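/- **Setting.** Let $\Sigma$ be a compact smooth manifold of dimension $n\ge 1$ with (possibly empty) boundary $\partial\Sigma$, with a smooth positive volume $d^nx$ on $\Sigma$ and a smooth positive volume on $\partial\Sigma$. A *local* operator is one whose value at $x$ is, in charts, a smooth function of $x$ (and possibly $t$) and of finitely many spatial derivatives of the fields at $x$; *functionals* are integrals over $\Sigma$ of local densities plus integrals over $\partial\Sigma$ of local densities. The functional derivative $\delta F/\delta\varphi$ is the local operator with $\delta F=\int_\Sigma \frac{\delta F}{\delta\varphi}\,\delta\varphi$ for all variations vanishing near $\partial\Sigma$. Consider smooth fields $z^A(t,x)$, $A=1,\dots,N$, and Lagrange multipliers $\lambda^a(t,x)$, $a=1,\dots,m$, with the action $$S[z,\lambda]=\int dt\Big\{\int_\Sigma \tfrac12 z^A\sigma_{AB}\dot z^B-H[z,\lambda]\Big\},\qquad H[z,\lambda]=\int_\Sigma\big(h(z)+\lambda^a\phi_a(z)\big)+\oint_{\partial\Sigma}b(z,\lambda),$$ where $\sigma_{AB}$ is the inverse of a constant antisymmetric invertible matrix $\sigma^{AB}$, and $h,\phi_a,b$ are local. The $\phi_a$ and $h$ are first class: the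 brackets $\{\phi_a(x),\int\xi^b\phi_b\}$ (all smooth $\xi$) and $\{\phi_a(x),\int h\}$ are linear combinations, with local coefficients, of the constraints and their derivatives at $x$. *Boundary conditions.* Let $\chi^\alpha_I(z,\lambda)$ be local, time-independent operators; the internal boundary conditions are $\chi_I^\alpha|_{\partial\Sigma}=\zeta^\alpha$. The external boundary conditions require that $\phi_a$, $\dot z^A-\sigma^{AB}\frac{\delta H}{\delta z^B}$ and all their spatial derivatives vanish on $\partial\Sigma$. A smooth history is *admissible* on $[t_0,t_1]$ if it satisfies the external boundary conditions at all these times. A variation of an admissible history *preserves the internal boundary conditions* if the induced variations of the external boundary conditions and of $\chi_I^\alpha$ vanish on $\partial\Sigma$ at all these times. Assume that $\delta H=\int_\Sigma(\frac{\delta H}{\delta z^A}\delta z^A+\phi_a\,\delta\lambda^a)$ for all such variations. *Couples.* Let $k\ge0$, let $G[t,z,\lambda,\dot\lambda,\dots,\overset{(k)}{\lambda}]$ be a functional ($z$ and the $\overset{(l)}\lambda$ being independent arguments), let $\Lambda^a(t,z,\lambda,\dot\lambda,\dots,\overset{(k)}{\lambda})$ be local, and let $\delta_G z^A=Z^A:=\sigma^{AB}\frac{\delta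 G}{\delta z^B}$, $\delta_G\lambda^a=\delta_G^\lambda\lambda^a=\Lambda^a$. Assume that for all variations $\delta$ preserving the internal boundary conditions $$\delta G=\int_\Sigma\Big(\frac{\delta G}{\delta z^A}\delta z^A+\sum_{l=0}^k\frac{\delta G}{\delta\overset{(l)}{\lambda^a}}\,\delta\overset{(l)}{\lambda^a}\Big),\qquad [\delta_G,\delta]\chi_I^\alpha|_{\partial\Sigma}=0,$$ the second condition meaning $\delta(\delta_G\chi^\alpha_I)|_{\partial\Sigma}=0$, as $\delta\chi_I^\alpha|_{\partial\Sigma}=0$. *External symmetry.* The couple $(G,\delta^\lambda_G)$ generates an external symmetry of the action if there are a functional $U[t,z,\lambda,\dots,\overset{(k)}\lambda]$ and a local boundary term $\oint_{\partial\Sigma}V_G(t,z,\lambda,\dot\lambda,\dots)$ such that on every interval $[t_0,t_1]$, for all histories admissible there, $$\delta_G S=\int_{t_0}^{t_1} dt\Big\{\frac{d}{dt}U+\oint_{\partial\Sigma}V_G\Big\},\qquad \delta\oint_{\partial\Sigma}V_G=0$$ for all $\delta$ preserving the internal boundary conditions, and such that $G$ is its canonical generator, $G=\int_\Sigma\frac12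 z^A\sigma_{AB}Z^B-U$. **Corollary.** If the couple $(G,\delta^\lambda_G)$ generates an external symmetry of the action, then $$\frac{\delta G}{\delta\overset{(l)}{\lambda^a}}\approx0\qquad\text{for all } l=0,\dots,k \text{ and all } a,$$ that is: at every time $t$ lying in an interval on which some admissible history exists, these functional derivatives vanish at all points of $\Sigma$ for all smooth $(z,\lambda,\dot\lambda,\dots,\overset{(k)}\lambda)$ with $\phi_a(z)=0$ on $\Sigma$. -/

import Mathlib

open scoped Manifold ContDiff

noncomputable section

namespace ExtSym

/-! ## Local operators on a compact manifold with boundary -/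

section Local

variable {n : ℕ} [NeZero n] {M : Type*} [TopologicalSpace M]
  [ChartedSpace (EuclideanHalfSpace n) M]
  {V : Type*} [NormedAddCommGroup V] [NormedSpace ℝ V]
  {W : Type*} [NormedAddCommGroup W] [NormedSpace ℝ W]

/-- A smooth `V`-valued field on the manifold with boundary `M`. -/
def SmoothField (n : ℕ) [NeZero n] {M : Type*} [TopologicalSpace M]
    [ChartedSpace (EuclideanHalfSpace n) M] {V : Type*} [NormedAddCommGroup V] [NormedSpace ℝ V]
    (f : M → V) : Prop :=
  ContMDiff (𝓡∂ n) 𝓘(ℝ, V) ∞ f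

/-- A smooth history `y t x` (`t` the time, `x` the point of space). -/
def SmoothHistory (n : ℕ) [NeZero n] {M : Type*} [TopologicalSpace M]
    [ChartedSpace (EuclideanHalfSpace n) M] {V : Type*} [NormedAddCommGroup V] [NormedSpace ℝ V]
    (y : ℝ → M → V) : Prop :=
  ContMDiff (𝓘(ℝ, ℝ).prod (𝓡∂ n)) 𝓘(ℝ, V) ∞ (fun p : ℝ × M => y p.1 p.2)

/-- Values of all partial derivatives of order at most `k` (as symmetric multilinear forms). -/
abbrev JetSpace (n k : ℕ) (V : Type*) [NormedAddCommGroup V] [NormedSpace ℝ V] : Type _ :=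
  (j : Fin (k + 1)) →
    ContinuousMultilinearMap ℝ (fun _ : Fin (j : ℕ) => EuclideanSpace ℝ (Fin n)) V

/-- The partial derivatives of order `j` at `x` of the field `f`, in the chart at `c`. -/
def chartDeriv (n : ℕ) [NeZero n] {M : Type*} [TopologicalSpace M]
    [ChartedSpace (EuclideanHalfSpace n) M] {V : Type*} [NormedAddCommGroup V] [NormedSpace ℝ V]
    (c : M) (j : ℕ) (f : M → V) (x : M) :
    ContinuousMultilinearMap ℝ (fun _ : Fin j => EuclideanSpace ℝ (Fin n)) V :=
  iteratedFDerivWithin ℝ j (f ∘ (extChartAt (𝓡∂ n) c).symm) (Set.range (𝓡∂ n))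
    (extChartAt (𝓡∂ n) c x)

/-- `L`, an operator that may depend explicitly on the time, is local: in every chart its value
at `x` is a smooth function of the time, of the coordinates of `x` and of finitely many partial
derivatives of the field at `x`. -/
def IsLocal (n : ℕ) [NeZero n] {M : Type*} [TopologicalSpace M]
    [ChartedSpace (EuclideanHalfSpace n) M] {V : Type*} [NormedAddCommGroup V] [NormedSpace ℝ V]
    {W : Type*} [NormedAddCommGroup W] [NormedSpace ℝ W]
    (L : ℝ → (M → V) → M → W) : Prop :=
  ∃ k : ℕ, ∀ c : M, ∃ F : ℝ × EuclideanSpace ℝ (Fin n) × JetSpace n k V → W,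
    ContDiffOn ℝ ∞ F (Set.univ ×ˢ (extChartAt (𝓡∂ n) c).target ×ˢ Set.univ) ∧
    ∀ (t : ℝ) (f : M → V), SmoothField n f → ∀ x ∈ (extChartAt (𝓡∂ n) c).source,
      L t f x = F (t, extChartAt (𝓡∂ n) c x, fun j => chartDeriv n c j f x)

/-- All partial derivatives of `f`, including `f` itself, vanish at `x`. -/
def FlatAt (n : ℕ) [NeZero n] {M : Type*} [TopologicalSpace M]
    [ChartedSpace (EuclideanHalfSpace n) M] {V : Type*} [NormedAddCommGroup V] [NormedSpace ℝ V]
    (f : M → V) (x : M) : Prop :=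
  ∀ j : ℕ, chartDeriv n x j f x = 0

variable [MeasurableSpace M]

/-- `μ` is given in every chart by a smooth positive density times `dⁿx`. -/
def IsSmoothVolume (n : ℕ) [NeZero n] {M : Type*} [TopologicalSpace M]
    [ChartedSpace (EuclideanHalfSpace n) M] [MeasurableSpace M]
    (μ : MeasureTheory.Measure M) : Prop :=
  ∀ c : M, ∃ ρ : EuclideanSpace ℝ (Fin n) → ℝ,
    ContDiffOn ℝ ∞ ρ (extChartAt (𝓡∂ n) c).target ∧
    (∀ u ∈ (extChartAt (𝓡∂ n) c).target, 0 < ρ u) ∧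
    (μ.restrict (extChartAt (𝓡∂ n) c).source).map (extChartAt (𝓡∂ n) c) =
      (MeasureTheory.volume.restrict (extChartAt (𝓡∂ n) c).target).withDensity
        (fun u => ENNReal.ofReal (ρ u))

/-- `ν` is carried by the boundary, and is given there in every chart by a smooth positive
density times the `(n-1)`-dimensional area. -/
def IsSmoothBoundaryVolume (n : ℕ) [NeZero n] {M : Type*} [TopologicalSpace M]
    [ChartedSpace (EuclideanHalfSpace n) M] [MeasurableSpace M]
    (ν : MeasureTheory.Measure M) : Prop :=
  ∀ c : M, ∃ ρ : EuclideanSpace ℝ (Fin n) → ℝ,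
    ContDiffOn ℝ ∞ ρ (extChartAt (𝓡∂ n) c).target ∧
    (∀ u ∈ (extChartAt (𝓡∂ n) c).target, 0 < ρ u) ∧
    (ν.restrict (extChartAt (𝓡∂ n) c).source).map (extChartAt (𝓡∂ n) c) =
      ((MeasureTheory.Measure.hausdorffMeasure ((n : ℝ) - 1)).restrict
        ((extChartAt (𝓡∂ n) c).target ∩ frontier (Set.range (𝓡∂ n)))).withDensity
        (fun u => ENNReal.ofReal (ρ u))

/-- A functional of `V`-valued fields: the integral of a local bulk density plus the integral of
a local boundary density. -/
structure LocalFunctional (n : ℕ) [NeZero n] (M : Type*) [TopologicalSpace M]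
    [ChartedSpace (EuclideanHalfSpace n) M] (V : Type*) [NormedAddCommGroup V]
    [NormedSpace ℝ V] where
  bulk : ℝ → (M → V) → M → ℝ
  bdry : ℝ → (M → V) → M → ℝ
  bulk_local : IsLocal n bulk
  bdry_local : IsLocal n bdry

/-- The value of a functional at time `t` on the field `C`. -/
def LocalFunctional.val (G : LocalFunctional n M V) (μ ν : MeasureTheory.Measure M)
    (t : ℝ) (C : M → V) : ℝ :=
  (∫ x, G.bulk t C x ∂μ) + ∫ x, G.bdry t C x ∂ν

/-- `E` is the functional derivative of `F`: the local operator with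
`δF = ∫ E (δC)` for all variations `δC` that vanish near the boundary. It is unique. -/
def IsFunctionalDerivative (n : ℕ) [NeZero n] {M : Type*} [TopologicalSpace M]
    [ChartedSpace (EuclideanHalfSpace n) M] [MeasurableSpace M]
    {V : Type*} [NormedAddCommGroup V] [NormedSpace ℝ V] (μ : MeasureTheory.Measure M)
    (F : ℝ → (M → V) → ℝ) (E : ℝ → (M → V) → M → (V →L[ℝ] ℝ)) : Prop :=
  IsLocal n E ∧
  ∀ (t : ℝ) (C η : M → V), SmoothField n C → SmoothField n η →
    tsupport η ⊆ (𝓡∂ n).interior M →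
    HasDerivAt (fun s : ℝ => F t (C + s • η)) (∫ x, E t C x (η x) ∂μ) 0

end Local

/-! ## Field values -/

/-- Values of the canonical variables `z^A`. -/
abbrev ZVal (N : ℕ) : Type := Fin N → ℝ

/-- Values of the pair `(z^A, λ^a)`. -/
abbrev ZLVal (N m : ℕ) : Type := ZVal N × (Fin m → ℝ)

/-- Values of `(z^A, λ^a, dλ^a/dt, …, d^kλ^a/dt^k)`, all regarded as independent. -/
abbrev JVal (N m k : ℕ) : Type := ZVal N × (Fin (k + 1) → Fin m → ℝ)

/-- The `z`-part of a history. -/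
def zPart {M : Type*} {N m : ℕ} (y : M → ZLVal N m) : M → ZVal N := fun x => (y x).1

/-- The velocity `dz/dt` of a history. -/
def zDot {M : Type*} {N m : ℕ} (y : ℝ → M → ZLVal N m) (t : ℝ) (x : M) : ZVal N :=
  deriv (fun τ => (y τ x).1) t

/-- The configuration `(z, λ, dλ/dt, …, d^kλ/dt^k)` of a history at time `t`. -/
def jetAt {M : Type*} {N m : ℕ} (k : ℕ) (y : ℝ → M → ZLVal N m) (t : ℝ) : M → JVal N m k :=
  fun x => ((y t x).1, fun l => iteratedDeriv (l : ℕ) (fun τ => (y τ x).2) t)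

/-- The vector with components `σ^{AB} e_B`. -/
def sharp {N : ℕ} (sig : Matrix (Fin N) (Fin N) ℝ) (e : ZVal N →L[ℝ] ℝ) : ZVal N :=
  fun A => ∑ B, sig A B * e (Pi.single B 1)

/-! ## Gauge field theories -/

section Theory

variable {n : ℕ} [NeZero n] {M : Type*} [TopologicalSpace M]
  [ChartedSpace (EuclideanHalfSpace n) M] [MeasurableSpace M] {N m r k : ℕ}

/-- The data of a Hamiltonian gauge field theory
`S[z, λ] = ∫ dt { ∫ ½ z^A σ_{AB} dz^B/dt - H[z, λ] }`,
`H[z, λ] = ∫ (h(z) + λ^a φ_a(z)) + ∮ b(z, λ)`,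
with internal boundary conditions `χ^α(z, λ) = ζ^α` on the boundary. -/
structure TheoryData (n : ℕ) [NeZero n] (M : Type*) [TopologicalSpace M]
    [ChartedSpace (EuclideanHalfSpace n) M] [MeasurableSpace M] (N m r : ℕ) where
  vol : MeasureTheory.Measure M
  bvol : MeasureTheory.Measure M
  vol_smooth : IsSmoothVolume n vol
  bvol_smooth : IsSmoothBoundaryVolume n bvol
  /-- the matrix `σ^{AB}` -/
  sig : Matrix (Fin N) (Fin N) ℝ
  sig_antisymm : sig.transpose = -sig
  sig_isUnit : IsUnit sig
  h : (M → ZVal N) → M → ℝ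
  h_local : IsLocal n (fun _ : ℝ => h)
  φ : (M → ZVal N) → M → Fin m → ℝ
  φ_local : IsLocal n (fun _ : ℝ => φ)
  b : (M → ZLVal N m) → M → ℝ
  b_local : IsLocal n (fun _ : ℝ => b)
  χ : (M → ZLVal N m) → M → Fin r → ℝ
  χ_local : IsLocal n (fun _ : ℝ => χ)
  /-- the functional derivative of `∫ h(z)` -/
  dh : (M → ZVal N) → M → (ZVal N →L[ℝ] ℝ)
  dh_spec : IsFunctionalDerivative n vol (fun _ z => ∫ x, h z x ∂vol) (fun _ => dh)
  /-- the functional derivative of `∫ ξ^a φ_a(z)` with respect to `(z, ξ)` -/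
  dφ : (M → ZLVal N m) → M → (ZLVal N m →L[ℝ] ℝ)
  dφ_spec : IsFunctionalDerivative n vol
    (fun _ w => ∫ x, ∑ a, (w x).2 a * φ (zPart w) x a ∂vol) (fun _ => dφ)

namespace TheoryData

variable (T : TheoryData n M N m r)

/-- The Hamiltonian `H[z, λ]`. -/
def H (w : M → ZLVal N m) : ℝ :=
  (∫ x, (T.h (zPart w) x + ∑ a, (w x).2 a * T.φ (zPart w) x a) ∂T.vol) + ∫ x, T.b w x ∂T.bvol

/-- `δ(∫ ξ^a φ_a)/δz^A`. -/
def dφz (w : M → ZLVal N m) (x : M) : ZVal N →L[ℝ] ℝ :=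
  (T.dφ w x).comp (ContinuousLinearMap.inl ℝ (ZVal N) (Fin m → ℝ))

/-- `δH/δz^A`. -/
def dHz (w : M → ZLVal N m) (x : M) : ZVal N →L[ℝ] ℝ :=
  T.dh (zPart w) x + T.dφz w x

/-- The Hamiltonian vector field `σ^{AB} δH/δz^B`. -/
def flow (w : M → ZLVal N m) (x : M) : ZVal N := sharp T.sig (T.dHz w x)

/-- The action on the time interval `[t₀, t₁]`. -/
def action (t₀ t₁ : ℝ) (y : ℝ → M → ZLVal N m) : ℝ :=
  ∫ t in t₀..t₁,
    ((∫ x, (1 / 2 : ℝ) * ((y t x).1 ⬝ᵥ (T.sig⁻¹).mulVec (zDot y t x)) ∂T.vol) - T.H (y t))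

/-- A smooth history that satisfies the external boundary conditions for all times in
`[t₀, t₁]`: the equations of motion and all their spatial derivatives hold on the boundary. -/
structure Admissible (t₀ t₁ : ℝ) (y : ℝ → M → ZLVal N m) : Prop where
  smooth : SmoothHistory n y
  constraints : ∀ t ∈ Set.Icc t₀ t₁, ∀ x ∈ (𝓡∂ n).boundary M, FlatAt n (T.φ (zPart (y t))) x
  motion : ∀ t ∈ Set.Icc t₀ t₁, ∀ x ∈ (𝓡∂ n).boundary M,
    FlatAt n (fun x' => zDot y t x' - T.flow (y t) x') x

/-- The variation `v` of the history `y` preserves the internal boundary conditions on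
`[t₀, t₁]`: the induced variations of the external boundary conditions and of `χ^α` vanish on the
boundary. -/
structure PreservesInternal (t₀ t₁ : ℝ) (y v : ℝ → M → ZLVal N m) : Prop where
  smooth : SmoothHistory n v
  constraints : ∀ t ∈ Set.Icc t₀ t₁, ∀ x ∈ (𝓡∂ n).boundary M,
    FlatAt n (fun x' => deriv (fun s : ℝ => T.φ (zPart (y t + s • v t)) x') 0) x
  motion : ∀ t ∈ Set.Icc t₀ t₁, ∀ x ∈ (𝓡∂ n).boundary M,
    FlatAt n (fun x' => deriv (fun s : ℝ =>
      zDot (y + s • v) t x' - T.flow (y t + s • v t) x') 0) x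
  internal : ∀ t ∈ Set.Icc t₀ t₁, ∀ x ∈ (𝓡∂ n).boundary M,
    deriv (fun s : ℝ => T.χ (y t + s • v t) x) 0 = 0

/-- The constraints are first class: the bracket of `φ_a` with `∫ ξ^b φ_b` is a linear combination
of the constraints and their derivatives, with local coefficients. -/
def ConstraintsFirstClass : Prop :=
  ∃ C : (M → ZLVal N m × (Fin m → ℝ)) → M → Fin m → ℝ,
    IsLocal n (fun _ : ℝ => C) ∧
    (∀ (w : M → ZLVal N m) (ψ ψ' : M → Fin m → ℝ) (c : ℝ), SmoothField n w →
      SmoothField n ψ → SmoothField n ψ' → ∀ x,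
      C (fun x' => (w x', c • ψ x' + ψ' x')) x
        = c • C (fun x' => (w x', ψ x')) x + C (fun x' => (w x', ψ' x')) x) ∧
    ∀ w : M → ZLVal N m, SmoothField n w → ∀ x,
      HasDerivAt (fun s : ℝ => T.φ (zPart w + s • fun x' => sharp T.sig (T.dφz w x')) x)
        (C (fun x' => (w x', T.φ (zPart w) x')) x) 0

/-- `h` is first class: the bracket of `φ_a` with `∫ h` is a linear combination of the
constraints and their derivatives, with local coefficients. -/
def HamiltonianFirstClass : Prop :=
  ∃ C : (M → ZVal N × (Fin m → ℝ)) → M → Fin m → ℝ,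
    IsLocal n (fun _ : ℝ => C) ∧
    (∀ (z : M → ZVal N) (ψ ψ' : M → Fin m → ℝ) (c : ℝ), SmoothField n z →
      SmoothField n ψ → SmoothField n ψ' → ∀ x,
      C (fun x' => (z x', c • ψ x' + ψ' x')) x
        = c • C (fun x' => (z x', ψ x')) x + C (fun x' => (z x', ψ' x')) x) ∧
    ∀ z : M → ZVal N, SmoothField n z → ∀ x,
      HasDerivAt (fun s : ℝ => T.φ (z + s • fun x' => sharp T.sig (T.dh z x')) x)
        (C (fun x' => (z x', T.φ z x')) x) 0

/-- The total Hamiltonian has a well-defined variation: no boundary term appears in `δH` for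
variations that preserve the internal boundary conditions. -/
def HamiltonianDifferentiable : Prop :=
  ∀ t₀ t₁ : ℝ, t₀ < t₁ → ∀ y v : ℝ → M → ZLVal N m, T.Admissible t₀ t₁ y →
    T.PreservesInternal t₀ t₁ y v → ∀ t ∈ Set.Icc t₀ t₁,
    HasDerivAt (fun s : ℝ => T.H (y t + s • v t))
      (∫ x, (T.dHz (y t) x (v t x).1 + ∑ a, T.φ (zPart (y t)) x a * (v t x).2 a) ∂T.vol) 0

/-- The standing assumptions on a gauge field theory. -/
structure IsGaugeFieldTheory : Prop where
  constraints_firstClass : T.ConstraintsFirstClass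
  hamiltonian_firstClass : T.HamiltonianFirstClass
  hamiltonian_differentiable : T.HamiltonianDifferentiable

/-! ## Couples `(G, δ^λ_G)` and external symmetries -/

/-- `Z^A = σ^{AB} δG/δz^B`. -/
def genZ (dG : ℝ → (M → JVal N m k) → M → (JVal N m k →L[ℝ] ℝ)) (t : ℝ) (C : M → JVal N m k)
    (x : M) : ZVal N :=
  sharp T.sig ((dG t C x).comp (ContinuousLinearMap.inl ℝ (ZVal N) (Fin (k + 1) → Fin m → ℝ)))

/-- The transformation `δ_G z^A = Z^A`, `δ_G λ^a = Λ^a`, evaluated on a history. -/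
def transf (dG : ℝ → (M → JVal N m k) → M → (JVal N m k →L[ℝ] ℝ))
    (Λ : ℝ → (M → JVal N m k) → M → Fin m → ℝ) (y : ℝ → M → ZLVal N m) : ℝ → M → ZLVal N m :=
  fun t x => (T.genZ dG t (jetAt k y t) x, Λ t (jetAt k y t) x)

/-- The conditions on a couple `(G, δ^λ_G)`: for variations that preserve the internal boundary
conditions, `δG` has no boundary term, and the variation `δ_G χ^α` of the boundary sources does
not change (this is `[δ_G, δ] χ^α = 0`, because `δ χ^α = 0`). -/
structure IsCouple (G : LocalFunctional n M (JVal N m k))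
    (dG : ℝ → (M → JVal N m k) → M → (JVal N m k →L[ℝ] ℝ))
    (Λ : ℝ → (M → JVal N m k) → M → Fin m → ℝ) : Prop where
  sources : ∀ t₀ t₁ : ℝ, t₀ < t₁ → ∀ y v : ℝ → M → ZLVal N m, T.Admissible t₀ t₁ y →
    T.PreservesInternal t₀ t₁ y v → ∀ t ∈ Set.Icc t₀ t₁, ∀ x ∈ (𝓡∂ n).boundary M,
    HasDerivAt (fun s : ℝ =>
      deriv (fun u : ℝ => T.χ ((y + s • v) t + u • T.transf dG Λ (y + s • v) t) x) 0) 0 0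
  differentiable : ∀ t₀ t₁ : ℝ, t₀ < t₁ → ∀ y v : ℝ → M → ZLVal N m, T.Admissible t₀ t₁ y →
    T.PreservesInternal t₀ t₁ y v → ∀ t ∈ Set.Icc t₀ t₁,
    HasDerivAt (fun s : ℝ => G.val T.vol T.bvol t (jetAt k (y + s • v) t))
      (∫ x, dG t (jetAt k y t) x (jetAt k v t x) ∂T.vol) 0

/-- `(G, δ^λ_G)` generates an external symmetry: there are a functional `U` and a boundary term
`∮ V`, invariant under variations that preserve the internal boundary conditions, with
`δ_G S = ∫ dt { dU/dt + ∮ V }`, and `G = ∫ ½ z^A σ_{AB} Z^B - U`. -/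
def IsExternalSymmetry (G : LocalFunctional n M (JVal N m k))
    (dG : ℝ → (M → JVal N m k) → M → (JVal N m k →L[ℝ] ℝ))
    (Λ : ℝ → (M → JVal N m k) → M → Fin m → ℝ) : Prop :=
  ∃ (U : LocalFunctional n M (JVal N m k)) (k' : ℕ) (V : ℝ → (M → JVal N m k') → M → ℝ),
    IsLocal n V ∧
    (∀ t₀ t₁ : ℝ, t₀ < t₁ → ∀ y v : ℝ → M → ZLVal N m, T.Admissible t₀ t₁ y →
      T.PreservesInternal t₀ t₁ y v → ∀ t ∈ Set.Icc t₀ t₁,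
      HasDerivAt (fun s : ℝ => ∫ x, V t (jetAt k' (y + s • v) t) x ∂T.bvol) 0 0) ∧
    (∀ t₀ t₁ : ℝ, t₀ < t₁ → ∀ y : ℝ → M → ZLVal N m, T.Admissible t₀ t₁ y →
      HasDerivAt (fun s : ℝ => T.action t₀ t₁ (y + s • T.transf dG Λ y))
        (U.val T.vol T.bvol t₁ (jetAt k y t₁) - U.val T.vol T.bvol t₀ (jetAt k y t₀)
          + ∫ t in t₀..t₁, ∫ x, V t (jetAt k' y t) x ∂T.bvol) 0) ∧
    ∀ (t : ℝ) (C : M → JVal N m k), SmoothField n C →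
      G.val T.vol T.bvol t C =
        (∫ x, (1 / 2 : ℝ) * ((C x).1 ⬝ᵥ (T.sig⁻¹).mulVec (T.genZ dG t C x)) ∂T.vol)
          - U.val T.vol T.bvol t C

/-- Some history satisfies the external boundary conditions on a time interval containing `t`. -/
def HasHistoryAt (t : ℝ) : Prop :=
  ∃ t₀ t₁ : ℝ, t₀ < t₁ ∧ t ∈ Set.Icc t₀ t₁ ∧ ∃ y : ℝ → M → ZLVal N m, T.Admissible t₀ t₁ y

/-- `X ≈ 0`: at every time for which the theory has histories, `X` vanishes at all points for all
configurations on the constraint surface `φ_a(z) = 0`. -/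
def WeaklyZero (X : ℝ → (M → JVal N m k) → M → ℝ) : Prop :=
  ∀ t : ℝ, T.HasHistoryAt t → ∀ C : M → JVal N m k, SmoothField n C →
    (∀ x, T.φ (fun x' => (C x').1) x = 0) → ∀ x, X t C x = 0

end TheoryData

end Theory

end ExtSym

end

/-!
The proof varies the conservation law of the external symmetry.

Differentiating `δ_G S = ∫ dt {dU/dt + ∮ V}` in the upper end of the time interval, and using that
`G = ∫ ½ z σ Z - U`, one finds along every admissible history `y`
`dG/dt = ∫ (δG/δz) dz/dt + δ_G H + ∮ V` (`hasDerivAt_generator`). Admissibility restricts a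
history only near the boundary, so this law may be varied freely in the interior, where neither
the boundary term of `H` nor `∮ V` contributes. Vary only `λ^a`, by `(t - τ)^(l+1) / (l+1)! · η(x)`
with `η` supported in the interior. At time `τ` the history itself does not change, only the
derivative of order `l + 1` of `λ^a` does, and since `(δH/δz) σ g = - g σ (δH/δz)` the varied law
reads (`deriv_pairing_eq`, `multiplier_recursion`)
`a_l + d(a_{l+1})/dt = R_{l+1}`, `a_{k+1} = 0`.
Here `a_l` is the integral of `η δG/δλ^a^{(l)}` over `Σ`, and `R_{l+1}`
(`recursionSource`) is linear in `dz/dt - σ δH/δz` and in the constraints, evaluated on the support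
of `η`.

It remains to find, for a configuration `C` on the constraint surface, an admissible history that
passes through `C` near a given interior point and for which the sources vanish there to order
`k + 1` in time; then `eq_zero_of_recursion` gives `a_l = 0` for all `l`. The equations of motion
can be solved to any finite order by a polynomial in time (`exists_solution_to_order`), and because
`φ_a` and `h` are first class the constraints then hold to the same order
(`vanishesTo_constraints`). A cutoff in space glues this formal solution into the given admissible
history (`exists_admissible_to_order`). The fundamental lemma of the calculus of variations
(`eq_zero_of_forall_integral_mul_eq_zero`) turns `a_l = 0` for all `η` into the pointwise
statement, and continuity extends it from interior points and interior times to the boundary of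
`Σ` and to the ends of the time interval.

All operators in play are local. They are treated through `SmoothFamily`, joint smoothness in the
point and in finitely many parameters: local operators preserve smooth families
(`IsLocal.smoothFamily`), and at a given point a local operator is a smooth function of a jet
(`IsLocal.exists_jet`), so that differentiation in time and in the parameters of a variation is
ordinary calculus.
-/

noncomputable section

namespace ExtSym

open Set MeasureTheory

set_option linter.unusedSectionVars false

/-! ### Smooth families of fields -/

section Families

variable {n : ℕ} [NeZero n] {M : Type*} [TopologicalSpace M]
  [ChartedSpace (EuclideanHalfSpace n) M]
  {E : Type*} [NormedAddCommGroup E] [NormedSpace ℝ E]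
  {E' : Type*} [NormedAddCommGroup E'] [NormedSpace ℝ E']
  {V : Type*} [NormedAddCommGroup V] [NormedSpace ℝ V]
  {W : Type*} [NormedAddCommGroup W] [NormedSpace ℝ W]

/-- A family of `V`-valued fields on `M`, jointly smooth in the point and in a parameter that
ranges over a normed space. A smooth history is a smooth family over `ℝ`. -/
def SmoothFamily (n : ℕ) [NeZero n] {M : Type*} [TopologicalSpace M]
    [ChartedSpace (EuclideanHalfSpace n) M] {E : Type*} [NormedAddCommGroup E] [NormedSpace ℝ E]
    {V : Type*} [NormedAddCommGroup V] [NormedSpace ℝ V] (f : E → M → V) : Prop :=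
  ContMDiff (𝓘(ℝ, E).prod (𝓡∂ n)) 𝓘(ℝ, V) ∞ (fun p : E × M => f p.1 p.2)

theorem SmoothFamily.comp_param {f : E → M → V} (hf : SmoothFamily n f) {g : E' → E}
    (hg : ContDiff ℝ ∞ g) : SmoothFamily n (fun p => f (g p)) :=
  ContMDiff.comp (I' := 𝓘(ℝ, E).prod (𝓡∂ n)) (f := fun p : E' × M => (g p.1, p.2)) hf
    ((hg.contMDiff.comp contMDiff_fst).prodMk contMDiff_snd)

theorem SmoothFamily.field {f : E → M → V} (hf : SmoothFamily n f) (p : E) :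
    SmoothField n (f p) :=
  ContMDiff.comp (I' := 𝓘(ℝ, E).prod (𝓡∂ n)) (f := fun x : M => (p, x)) hf
    (contMDiff_const.prodMk contMDiff_id)

theorem SmoothField.family {f : M → V} (hf : SmoothField n f) :
    SmoothFamily n (fun _ : E => f) :=
  ContMDiff.comp (I' := 𝓡∂ n) (f := fun x : E × M => x.2) hf contMDiff_snd

theorem SmoothFamily.of_contDiff {g : E → V} (hg : ContDiff ℝ ∞ g) :
    SmoothFamily n (fun p (_ : M) => g p) :=
  hg.contMDiff.comp contMDiff_fst

theorem SmoothFamily.at {f : E → M → V} (hf : SmoothFamily n f) (x : M) :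
    ContDiff ℝ ∞ (fun p => f p x) := by
  rw [← contMDiff_iff_contDiff]
  exact ContMDiff.comp (I' := 𝓘(ℝ, E).prod (𝓡∂ n)) (f := fun p : E => (p, x)) hf
    (contMDiff_id.prodMk contMDiff_const)

theorem SmoothFamily.post {f : E → M → V} (hf : SmoothFamily n f) {g : V → W}
    (hg : ContDiff ℝ ∞ g) : SmoothFamily n (fun p x => g (f p x)) :=
  hg.contMDiff.comp hf

theorem SmoothFamily.prodMk {f : E → M → V} {g : E → M → W} (hf : SmoothFamily n f)
    (hg : SmoothFamily n g) : SmoothFamily n (fun p x => (f p x, g p x)) :=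
  ContMDiff.prodMk_space hf hg

theorem SmoothFamily.pi {ι : Type*} [Fintype ι] {f : E → M → ι → V}
    (h : ∀ i, SmoothFamily n (fun p x => f p x i)) : SmoothFamily n f :=
  contMDiff_pi_space.2 h

theorem SmoothFamily.add {f g : E → M → V} (hf : SmoothFamily n f)
    (hg : SmoothFamily n g) : SmoothFamily n (fun p x => f p x + g p x) :=
  (hf.prodMk hg).post contDiff_add

theorem SmoothFamily.sub {f g : E → M → V} (hf : SmoothFamily n f)
    (hg : SmoothFamily n g) : SmoothFamily n (fun p x => f p x - g p x) :=
  (hf.prodMk hg).post (contDiff_fst.sub contDiff_snd)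

theorem SmoothFamily.smul {c : E → M → ℝ} {g : E → M → V} (hc : SmoothFamily n c)
    (hg : SmoothFamily n g) : SmoothFamily n (fun p x => c p x • g p x) :=
  (hc.prodMk hg).post contDiff_smul

theorem SmoothFamily.mul {f g : E → M → ℝ} (hf : SmoothFamily n f)
    (hg : SmoothFamily n g) : SmoothFamily n (fun p x => f p x * g p x) :=
  (hf.prodMk hg).post contDiff_mul

theorem SmoothFamily.clm {f : E → M → V →L[ℝ] W} {g : E → M → V} (hf : SmoothFamily n f)
    (hg : SmoothFamily n g) : SmoothFamily n (fun p x => f p x (g p x)) :=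
  (hf.prodMk hg).post (contDiff_fst.clm_apply contDiff_snd)

theorem SmoothFamily.sum {ι : Type*} {s : Finset ι} {f : ι → E → M → V}
    (hf : ∀ i ∈ s, SmoothFamily n (f i)) : SmoothFamily n (fun p x => ∑ i ∈ s, f i p x) := by
  classical
  induction s using Finset.induction_on with
  | empty => simpa using SmoothFamily.of_contDiff (M := M) (n := n) (contDiff_const (c := (0 : V)))
  | insert a s ha ih =>
    simp_rw [Finset.sum_insert ha]
    exact (hf a (by simp)).add (ih fun i hi => hf i (by simp [hi]))

theorem SmoothFamily.continuous {f : E → M → V} (hf : SmoothFamily n f) :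
    Continuous (fun p : E × M => f p.1 p.2) :=
  ContMDiff.continuous hf

variable [IsManifold (𝓡∂ n) ∞ M]

/-- Smoothness of a family in charts of `M`, with the parameter kept global. -/
theorem smoothFamily_iff_charts {f : E → M → V} :
    SmoothFamily n f ↔ ∀ c : M,
      ContDiffOn ℝ ∞ (fun q : E × EuclideanSpace ℝ (Fin n) =>
        f q.1 ((extChartAt (𝓡∂ n) c).symm q.2)) (univ ×ˢ (extChartAt (𝓡∂ n) c).target) := by
  constructor
  · intro hf c
    rw [← contMDiffOn_iff_contDiffOn]
    have h2 : ContMDiffOn 𝓘(ℝ, E × EuclideanSpace ℝ (Fin n)) (𝓘(ℝ, E).prod (𝓡∂ n)) ∞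
        (fun q : E × EuclideanSpace ℝ (Fin n) => (q.1, (extChartAt (𝓡∂ n) c).symm q.2))
        (univ ×ˢ (extChartAt (𝓡∂ n) c).target) :=
      contDiff_fst.contMDiff.contMDiffOn.prodMk
        ((contMDiffOn_extChartAt_symm c).comp contDiff_snd.contMDiff.contMDiffOn
          (fun q hq => hq.2))
    exact ContMDiff.comp_contMDiffOn (I' := 𝓘(ℝ, E).prod (𝓡∂ n)) hf h2
  · intro h ⟨p, x⟩
    have h2 : ContMDiffOn (𝓘(ℝ, E).prod (𝓡∂ n)) 𝓘(ℝ, E × EuclideanSpace ℝ (Fin n)) ∞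
        (fun q : E × M => (q.1, extChartAt (𝓡∂ n) x q.2))
        (univ ×ˢ (chartAt (EuclideanHalfSpace n) x).source) :=
      contMDiffOn_fst.prodMk_space
        (contMDiffOn_extChartAt.comp contMDiffOn_snd (fun q hq => hq.2))
    have h3 := (h x).contMDiffOn.comp h2 (fun q hq => ⟨mem_univ _,
      (extChartAt (𝓡∂ n) x).map_source (by simpa [extChartAt_source] using hq.2)⟩)
    have hn : univ ×ˢ (chartAt (EuclideanHalfSpace n) x).source ∈ nhds (p, x) :=
      prod_mem_nhds Filter.univ_mem (chart_source_mem_nhds _ x)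
    refine ((h3.contMDiffAt hn).congr_of_eventuallyEq ?_)
    filter_upwards [hn] with q hq
    simp only [Function.comp]
    rw [(extChartAt (𝓡∂ n) x).left_inv (by simpa [extChartAt_source] using hq.2)]

theorem uniqueDiffOn_univ_prod_target (c : M) :
    UniqueDiffOn ℝ ((univ : Set E) ×ˢ (extChartAt (𝓡∂ n) c).target) :=
  uniqueDiffOn_univ.prod (uniqueDiffOn_extChartAt_target c)

/-- The derivative of a slice `p ↦ g (p, u)` is the restriction of the full derivative. -/
theorem hasFDerivAt_slice {S : Set E'} {g : E × E' → W} (hg : ContDiffOn ℝ ∞ g (univ ×ˢ S))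
    (p : E) {u : E'} (hu : u ∈ S) :
    HasFDerivAt (fun p => g (p, u))
      ((fderivWithin ℝ g (univ ×ˢ S) (p, u)).comp (ContinuousLinearMap.inl ℝ E E')) p := by
  have h1 : HasFDerivWithinAt g (fderivWithin ℝ g (univ ×ˢ S) (p, u)) (univ ×ˢ S) (p, u) :=
    ((hg.differentiableOn (by simp)) _ ⟨mem_univ _, hu⟩).hasFDerivWithinAt
  have h2 : HasFDerivWithinAt (fun p : E => (p, u)) (ContinuousLinearMap.inl ℝ E E') univ p := by
    simpa using (hasFDerivAt_prodMk_left (𝕜 := ℝ) p u)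
  have hm : MapsTo (fun p : E => (p, u)) univ (univ ×ˢ S) := fun q _ => ⟨mem_univ _, hu⟩
  exact hasFDerivWithinAt_univ.1 (h1.comp p h2 hm)

/-- The derivative of a smooth family in its parameter is a smooth family. -/
theorem SmoothFamily.fderiv {f : E → M → V} (hf : SmoothFamily n f) :
    SmoothFamily n (fun p x => fderiv ℝ (fun p => f p x) p) := by
  rw [smoothFamily_iff_charts] at hf ⊢
  intro c
  have h1 := ((hf c).fderivWithin (m := ∞) (uniqueDiffOn_univ_prod_target c) (by simp)).clm_comp
    (contDiffOn_const (c := ContinuousLinearMap.inl ℝ E (EuclideanSpace ℝ (Fin n))))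
  refine h1.congr fun q hq => ?_
  exact (hasFDerivAt_slice (hf c) q.1 hq.2).fderiv

theorem SmoothFamily.differentiableAt {f : E → M → V} (hf : SmoothFamily n f) (p : E) (x : M) :
    DifferentiableAt ℝ (fun p => f p x) p :=
  (hf.at x).differentiable (by simp) p

theorem SmoothFamily.deriv {f : ℝ → M → V} (hf : SmoothFamily n f) :
    SmoothFamily n (fun t x => deriv (fun t => f t x) t) :=
  hf.fderiv.clm (SmoothFamily.of_contDiff contDiff_const)

/-- The partial derivative along a real parameter of a smooth family is a smooth family. -/
theorem SmoothFamily.deriv_right {f : E × ℝ → M → V} (hf : SmoothFamily n f) :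
    SmoothFamily n (fun (p : E × ℝ) x => _root_.deriv (fun s => f (p.1, s) x) p.2) := by
  have h := hf.fderiv.clm (SmoothFamily.of_contDiff (contDiff_const (c := ((0 : E), (1 : ℝ)))))
  have h2 : (fun (p : E × ℝ) x => _root_.deriv (fun s => f (p.1, s) x) p.2) =
      fun p x => _root_.fderiv ℝ (fun p => f p x) p ((0 : E), (1 : ℝ)) := by
    funext p x
    have h1 : HasDerivAt (fun s : ℝ => (p.1, s)) ((0 : E), (1 : ℝ)) p.2 :=
      (hasDerivAt_const _ _).prodMk (hasDerivAt_id _)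
    exact ((hf.differentiableAt p x).hasFDerivAt.comp_hasDerivAt p.2 h1).deriv
  rw [h2]
  exact h

theorem SmoothFamily.iteratedDeriv {f : ℝ → M → V} (hf : SmoothFamily n f) (j : ℕ) :
    SmoothFamily n (fun t x => iteratedDeriv j (fun t => f t x) t) := by
  induction j with
  | zero => simpa using hf
  | succ j ih => simpa [iteratedDeriv_succ] using ih.deriv

/-! ### Jets of smooth families and local operators -/

/-- The derivative within `S` of a slice `u ↦ g (p, u)`. -/
theorem hasFDerivWithinAt_slice {S : Set E'} {g : E × E' → W}
    (hg : ContDiffOn ℝ ∞ g (univ ×ˢ S)) (p : E) {u : E'} (hu : u ∈ S) :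
    HasFDerivWithinAt (fun u => g (p, u))
      ((fderivWithin ℝ g (univ ×ˢ S) (p, u)).comp (ContinuousLinearMap.inr ℝ E E')) S u := by
  have h1 : HasFDerivWithinAt g (fderivWithin ℝ g (univ ×ˢ S) (p, u)) (univ ×ˢ S) (p, u) :=
    ((hg.differentiableOn (by simp)) _ ⟨mem_univ _, hu⟩).hasFDerivWithinAt
  have h2 : HasFDerivWithinAt (fun u : E' => (p, u)) (ContinuousLinearMap.inr ℝ E E') S u :=
    (hasFDerivAt_prodMk_right (𝕜 := ℝ) p u).hasFDerivWithinAt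
  have hm : MapsTo (fun u : E' => (p, u)) S (univ ×ˢ S) := fun q hq => ⟨mem_univ _, hq⟩
  exact h1.comp u h2 hm

/-- Symmetry of mixed partial derivatives, up to the boundary of `S`. -/
theorem hasDerivAt_fderivWithin_slice {S : Set E'} (hS : UniqueDiffOn ℝ S)
    (hS' : S ⊆ closure (interior S)) {g : ℝ × E' → W} (hg : ContDiffOn ℝ ∞ g (univ ×ˢ S))
    (t : ℝ) {u : E'} (hu : u ∈ S) :
    HasDerivAt (fun t => fderivWithin ℝ (fun u => g (t, u)) S u)
      (fderivWithin ℝ (fun u => deriv (fun t => g (t, u)) t) S u) t := by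
  have hΩ : UniqueDiffOn ℝ ((univ : Set ℝ) ×ˢ S) := uniqueDiffOn_univ.prod hS
  set D := fderivWithin ℝ g (univ ×ˢ S) with hD
  have hDs : ContDiffOn ℝ ∞ D (univ ×ˢ S) := hg.fderivWithin hΩ (by simp)
  have e1 : (fun t => fderivWithin ℝ (fun u => g (t, u)) S u) =
      fun t => (D (t, u)).comp (ContinuousLinearMap.inr ℝ ℝ E') := by
    funext t
    exact (hasFDerivWithinAt_slice hg t hu).fderivWithin (hS u hu)
  have e2 : EqOn (fun u => deriv (fun t => g (t, u)) t) (fun u => D (t, u) (1, 0)) S := by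
    intro u hu
    simpa using (hasFDerivAt_slice hg t hu).hasDerivAt.deriv
  have h3 := (hasFDerivWithinAt_slice hDs t hu)
  have h4 : HasFDerivWithinAt (fun u => D (t, u) (1, 0)) _ S u :=
    h3.clm_apply (hasFDerivWithinAt_const ((1 : ℝ), (0 : E')) u S)
  have h5 := (hasFDerivAt_slice hDs t hu).hasDerivAt.clm_comp
    (hasDerivAt_const t (ContinuousLinearMap.inr ℝ ℝ E'))
  have hsymm : IsSymmSndFDerivWithinAt ℝ g (univ ×ˢ S) (t, u) :=
    (hg (t, u) ⟨mem_univ _, hu⟩).isSymmSndFDerivWithinAt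
      (by simpa using WithTop.coe_le_coe.2 (le_top : (2 : ℕ∞) ≤ ⊤)) hΩ
      (by rw [interior_prod_eq, closure_prod_eq]; exact ⟨by simp, hS' hu⟩) ⟨mem_univ _, hu⟩
  rw [e1, fderivWithin_congr e2 (e2 hu), h4.fderivWithin (hS u hu)]
  convert h5 using 1
  ext v
  simpa using (hsymm (0, v) (1, 0))

/-- Near the target of a chart, derivatives within the half space may be taken within that target,
which is the set on which a family read in the chart is smooth. -/
theorem iteratedFDerivWithin_range_succ (c : M) (j : ℕ) (f : EuclideanSpace ℝ (Fin n) → V)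
    {u : EuclideanSpace ℝ (Fin n)} (hu : u ∈ (extChartAt (𝓡∂ n) c).target) :
    iteratedFDerivWithin ℝ (j + 1) f (Set.range (𝓡∂ n)) u =
      (continuousMultilinearCurryLeftEquiv ℝ (fun _ : Fin (j + 1) => EuclideanSpace ℝ (Fin n))
        V).symm (_root_.fderivWithin ℝ (iteratedFDerivWithin ℝ j f (Set.range (𝓡∂ n)))
          (extChartAt (𝓡∂ n) c).target u) := by
  rw [iteratedFDerivWithin_succ_eq_comp_left, Function.comp,
    fderivWithin_congr_set (extChartAt_target_eventuallyEq_of_mem hu)]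

theorem contDiffOn_iteratedFDerivWithin_param {f : E → M → V} (hf : SmoothFamily n f) (c : M)
    (j : ℕ) :
    ContDiffOn ℝ ∞ (fun q : E × EuclideanSpace ℝ (Fin n) =>
        iteratedFDerivWithin ℝ j (f q.1 ∘ (extChartAt (𝓡∂ n) c).symm) (Set.range (𝓡∂ n)) q.2)
      (univ ×ˢ (extChartAt (𝓡∂ n) c).target) := by
  induction j with
  | zero =>
    exact (continuousMultilinearCurryFin0 ℝ (EuclideanSpace ℝ (Fin n)) V).symm.contDiff
      |>.comp_contDiffOn (smoothFamily_iff_charts.1 hf c)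
  | succ j ih =>
    have h1 := (ih.fderivWithin (m := ∞) (uniqueDiffOn_univ_prod_target c) (by simp)).clm_comp
      (contDiffOn_const (c := ContinuousLinearMap.inr ℝ E (EuclideanSpace ℝ (Fin n))))
    refine ((continuousMultilinearCurryLeftEquiv ℝ (fun _ : Fin (j + 1) =>
      EuclideanSpace ℝ (Fin n)) V).symm.contDiff.comp_contDiffOn h1).congr fun q hq => ?_
    rw [iteratedFDerivWithin_range_succ c j _ hq.2]
    simp only [Function.comp]
    congr 1
    exact (hasFDerivWithinAt_slice ih q.1 hq.2).fderivWithin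
      (uniqueDiffOn_extChartAt_target c _ hq.2)

/-- Time derivatives commute with spatial jets. -/
theorem SmoothFamily.hasDerivAt_chartDeriv {f : ℝ → M → V} (hf : SmoothFamily n f) (c : M)
    (j : ℕ) (t : ℝ) {x : M} (hx : x ∈ (extChartAt (𝓡∂ n) c).source) :
    HasDerivAt (fun t => chartDeriv n c j (f t) x)
      (chartDeriv n c j (fun x => _root_.deriv (fun t => f t x) t) x) t := by
  suffices H : ∀ t, ∀ u ∈ (extChartAt (𝓡∂ n) c).target,
      HasDerivAt (fun t => iteratedFDerivWithin ℝ j (f t ∘ (extChartAt (𝓡∂ n) c).symm)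
        (Set.range (𝓡∂ n)) u)
      (iteratedFDerivWithin ℝ j ((fun x => _root_.deriv (fun t => f t x) t) ∘
        (extChartAt (𝓡∂ n) c).symm) (Set.range (𝓡∂ n)) u) t from
    H t _ ((extChartAt (𝓡∂ n) c).map_source hx)
  induction j with
  | zero =>
    intro t u hu
    exact (continuousMultilinearCurryFin0 ℝ (EuclideanSpace ℝ (Fin n))
      V).symm.toContinuousLinearEquiv.hasFDerivAt.comp_hasDerivAt t
        (hf.differentiableAt t _).hasDerivAt
  | succ j ih =>
    intro t u hu
    have h1 := contDiffOn_iteratedFDerivWithin_param hf c j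
    have h2 := hasDerivAt_fderivWithin_slice (uniqueDiffOn_extChartAt_target c)
      extChartAt_target_subset_closure_interior h1 t hu
    simp_rw [iteratedFDerivWithin_range_succ c j _ hu]
    have h3 := (continuousMultilinearCurryLeftEquiv ℝ (fun _ : Fin (j + 1) =>
      EuclideanSpace ℝ (Fin n)) V).symm.toContinuousLinearEquiv.hasFDerivAt.comp_hasDerivAt t h2
    refine h3.congr_deriv ?_
    refine congrArg (continuousMultilinearCurryLeftEquiv ℝ (fun _ : Fin (j + 1) =>
      EuclideanSpace ℝ (Fin n)) V).symm ?_
    refine fderivWithin_congr (fun u hu => ?_) ?_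
    · exact (ih t u hu).deriv
    · exact (ih t u hu).deriv

theorem chartDeriv_congr_of_eventuallyEq {f g : M → V} {x : M} (h : f =ᶠ[nhds x] g) (c : M)
    (j : ℕ) (hx : x ∈ (extChartAt (𝓡∂ n) c).source) :
    chartDeriv n c j f x = chartDeriv n c j g x := by
  unfold chartDeriv
  have hc : ContinuousAt (extChartAt (𝓡∂ n) c).symm (extChartAt (𝓡∂ n) c x) :=
    continuousAt_extChartAt_symm' hx
  have h' : f ∘ (extChartAt (𝓡∂ n) c).symm =ᶠ[nhds (extChartAt (𝓡∂ n) c x)]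
      g ∘ (extChartAt (𝓡∂ n) c).symm := by
    refine hc.tendsto.eventually (p := fun y => f y = g y) ?_
    rw [(extChartAt (𝓡∂ n) c).left_inv hx]
    exact h
  exact (h'.filter_mono nhdsWithin_le_nhds).iteratedFDerivWithin_eq h'.self_of_nhds _

/-- The value at `x` of a local operator depends only on the germ of the field at `x`. -/
theorem IsLocal.congr_of_eventuallyEq {L : ℝ → (M → V) → M → W} (hL : IsLocal n L) (t : ℝ)
    {f g : M → V} (hf : SmoothField n f) (hg : SmoothField n g) {x : M}
    (h : f =ᶠ[nhds x] g) : L t f x = L t g x := by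
  obtain ⟨k, hk⟩ := hL
  obtain ⟨F, -, hF⟩ := hk x
  have hx := mem_extChartAt_source (I := 𝓡∂ n) x
  rw [hF t f hf x hx, hF t g hg x hx]
  simp_rw [chartDeriv_congr_of_eventuallyEq h x _ hx]

/-- Local operators map smooth families to smooth families. -/
theorem IsLocal.smoothFamily {L : ℝ → (M → V) → M → W} (hL : IsLocal n L) {f : E → M → V}
    (hf : SmoothFamily n f) {τ : E → ℝ} (hτ : ContDiff ℝ ∞ τ) :
    SmoothFamily n (fun p => L (τ p) (f p)) := by
  obtain ⟨k, hk⟩ := hL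
  rw [smoothFamily_iff_charts]
  intro c
  obtain ⟨F, hFs, hF⟩ := hk c
  have h1 : ContDiffOn ℝ ∞ (fun q : E × EuclideanSpace ℝ (Fin n) =>
      (τ q.1, q.2, (fun j : Fin (k + 1) => iteratedFDerivWithin ℝ j
        (f q.1 ∘ (extChartAt (𝓡∂ n) c).symm) (Set.range (𝓡∂ n)) q.2 : JetSpace n k V)))
      (univ ×ˢ (extChartAt (𝓡∂ n) c).target) :=
    (hτ.comp contDiff_fst).contDiffOn.prodMk (contDiffOn_snd.prodMk
      (contDiffOn_pi.2 fun j => contDiffOn_iteratedFDerivWithin_param hf c j))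
  refine (hFs.comp h1 fun q hq => ⟨mem_univ _, hq.2, mem_univ _⟩).congr fun q hq => ?_
  have hx := (extChartAt (𝓡∂ n) c).map_target hq.2
  rw [hF _ _ (hf.field q.1) _ hx]
  simp only [Function.comp, chartDeriv, (extChartAt (𝓡∂ n) c).right_inv hq.2]

theorem SmoothFamily.line {f v : M → V} (hf : SmoothField n f) (hv : SmoothField n v) :
    SmoothFamily n (fun r : ℝ => f + r • v) :=
  hf.family.add ((SmoothFamily.of_contDiff contDiff_id).smul hv.family)

/-- The `k`-jet at `x` of a field, in the preferred chart at `x`. -/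
def jet (n : ℕ) [NeZero n] {M : Type*} [TopologicalSpace M]
    [ChartedSpace (EuclideanHalfSpace n) M] {V : Type*} [NormedAddCommGroup V] [NormedSpace ℝ V]
    (k : ℕ) (x : M) (f : M → V) : JetSpace n k V :=
  fun j => chartDeriv n x j f x

theorem jet_zero (k : ℕ) (x : M) : jet n k x (fun _ : M => (0 : V)) = 0 := by
  funext j
  exact congrFun (iteratedFDerivWithin_fun_zero (𝕜 := ℝ) (i := (j : ℕ))) _

theorem SmoothFamily.hasDerivAt_jet {f : ℝ → M → V} (hf : SmoothFamily n f) (k : ℕ) (x : M)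
    (t : ℝ) :
    HasDerivAt (fun t => jet n k x (f t))
      (jet n k x (fun x => _root_.deriv (fun t => f t x) t)) t :=
  hasDerivAt_pi.2 fun j => hf.hasDerivAt_chartDeriv x j t (mem_extChartAt_source x)

theorem SmoothFamily.iteratedDeriv_jet {f : ℝ → M → V} (hf : SmoothFamily n f) (k : ℕ) (x : M)
    (i : ℕ) :
    _root_.iteratedDeriv i (fun t => jet n k x (f t)) =
      fun t => jet n k x (fun x => _root_.iteratedDeriv i (fun t => f t x) t) := by
  induction i with
  | zero => simp
  | succ i ih =>
    rw [iteratedDeriv_succ, ih]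
    funext t
    simpa only [iteratedDeriv_succ] using ((hf.iteratedDeriv i).hasDerivAt_jet k x t).deriv

/-- At a point, a local operator is a smooth function of the time and of a jet. -/
theorem IsLocal.exists_jet {L : ℝ → (M → V) → M → W} (hL : IsLocal n L) (x : M) :
    ∃ (k : ℕ) (Φ : ℝ × JetSpace n k V → W), ContDiff ℝ ∞ Φ ∧ ∀ t f, SmoothField n f →
      L t f x = Φ (t, jet n k x f) := by
  obtain ⟨k, hk⟩ := hL
  obtain ⟨F, hFs, hF⟩ := hk x
  refine ⟨k, fun q => F (q.1, extChartAt (𝓡∂ n) x x, q.2), ?_, fun t f hf =>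
    hF t f hf x (mem_extChartAt_source x)⟩
  rw [← contDiffOn_univ]
  exact hFs.comp (contDiff_fst.prodMk (contDiff_const.prodMk contDiff_snd)).contDiffOn
    fun q _ => ⟨mem_univ _, mem_extChartAt_target x, mem_univ _⟩

/-- The directional derivative at `f`, along `v`, of a local operator. -/
def dirDeriv (L : ℝ → (M → V) → M → W) (t : ℝ) (f v : M → V) (x : M) : W :=
  deriv (fun r : ℝ => L t (f + r • v) x) 0

theorem SmoothFamily.hasDerivAt_comp_jet {k : ℕ} {Φ : ℝ × JetSpace n k V → W}
    (hΦ : ContDiff ℝ ∞ Φ) (t : ℝ) {f : ℝ → M → V} (hf : SmoothFamily n f) (s : ℝ) (x : M) :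
    HasDerivAt (fun s => Φ (t, jet n k x (f s)))
      (_root_.fderiv ℝ Φ (t, jet n k x (f s))
        (0, jet n k x (fun x => _root_.deriv (fun s => f s x) s))) s :=
  ((hΦ.differentiable (by simp)) _).hasFDerivAt.comp_hasDerivAt s
    ((hasDerivAt_const s t).prodMk (hf.hasDerivAt_jet k x s))

/-- The directional derivative of a local operator in terms of jets. -/
theorem dirDeriv_eq_fderiv_jet {L : ℝ → (M → V) → M → W} {x : M} {k : ℕ}
    {Φ : ℝ × JetSpace n k V → W} (hΦ : ContDiff ℝ ∞ Φ)
    (hL : ∀ t f, SmoothField n f → L t f x = Φ (t, jet n k x f)) (t : ℝ) {f v : M → V}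
    (hf : SmoothField n f) (hv : SmoothField n v) :
    dirDeriv L t f v x = fderiv ℝ Φ (t, jet n k x f) (0, jet n k x v) := by
  have h2 := SmoothFamily.line hf hv
  have h3 := (h2.hasDerivAt_comp_jet hΦ t 0 x).deriv
  have h4 : ∀ x, deriv (fun r : ℝ => (f + r • v) x) 0 = v x := by
    intro x
    simpa using (((hasDerivAt_id (0 : ℝ)).smul_const (v x)).const_add (f x)).deriv
  simp only [h4] at h3
  rw [dirDeriv]
  simp_rw [fun r => hL t _ (h2.field r)]
  simpa using h3

/-- Chain rule for a local operator along a smooth curve of fields. -/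
theorem IsLocal.hasDerivAt_curve {L : ℝ → (M → V) → M → W} (hL : IsLocal n L) (t : ℝ)
    {f : ℝ → M → V} (hf : SmoothFamily n f) (s : ℝ) (x : M) :
    HasDerivAt (fun s => L t (f s) x)
      (dirDeriv L t (f s) (fun x => deriv (fun s => f s x) s) x) s := by
  obtain ⟨k, Φ, hΦ, hLΦ⟩ := hL.exists_jet x
  simp_rw [fun s => hLΦ t (f s) (hf.field s)]
  rw [dirDeriv_eq_fderiv_jet hΦ hLΦ t (hf.field s) (hf.deriv.field s)]
  exact hf.hasDerivAt_comp_jet hΦ t s x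

theorem IsLocal.hasDerivAt_line {L : ℝ → (M → V) → M → W} (hL : IsLocal n L) (t : ℝ)
    {f v : M → V} (hf : SmoothField n f) (hv : SmoothField n v) (x : M) :
    HasDerivAt (fun r : ℝ => L t (f + r • v) x) (dirDeriv L t f v x) 0 :=
  ((hL.smoothFamily (SmoothFamily.line hf hv)
    (contDiff_const (c := t))).differentiableAt 0 x).hasDerivAt

/-- The derivative along the diagonal is the sum of the partial derivatives. -/
theorem deriv_diagonal {Ψ : ℝ × ℝ → W} {a b : ℝ} (h : DifferentiableAt ℝ Ψ (a, b)) :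
    deriv (fun r : ℝ => Ψ (a + r, b + r)) 0 =
      deriv (fun r : ℝ => Ψ (a + r, b)) 0 + deriv (fun r : ℝ => Ψ (a, b + r)) 0 := by
  have e1 : HasDerivAt (fun r : ℝ => (a + r, b + r)) ((1 : ℝ), (1 : ℝ)) 0 :=
    ((hasDerivAt_id (0 : ℝ)).const_add a).prodMk ((hasDerivAt_id (0 : ℝ)).const_add b)
  have e2 : HasDerivAt (fun r : ℝ => (a + r, b)) ((1 : ℝ), (0 : ℝ)) 0 :=
    ((hasDerivAt_id (0 : ℝ)).const_add a).prodMk (hasDerivAt_const _ _)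
  have e3 : HasDerivAt (fun r : ℝ => (a, b + r)) ((0 : ℝ), (1 : ℝ)) 0 :=
    (hasDerivAt_const _ _).prodMk ((hasDerivAt_id (0 : ℝ)).const_add b)
  have h' : HasFDerivAt Ψ (fderiv ℝ Ψ (a, b)) (a, b) := h.hasFDerivAt
  have d1 : deriv (fun r : ℝ => Ψ (a + r, b + r)) 0 = _ :=
    (h'.comp_hasDerivAt_of_eq (0 : ℝ) e1 (by simp)).deriv
  have d2 : deriv (fun r : ℝ => Ψ (a + r, b)) 0 = _ :=
    (h'.comp_hasDerivAt_of_eq (0 : ℝ) e2 (by simp)).deriv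
  have d3 : deriv (fun r : ℝ => Ψ (a, b + r)) 0 = _ :=
    (h'.comp_hasDerivAt_of_eq (0 : ℝ) e3 (by simp)).deriv
  rw [d1, d2, d3, ← map_add]
  simp

theorem SmoothFamily.plane {f v w : M → V} (hf : SmoothField n f) (hv : SmoothField n v)
    (hw : SmoothField n w) : SmoothFamily n (fun r : ℝ × ℝ => f + r.1 • v + r.2 • w) :=
  (hf.family.add ((SmoothFamily.of_contDiff contDiff_fst).smul hv.family)).add
    ((SmoothFamily.of_contDiff contDiff_snd).smul hw.family)

theorem IsLocal.dirDeriv_add {L : ℝ → (M → V) → M → W} (hL : IsLocal n L) (t : ℝ)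
    {f v w : M → V} (hf : SmoothField n f) (hv : SmoothField n v) (hw : SmoothField n w) (x : M) :
    dirDeriv L t f (v + w) x = dirDeriv L t f v x + dirDeriv L t f w x := by
  have h := (hL.smoothFamily (SmoothFamily.plane hf hv hw)
    (contDiff_const (c := t))).differentiableAt (0, 0) x
  simpa [dirDeriv, add_assoc] using deriv_diagonal h

end Families

/-! ### Orders of vanishing in time -/

section Vanishing

/-- The derivatives of `g` of order less than `p` vanish at `t`. -/
def VanishesTo {W : Type*} [NormedAddCommGroup W] [NormedSpace ℝ W] (p : ℕ) (t : ℝ)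
    (g : ℝ → W) : Prop :=
  ∀ i < p, iteratedDeriv i g t = 0

variable {V : Type*} [NormedAddCommGroup V] [NormedSpace ℝ V]
  {W : Type*} [NormedAddCommGroup W] [NormedSpace ℝ W] {p : ℕ} {t : ℝ}

theorem VanishesTo.mono {q : ℕ} {g : ℝ → W} (h : VanishesTo p t g) (hq : q ≤ p) :
    VanishesTo q t g :=
  fun i hi => h i (hi.trans_le hq)

theorem vanishesTo_zero_order (g : ℝ → W) : VanishesTo 0 t g :=
  fun i hi => absurd hi (Nat.not_lt_zero i)

theorem vanishesTo_succ {g : ℝ → W} :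
    VanishesTo (p + 1) t g ↔ g t = 0 ∧ VanishesTo p t (deriv g) := by
  constructor
  · intro h
    refine ⟨by simpa using h 0 p.succ_pos, fun i hi => ?_⟩
    rw [← iteratedDeriv_succ']
    exact h (i + 1) (Nat.succ_lt_succ hi)
  · rintro ⟨h0, h⟩ i hi
    cases i with
    | zero => simpa using h0
    | succ i =>
      rw [iteratedDeriv_succ']
      exact h i (Nat.lt_of_succ_lt_succ hi)

theorem VanishesTo.add {f g : ℝ → W} (hf : ContDiff ℝ ∞ f) (hg : ContDiff ℝ ∞ g)
    (h : VanishesTo p t f) (h' : VanishesTo p t g) : VanishesTo p t (fun s => f s + g s) := by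
  intro i hi
  have := iteratedDeriv_fun_add (n := i) (x := t) (f := f) (g := g)
    (hf.of_le (mod_cast le_top)).contDiffAt (hg.of_le (mod_cast le_top)).contDiffAt
  rw [this, h i hi, h' i hi, add_zero]

theorem VanishesTo.neg {f : ℝ → W} (h : VanishesTo p t f) : VanishesTo p t (fun s => - f s) := by
  intro i hi
  rw [iteratedDeriv_fun_neg, h i hi, neg_zero]

theorem VanishesTo.clm {L : ℝ → V →L[ℝ] W} {v : ℝ → V} (hL : ContDiff ℝ ∞ L)
    (hv : ContDiff ℝ ∞ v) (h : VanishesTo p t v) : VanishesTo p t (fun s => L s (v s)) := by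
  induction p generalizing L v with
  | zero => exact vanishesTo_zero_order _
  | succ p ih =>
    rw [vanishesTo_succ] at h ⊢
    have hL' : ContDiff ℝ ∞ (deriv L) := (contDiff_infty_iff_deriv.1 hL).2
    have hv' : ContDiff ℝ ∞ (deriv v) := (contDiff_infty_iff_deriv.1 hv).2
    refine ⟨by simp [h.1], ?_⟩
    have e : deriv (fun s => L s (v s)) = fun s => deriv L s (v s) + L s (deriv v s) := by
      funext s
      exact (((hL.differentiable (by simp)) s).hasDerivAt.clm_apply
        ((hv.differentiable (by simp)) s).hasDerivAt).deriv
    rw [e]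
    refine (ih hL' hv ?_).add (hL'.clm_apply hv) (hL.clm_apply hv') (ih hL hv' h.2)
    exact (vanishesTo_succ.2 h).mono (Nat.le_succ p)

/-- A smooth function takes two curves that agree to order `p` to curves that agree to
order `p`. -/
theorem VanishesTo.comp_sub {A : Type*} [NormedAddCommGroup A] [NormedSpace ℝ A]
    {Φ : ℝ × A → W} (hΦ : ContDiff ℝ ∞ Φ) {a b : ℝ → A} (ha : ContDiff ℝ ∞ a)
    (hb : ContDiff ℝ ∞ b) (h : VanishesTo p t (fun s => a s - b s)) :
    VanishesTo p t (fun s => Φ (s, a s) - Φ (s, b s)) := by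
  induction p generalizing A with
  | zero => exact vanishesTo_zero_order _
  | succ p ih =>
    have hmono := h.mono (Nat.le_succ p)
    rw [vanishesTo_succ] at h ⊢
    have e0 : a t = b t := sub_eq_zero.1 h.1
    refine ⟨by simp [e0], ?_⟩
    have ha' : ContDiff ℝ ∞ (deriv a) := (contDiff_infty_iff_deriv.1 ha).2
    have hb' : ContDiff ℝ ∞ (deriv b) := (contDiff_infty_iff_deriv.1 hb).2
    -- the velocity of `Φ (s, a s)` is a smooth function of `s`, `a s` and the velocity of `a`
    let Ψ : ℝ × (A × A) → W := fun q => fderiv ℝ Φ (q.1, q.2.1) (1, q.2.2)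
    have hΨ : ContDiff ℝ ∞ Ψ :=
      ((hΦ.fderiv_right (m := ∞) (by simp)).comp
        (contDiff_fst.prodMk contDiff_snd.fst)).clm_apply
        (contDiff_const.prodMk contDiff_snd.snd)
    have d : ∀ {c : ℝ → A}, ContDiff ℝ ∞ c → ∀ s,
        HasDerivAt (fun s => Φ (s, c s)) (Ψ (s, (c s, deriv c s))) s := by
      intro c hc s
      exact ((hΦ.differentiable (by simp)) _).hasFDerivAt.comp_hasDerivAt s
        ((hasDerivAt_id s).prodMk ((hc.differentiable (by simp)) s).hasDerivAt)
    have e : deriv (fun s => Φ (s, a s) - Φ (s, b s)) =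
        fun s => Ψ (s, (a s, deriv a s)) - Ψ (s, (b s, deriv b s)) :=
      funext fun s => ((d ha s).sub (d hb s)).deriv
    rw [e]
    refine ih hΨ (ha.prodMk ha') (hb.prodMk hb') ?_
    have e2 : deriv (fun s => a s - b s) = fun s => deriv a s - deriv b s :=
      funext fun s => (((ha.differentiable (by simp)) s).hasDerivAt.sub
        ((hb.differentiable (by simp)) s).hasDerivAt).deriv
    rw [e2] at h
    have hs : (fun s => (a s, deriv a s) - (b s, deriv b s)) = fun s =>
        ContinuousLinearMap.inl ℝ A A (a s - b s) +
          ContinuousLinearMap.inr ℝ A A (deriv a s - deriv b s) := by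
      funext s; simp
    rw [hs]
    exact (hmono.clm contDiff_const (ha.sub hb)).add (contDiff_const.clm_apply (ha.sub hb))
      (contDiff_const.clm_apply (ha'.sub hb'))
      (h.2.clm (L := fun _ => ContinuousLinearMap.inr ℝ A A) contDiff_const (ha'.sub hb'))

end Vanishing

section VanishingLocal

variable {n : ℕ} [NeZero n] {M : Type*} [TopologicalSpace M]
  [ChartedSpace (EuclideanHalfSpace n) M] [IsManifold (𝓡∂ n) ∞ M]
  {V : Type*} [NormedAddCommGroup V] [NormedSpace ℝ V]
  {W : Type*} [NormedAddCommGroup W] [NormedSpace ℝ W] {p : ℕ} {t : ℝ}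

theorem SmoothFamily.contDiff_jet {f : ℝ → M → V} (hf : SmoothFamily n f) (k : ℕ) (x : M) :
    ContDiff ℝ ∞ (fun s => jet n k x (f s)) := by
  have h : ∀ i : ℕ, ∀ {f : ℝ → M → V}, SmoothFamily n f →
      ContDiff ℝ i (fun s => jet n k x (f s)) := by
    intro i
    induction i with
    | zero =>
      intro f hf
      exact contDiff_zero.2 (continuous_iff_continuousAt.2
        fun s => (hf.hasDerivAt_jet k x s).continuousAt)
    | succ i ih =>
      intro f hf
      rw [Nat.cast_succ, contDiff_succ_iff_deriv]
      refine ⟨fun s => (hf.hasDerivAt_jet k x s).differentiableAt, by simp, ?_⟩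
      rw [funext fun s => (hf.hasDerivAt_jet k x s).deriv]
      exact ih hf.deriv
  exact contDiff_infty.2 fun i => h i hf

/-- A local operator takes two histories that agree to order `p` at time `t` to histories that
agree to order `p` at time `t`. -/
theorem IsLocal.vanishesTo_sub {L : ℝ → (M → V) → M → W} (hL : IsLocal n L) {f g : ℝ → M → V}
    (hf : SmoothFamily n f) (hg : SmoothFamily n g)
    (h : ∀ x, VanishesTo p t (fun s => f s x - g s x)) (x : M) :
    VanishesTo p t (fun s => L s (f s) x - L s (g s) x) := by
  obtain ⟨k, Φ, hΦ, hLΦ⟩ := hL.exists_jet x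
  simp_rw [fun s => hLΦ s (f s) (hf.field s), fun s => hLΦ s (g s) (hg.field s)]
  refine VanishesTo.comp_sub hΦ (hf.contDiff_jet k x) (hg.contDiff_jet k x) fun i hi => ?_
  rw [iteratedDeriv_fun_sub ((hf.contDiff_jet k x).of_le (mod_cast le_top)).contDiffAt
    ((hg.contDiff_jet k x).of_le (mod_cast le_top)).contDiffAt, hf.iteratedDeriv_jet,
    hg.iteratedDeriv_jet, sub_eq_zero]
  refine congrArg (jet n k x) (funext fun x => ?_)
  have := h x i hi
  rwa [iteratedDeriv_fun_sub ((hf.at x).of_le (mod_cast le_top)).contDiffAt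
    ((hg.at x).of_le (mod_cast le_top)).contDiffAt, sub_eq_zero] at this

theorem IsLocal.vanishesTo_dirDeriv {L : ℝ → (M → V) → M → W} (hL : IsLocal n L)
    {f v : ℝ → M → V} (hf : SmoothFamily n f) (hv : SmoothFamily n v)
    (h : ∀ x, VanishesTo p t (fun s => v s x)) (x : M) :
    VanishesTo p t (fun s => dirDeriv L s (f s) (v s) x) := by
  obtain ⟨k, Φ, hΦ, hLΦ⟩ := hL.exists_jet x
  simp_rw [fun s => dirDeriv_eq_fderiv_jet hΦ hLΦ s (hf.field s) (hv.field s)]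
  have h1 : VanishesTo p t (fun s => jet n k x (v s)) := by
    intro i hi
    rw [hv.iteratedDeriv_jet]
    simp only [h _ i hi]
    exact jet_zero k x
  exact h1.clm (L := fun s => (fderiv ℝ Φ (s, jet n k x (f s))).comp
      (ContinuousLinearMap.inr ℝ ℝ (JetSpace n k V)))
    (((hΦ.fderiv_right (m := ∞) (by simp)).comp
      (contDiff_id.prodMk (hf.contDiff_jet k x))).clm_comp contDiff_const) (hv.contDiff_jet k x)

end VanishingLocal

/-! ### Integrals of smooth families -/

section Integrals

variable {n : ℕ} [NeZero n] {M : Type*} [TopologicalSpace M] [CompactSpace M]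
  [ChartedSpace (EuclideanHalfSpace n) M] [IsManifold (𝓡∂ n) ∞ M]
  [MeasurableSpace M] [BorelSpace M]

theorem secondCountable_of_compact_halfSpace (n : ℕ) [NeZero n] (M : Type*) [TopologicalSpace M]
    [CompactSpace M] [ChartedSpace (EuclideanHalfSpace n) M] : SecondCountableTopology M :=
  have := (𝓡∂ n).secondCountableTopology
  ChartedSpace.secondCountable_of_sigmaCompact (EuclideanHalfSpace n) M

variable {μ : Measure M} [IsFiniteMeasure μ]

universe u

theorem integrable_of_continuous (n : ℕ) [NeZero n] {M : Type*} [TopologicalSpace M]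
    [CompactSpace M] [ChartedSpace (EuclideanHalfSpace n) M] [MeasurableSpace M] [BorelSpace M]
    {μ : Measure M} [IsFiniteMeasure μ] {W : Type*} [NormedAddCommGroup W] {f : M → W}
    (hf : Continuous f) : Integrable f μ := by
  have := secondCountable_of_compact_halfSpace n M
  obtain ⟨C, hC⟩ := isCompact_univ.exists_bound_of_continuousOn hf.continuousOn
  exact Integrable.of_bound hf.aestronglyMeasurable C (Filter.Eventually.of_forall
    fun x => hC x (mem_univ x))

theorem SmoothField.integrable {W : Type*} [NormedAddCommGroup W] [NormedSpace ℝ W] {f : M → W}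
    (hf : SmoothField n f) : Integrable f μ :=
  integrable_of_continuous n (ContMDiff.continuous hf)

theorem SmoothFamily.integrable {E W : Type*} [NormedAddCommGroup E] [NormedSpace ℝ E]
    [NormedAddCommGroup W] [NormedSpace ℝ W] {f : E → M → W}
    (hf : SmoothFamily n f) (p : E) : Integrable (f p) μ :=
  (hf.field p).integrable

theorem SmoothFamily.hasFDerivAt_integral {E W : Type*} [NormedAddCommGroup E] [NormedSpace ℝ E]
    [FiniteDimensional ℝ E] [NormedAddCommGroup W] [NormedSpace ℝ W] {f : E → M → W}
    (hf : SmoothFamily n f) (p₀ : E) :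
    HasFDerivAt (fun p => ∫ x, f p x ∂μ) (∫ x, _root_.fderiv ℝ (fun p => f p x) p₀ ∂μ) p₀ := by
  have := secondCountable_of_compact_halfSpace n M
  have hK : IsCompact (Metric.closedBall p₀ 1 ×ˢ (univ : Set M)) :=
    (isCompact_closedBall p₀ 1).prod isCompact_univ
  obtain ⟨C, hC⟩ := hK.exists_bound_of_continuousOn hf.fderiv.continuous.continuousOn
  exact hasFDerivAt_integral_of_dominated_of_fderiv_le (bound := fun _ => C)
    (F' := fun p x => _root_.fderiv ℝ (fun p => f p x) p)
    (Metric.closedBall_mem_nhds p₀ one_pos)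
    (Filter.Eventually.of_forall fun p => (hf.integrable p).aestronglyMeasurable)
    (hf.integrable p₀) (hf.fderiv.integrable p₀).aestronglyMeasurable
    (Filter.Eventually.of_forall fun x p hp => hC (p, x) ⟨hp, mem_univ x⟩)
    (integrable_const C)
    (Filter.Eventually.of_forall fun x p _ => (hf.differentiableAt p x).hasFDerivAt)

/-- The integral of a smooth family is smooth in the parameter. The parameter space and the value
space share a universe because the induction replaces the values by linear maps. -/
theorem SmoothFamily.contDiff_integral {E W : Type u} [NormedAddCommGroup E] [NormedSpace ℝ E]
    [FiniteDimensional ℝ E] [NormedAddCommGroup W] [NormedSpace ℝ W] {f : E → M → W}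
    (hf : SmoothFamily n f) : ContDiff ℝ ∞ (fun p => ∫ x, f p x ∂μ) := by
  have h : ∀ i : ℕ, ∀ {W : Type u} [NormedAddCommGroup W] [NormedSpace ℝ W] {f : E → M → W},
      SmoothFamily n f → ContDiff ℝ i (fun p => ∫ x, f p x ∂μ) := by
    intro i
    induction i with
    | zero =>
      intro W _ _ f hf
      exact contDiff_zero.2 (continuous_iff_continuousAt.2
        fun p => (hf.hasFDerivAt_integral (μ := μ) p).continuousAt)
    | succ i ih =>
      intro W _ _ f hf
      rw [Nat.cast_succ, contDiff_succ_iff_hasFDerivAt]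
      exact ⟨_, ih hf.fderiv, fun p => hf.hasFDerivAt_integral p⟩
  exact contDiff_infty.2 fun i => h i hf

theorem SmoothFamily.hasDerivAt_integral {W : Type*} [NormedAddCommGroup W] [NormedSpace ℝ W]
    [CompleteSpace W] {f : ℝ → M → W} (hf : SmoothFamily n f) (t : ℝ) :
    HasDerivAt (fun t => ∫ x, f t x ∂μ) (∫ x, _root_.deriv (fun t => f t x) t ∂μ) t := by
  have h := (hf.hasFDerivAt_integral (μ := μ) t).hasDerivAt
  rwa [ContinuousLinearMap.integral_apply (hf.fderiv.integrable t)] at h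

theorem SmoothFamily.vanishesTo_integral {W : Type*} [NormedAddCommGroup W] [NormedSpace ℝ W]
    [CompleteSpace W] {f : ℝ → M → W} (hf : SmoothFamily n f) {p : ℕ} {t : ℝ}
    (h : ∀ x, VanishesTo p t (fun s => f s x)) :
    VanishesTo p t (fun s => ∫ x, f s x ∂μ) := by
  have key : ∀ i, _root_.iteratedDeriv i (fun s => ∫ x, f s x ∂μ) =
      fun s => ∫ x, _root_.iteratedDeriv i (fun s => f s x) s ∂μ := by
    intro i
    induction i with
    | zero => simp
    | succ i ih =>
      rw [iteratedDeriv_succ, ih]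
      funext s
      simpa only [iteratedDeriv_succ] using
        ((hf.iteratedDeriv i).hasDerivAt_integral (μ := μ) s).deriv
  intro i hi
  rw [key i]
  simp [h _ i hi]

end Integrals

/-! ### Smooth volumes -/

section Volumes

open scoped ENNReal

/-- A chart of a manifold with boundary covers a relative ball of the half space. -/
theorem exists_ball_inter_range_subset {n : ℕ} [NeZero n] {M : Type*} [TopologicalSpace M]
    [ChartedSpace (EuclideanHalfSpace n) M] (c : M) :
    ∃ r > 0, Metric.closedBall (extChartAt (𝓡∂ n) c c) r ∩ range (𝓡∂ n) ⊆
      (extChartAt (𝓡∂ n) c).target := by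
  obtain ⟨r, hr, h⟩ := Metric.nhdsWithin_basis_ball.mem_iff.1
    (extChartAt_target_mem_nhdsWithin (I := 𝓡∂ n) c)
  exact ⟨r / 2, half_pos hr, fun u hu => h ⟨Metric.closedBall_subset_ball (half_lt_self hr) hu.1,
    hu.2⟩⟩

variable {n : ℕ} [NeZero n] {M : Type*} [TopologicalSpace M]
  [ChartedSpace (EuclideanHalfSpace n) M]
  [MeasurableSpace M] [BorelSpace M]

theorem map_extChartAt_apply (μ : Measure M) (c : M) {B : Set (EuclideanSpace ℝ (Fin n))}
    (hB : MeasurableSet B) :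
    (μ.restrict (extChartAt (𝓡∂ n) c).source).map (extChartAt (𝓡∂ n) c) B =
      μ ((extChartAt (𝓡∂ n) c).source ∩ extChartAt (𝓡∂ n) c ⁻¹' B) := by
  have hs : MeasurableSet (extChartAt (𝓡∂ n) c).source :=
    (isOpen_extChartAt_source c).measurableSet
  have hm : AEMeasurable (extChartAt (𝓡∂ n) c) (μ.restrict (extChartAt (𝓡∂ n) c).source) :=
    (continuousOn_extChartAt c).aemeasurable hs
  rw [Measure.map_apply_of_aemeasurable hm hB, Measure.restrict_apply' hs, inter_comm]

/-- A measure given in charts by a continuous density with respect to a measure that is finite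
on bounded sets is locally finite. -/
theorem finiteAtFilter_of_density {μ : Measure M} {c : M}
    {lam : Measure (EuclideanSpace ℝ (Fin n))} {ρ : EuclideanSpace ℝ (Fin n) → ℝ}
    (hρ : ContinuousOn ρ (extChartAt (𝓡∂ n) c).target)
    (hlam : ∀ r, lam (Metric.closedBall (extChartAt (𝓡∂ n) c c) r) < ⊤)
    (hl : lam (extChartAt (𝓡∂ n) c).targetᶜ = 0)
    (h : (μ.restrict (extChartAt (𝓡∂ n) c).source).map (extChartAt (𝓡∂ n) c) =
      lam.withDensity (fun u => ENNReal.ofReal (ρ u))) :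
    μ.FiniteAtFilter (nhds c) := by
  obtain ⟨r, hr, hsub⟩ := exists_ball_inter_range_subset (n := n) c
  set u₀ := extChartAt (𝓡∂ n) c c with hu₀
  have hK : IsCompact (Metric.closedBall u₀ r ∩ range (𝓡∂ n)) :=
    (isCompact_closedBall u₀ r).inter_right (𝓡∂ n).isClosed_range
  obtain ⟨C, hC⟩ := hK.exists_bound_of_continuousOn (hρ.mono hsub)
  refine ⟨(extChartAt (𝓡∂ n) c).source ∩ extChartAt (𝓡∂ n) c ⁻¹' Metric.ball u₀ r,
    Filter.inter_mem (extChartAt_source_mem_nhds c)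
      ((continuousAt_extChartAt c).preimage_mem_nhds (Metric.ball_mem_nhds _ hr)), ?_⟩
  rw [← map_extChartAt_apply μ c Metric.isOpen_ball.measurableSet, h,
    withDensity_apply _ Metric.isOpen_ball.measurableSet]
  calc ∫⁻ u in Metric.ball u₀ r, ENNReal.ofReal (ρ u) ∂lam
      ≤ ∫⁻ _ in Metric.ball u₀ r, ENNReal.ofReal C ∂lam := by
        refine lintegral_mono_ae ?_
        have h0 : ∀ᵐ u ∂lam, u ∈ (extChartAt (𝓡∂ n) c).target := by
          rw [ae_iff]; exact hl
        filter_upwards [ae_restrict_of_ae h0, ae_restrict_mem Metric.isOpen_ball.measurableSet]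
          with u hu hu'
        refine ENNReal.ofReal_le_ofReal ((le_abs_self _).trans (hC u ⟨?_, ?_⟩))
        · exact Metric.ball_subset_closedBall hu'
        · exact extChartAt_target_subset_range c hu
    _ = ENNReal.ofReal C * lam (Metric.ball u₀ r) := by simp
    _ < ⊤ := ENNReal.mul_lt_top ENNReal.ofReal_lt_top
      ((measure_mono Metric.ball_subset_closedBall).trans_lt (hlam r))

/-- The target of a chart is open in the half space, which is closed. -/
theorem measurableSet_extChartAt_target (c : M) :
    MeasurableSet (extChartAt (𝓡∂ n) c).target := by
  have h : (extChartAt (𝓡∂ n) c).target =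
      range (𝓡∂ n) ∩ (𝓡∂ n).symm ⁻¹' (chartAt (EuclideanHalfSpace n) c).target := by
    rw [extChartAt_target, inter_comm]
  rw [h]
  exact (𝓡∂ n).isClosed_range.measurableSet.inter
    (((chartAt (EuclideanHalfSpace n) c).open_target.preimage
      (𝓡∂ n).continuous_symm).measurableSet)

theorem isFiniteMeasure_of_finiteAt [CompactSpace M] {μ : Measure M}
    (h : ∀ c, μ.FiniteAtFilter (nhds c)) : IsFiniteMeasure μ := by
  have : IsLocallyFiniteMeasure μ := ⟨h⟩
  infer_instance

theorem IsSmoothVolume.isFiniteMeasure [CompactSpace M] {μ : Measure M}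
    (h : IsSmoothVolume n μ) : IsFiniteMeasure μ := by
  refine isFiniteMeasure_of_finiteAt (M := M) fun c => ?_
  obtain ⟨ρ, h1, -, h3⟩ := h c
  refine finiteAtFilter_of_density h1.continuousOn (fun r => ?_) ?_ h3
  · exact (Measure.restrict_apply_le _ _).trans_lt measure_closedBall_lt_top
  · rw [Measure.restrict_apply (measurableSet_extChartAt_target c).compl]
    simp

/-- Bounded pieces of the boundary hyperplane have finite `(n-1)`-dimensional measure: they lie
in Lipschitz images of balls of `ℝⁿ⁻¹`. -/
theorem hausdorffMeasure_hyperplane_lt_top (u : EuclideanSpace ℝ (Fin n)) (r : ℝ) :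
    Measure.hausdorffMeasure ((n : ℝ) - 1)
      (Metric.closedBall u r ∩ frontier (range (𝓡∂ n))) < ⊤ := by
  let ι := {i : Fin n // i ≠ 0}
  have hcard : ((Fintype.card ι : ℕ) : ℝ) = (n : ℝ) - 1 := by
    have h1 : Fintype.card ι = n - 1 := by simp [ι, Fintype.card_subtype_compl]
    rw [h1, Nat.cast_sub (Nat.one_le_iff_ne_zero.2 (NeZero.ne n)), Nat.cast_one]
  let e : (ι → ℝ) →ₗ[ℝ] EuclideanSpace ℝ (Fin n) :=
    { toFun := fun g => WithLp.toLp 2 (fun i => if h : i ≠ 0 then g ⟨i, h⟩ else 0)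
      map_add' := fun f g => by
        ext i; by_cases h : i = 0 <;> simp [h]
      map_smul' := fun a f => by
        ext i; by_cases h : i = 0 <;> simp [h] }
  have hlip := (LinearMap.toContinuousLinearMap e).lipschitz
  have hsub : Metric.closedBall u r ∩ frontier (range (𝓡∂ n)) ⊆
      e '' Metric.closedBall 0 (‖u‖ + |r|) := by
    rintro y ⟨hy, hy'⟩
    rw [frontier_range_modelWithCornersEuclideanHalfSpace] at hy'
    refine ⟨fun i => y i, ?_, ?_⟩
    · rw [mem_closedBall_zero_iff, pi_norm_le_iff_of_nonneg (by positivity)]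
      intro i
      have h1 : ‖y‖ ≤ ‖u‖ + |r| := by
        have h2 := mem_closedBall_iff_norm.1 hy
        calc ‖y‖ = ‖u + (y - u)‖ := by congr 1; abel
          _ ≤ ‖u‖ + ‖y - u‖ := norm_add_le _ _
          _ ≤ ‖u‖ + |r| := by gcongr; exact h2.trans (le_abs_self r)
      exact (PiLp.norm_apply_le y i).trans h1
    · ext i
      by_cases h : i = 0
      · subst h; simpa [e] using hy'
      · simp [e, h]
  refine (measure_mono hsub).trans_lt ?_
  have h3 := hlip.hausdorffMeasure_image_le (d := (n : ℝ) - 1) (by rw [← hcard]; positivity)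
    (Metric.closedBall 0 (‖u‖ + |r|))
  refine h3.trans_lt (ENNReal.mul_lt_top ?_ ?_)
  · exact ENNReal.rpow_lt_top_of_nonneg (by rw [← hcard]; positivity) ENNReal.coe_ne_top
  · rw [← hcard, hausdorffMeasure_pi_real]
    exact measure_closedBall_lt_top

theorem IsSmoothBoundaryVolume.isFiniteMeasure [CompactSpace M] {ν : Measure M}
    (h : IsSmoothBoundaryVolume n ν) : IsFiniteMeasure ν := by
  refine isFiniteMeasure_of_finiteAt (M := M) fun c => ?_
  obtain ⟨ρ, h1, -, h3⟩ := h c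
  refine finiteAtFilter_of_density h1.continuousOn (fun r => ?_) ?_ h3
  · rw [Measure.restrict_apply Metric.isClosed_closedBall.measurableSet]
    refine (measure_mono ?_).trans_lt
      (hausdorffMeasure_hyperplane_lt_top (extChartAt (𝓡∂ n) c c) r)
    exact inter_subset_inter_right _ inter_subset_right
  · rw [Measure.restrict_apply (measurableSet_extChartAt_target c).compl]
    convert measure_empty (μ := Measure.hausdorffMeasure ((n : ℝ) - 1))
    ext u; simp; tauto

/-- The boundary volume does not charge sets of interior points. -/
theorem IsSmoothBoundaryVolume.measure_eq_zero [CompactSpace M] {ν : Measure M}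
    (h : IsSmoothBoundaryVolume n ν) {K : Set M} (hK : K ⊆ (𝓡∂ n).interior M) : ν K = 0 := by
  have := secondCountable_of_compact_halfSpace n M
  refine measure_null_of_locally_null K fun x hx => ?_
  obtain ⟨ρ, -, -, h3⟩ := h x
  have hxi : extChartAt (𝓡∂ n) x x ∈ interior (range (𝓡∂ n)) := hK hx
  refine ⟨(extChartAt (𝓡∂ n) x).source ∩ extChartAt (𝓡∂ n) x ⁻¹' interior (range (𝓡∂ n)),
    mem_nhdsWithin_of_mem_nhds (Filter.inter_mem (extChartAt_source_mem_nhds x)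
      ((continuousAt_extChartAt x).preimage_mem_nhds (isOpen_interior.mem_nhds hxi))), ?_⟩
  rw [← map_extChartAt_apply ν x isOpen_interior.measurableSet, h3,
    withDensity_apply _ isOpen_interior.measurableSet,
    Measure.restrict_restrict isOpen_interior.measurableSet]
  have he : interior (range (𝓡∂ n)) ∩ ((extChartAt (𝓡∂ n) x).target ∩ frontier (range (𝓡∂ n)))
      = ∅ := by
    rw [eq_empty_iff_forall_notMem]
    rintro u ⟨h1, -, h2⟩
    exact h2.2 h1
  rw [he]
  simp

/-- A smooth volume charges the neighbourhoods of interior points. -/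
theorem IsSmoothVolume.measure_pos {μ : Measure M} (h : IsSmoothVolume n μ) {x : M}
    (hx : x ∈ (𝓡∂ n).interior M) {O : Set M} (hO : O ∈ nhds x) : 0 < μ O := by
  obtain ⟨ρ, h1, h2, h3⟩ := h x
  set u₀ := extChartAt (𝓡∂ n) x x with hu₀
  have hxi : u₀ ∈ interior (range (𝓡∂ n)) := hx
  have hT : (extChartAt (𝓡∂ n) x).target ∈ nhds u₀ := by
    have := extChartAt_target_mem_nhdsWithin (I := 𝓡∂ n) x
    rwa [nhdsWithin_eq_nhds.2 (mem_interior_iff_mem_nhds.1 hxi)] at this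
  have hρ : ContinuousAt ρ u₀ := h1.continuousOn.continuousAt hT
  have hpos : 0 < ρ u₀ := h2 u₀ (mem_extChartAt_target x)
  have hlow : ∀ᶠ u in nhds u₀, ρ u₀ / 2 < ρ u := hρ.eventually (lt_mem_nhds (half_lt_self hpos))
  have hsym : ∀ᶠ u in nhds u₀, (extChartAt (𝓡∂ n) x).symm u ∈ O :=
    (continuousAt_extChartAt_symm x).eventually (by rwa [extChartAt_to_inv])
  obtain ⟨r, hr, hball⟩ := Metric.eventually_nhds_iff_ball.1
    ((Filter.eventually_mem_set.2 hT).and (hlow.and hsym))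
  have hm : MeasurableSet (Metric.ball u₀ r) := Metric.isOpen_ball.measurableSet
  calc 0 < ENNReal.ofReal (ρ u₀ / 2) * volume (Metric.ball u₀ r) :=
        ENNReal.mul_pos (by simpa using hpos) (Metric.measure_ball_pos _ _ hr).ne'
    _ = ∫⁻ _ in Metric.ball u₀ r, ENNReal.ofReal (ρ u₀ / 2) := by simp
    _ ≤ ∫⁻ u in Metric.ball u₀ r, ENNReal.ofReal (ρ u) :=
        setLIntegral_mono' hm fun u hu => ENNReal.ofReal_le_ofReal (hball u hu).2.1.le
    _ = μ ((extChartAt (𝓡∂ n) x).source ∩ extChartAt (𝓡∂ n) x ⁻¹' Metric.ball u₀ r) := by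
        rw [← map_extChartAt_apply μ x hm, h3, withDensity_apply _ hm,
          Measure.restrict_restrict hm, inter_eq_self_of_subset_left fun u hu => (hball u hu).1]
    _ ≤ μ O := measure_mono fun y hy => by
        have := (hball _ hy.2).2.2
        rwa [(extChartAt (𝓡∂ n) x).left_inv hy.1] at this

end Volumes

/-! ### Cutoffs and the fundamental lemma of the calculus of variations -/

section Cutoffs

variable {n : ℕ} [NeZero n] {M : Type*} [TopologicalSpace M] [T2Space M] [CompactSpace M]
  [ChartedSpace (EuclideanHalfSpace n) M] [IsManifold (𝓡∂ n) ∞ M]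

theorem exists_smooth_cutoff {x : M} {O : Set M} (hO : O ∈ nhds x) :
    ∃ η : M → ℝ, SmoothField n η ∧ tsupport η ⊆ O ∧ η =ᶠ[nhds x] 1 ∧ ∀ y, 0 ≤ η y := by
  obtain ⟨f, h0, h1, h01⟩ := exists_contMDiffMap_zero_one_nhds_of_isClosed (𝓡∂ n)
    (isOpen_interior (s := O)).isClosed_compl (isClosed_singleton (x := x))
    (by rw [disjoint_singleton_right]; simpa using mem_interior_iff_mem_nhds.2 hO) (n := ⊤)
  refine ⟨f, f.contMDiff, fun y hy => ?_, by rwa [nhdsSet_singleton] at h1, fun y => (h01 y).1⟩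
  by_contra hyO
  have : f =ᶠ[nhds y] 0 :=
    h0.filter_mono (nhds_le_nhdsSet (s := (interior O)ᶜ) fun h => hyO (interior_subset h))
  exact notMem_tsupport_iff_eventuallyEq.2 this hy

variable [MeasurableSpace M] [BorelSpace M]

/-- The fundamental lemma of the calculus of variations, at an interior point. -/
theorem eq_zero_of_forall_integral_mul_eq_zero {μ : Measure M} (hμ : IsSmoothVolume n μ)
    {g : M → ℝ} (hg : Continuous g) {x : M} (hx : x ∈ (𝓡∂ n).interior M) {O : Set M}
    (hO : O ∈ nhds x)
    (h : ∀ η : M → ℝ, SmoothField n η → tsupport η ⊆ O → ∫ y, g y * η y ∂μ = 0) : g x = 0 := by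
  by_contra hne
  have := hμ.isFiniteMeasure
  have hO' : O ∩ {y | 0 < g x * g y} ∈ nhds x :=
    Filter.inter_mem hO ((isOpen_lt continuous_const (continuous_const.mul hg)).mem_nhds
      (mul_self_pos.2 hne))
  obtain ⟨η, hη, hsupp, h1, h0⟩ := exists_smooth_cutoff (n := n) hO'
  have hηc : Continuous η := ContMDiff.continuous hη
  have hnn : ∀ y, 0 ≤ g x * (g y * η y) := by
    intro y
    by_cases hy : y ∈ tsupport η
    · have := (hsupp hy).2
      rw [← mul_assoc]
      exact mul_nonneg (le_of_lt this) (h0 y)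
    · simp [image_eq_zero_of_notMem_tsupport hy]
  have hint : Integrable (fun y => g x * (g y * η y)) μ :=
    integrable_of_continuous n (by fun_prop)
  have hpos : 0 < ∫ y, g x * (g y * η y) ∂μ := by
    rw [integral_pos_iff_support_of_nonneg hnn hint]
    refine hμ.measure_pos hx (Filter.mem_of_superset (Filter.inter_mem hO' h1) ?_)
    rintro y ⟨hy, hy1⟩
    have hy1' : η y = 1 := hy1
    have : 0 < g x * g y := hy.2
    simpa [hy1', Function.mem_support] using ⟨hne, fun h0 => by simp [h0] at this⟩
  rw [integral_const_mul, h η hη (hsupp.trans inter_subset_left), mul_zero] at hpos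
  exact lt_irrefl _ hpos

end Cutoffs

/-! ### The symplectic form -/

section Symplectic

variable {N : ℕ}

/-- The symplectic form `z^A σ_{AB} z'^B`. -/
def sympl (sig : Matrix (Fin N) (Fin N) ℝ) (z z' : ZVal N) : ℝ := z ⬝ᵥ (sig⁻¹).mulVec z'

theorem sympl_eq_sum (sig : Matrix (Fin N) (Fin N) ℝ) (z z' : ZVal N) :
    sympl sig z z' = ∑ A, ∑ B, z A * (sig⁻¹ A B * z' B) := by
  simp [sympl, dotProduct, Matrix.mulVec, Finset.mul_sum]

theorem contDiff_sympl (sig : Matrix (Fin N) (Fin N) ℝ) :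
    ContDiff ℝ ∞ (fun q : ZVal N × ZVal N => sympl sig q.1 q.2) := by
  simp_rw [sympl_eq_sum]
  fun_prop

theorem hasDerivAt_sympl (sig : Matrix (Fin N) (Fin N) ℝ) {a b : ℝ → ZVal N} {a' b' : ZVal N}
    {t : ℝ} (ha : HasDerivAt a a' t) (hb : HasDerivAt b b' t) :
    HasDerivAt (fun t => sympl sig (a t) (b t)) (sympl sig a' (b t) + sympl sig (a t) b') t := by
  simp_rw [sympl_eq_sum, ← Finset.sum_add_distrib]
  refine HasDerivAt.fun_sum fun A _ => HasDerivAt.fun_sum fun B _ => ?_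
  exact (hasDerivAt_pi.1 ha A).mul ((hasDerivAt_pi.1 hb B).const_mul _)

variable {sig : Matrix (Fin N) (Fin N) ℝ}

theorem sympl_swap (h : sig.transpose = -sig) (hu : IsUnit sig) (z z' : ZVal N) :
    sympl sig z z' = -sympl sig z' z := by
  have h1 : sig⁻¹.transpose = -sig⁻¹ := by
    rw [Matrix.transpose_nonsing_inv, h]
    exact Matrix.inv_eq_right_inv (by
      rw [neg_mul_neg, Matrix.mul_nonsing_inv _ ((Matrix.isUnit_iff_isUnit_det sig).1 hu)])
  rw [sympl, Matrix.dotProduct_mulVec, dotProduct_comm, ← Matrix.mulVec_transpose, h1, sympl,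
    Matrix.neg_mulVec, dotProduct_neg]

theorem sum_apply_single (e : ZVal N →L[ℝ] ℝ) (v : ZVal N) :
    e v = (fun B => e (Pi.single B 1)) ⬝ᵥ v := by
  conv_lhs => rw [← Finset.univ_sum_single v]
  rw [map_sum, dotProduct]
  refine Finset.sum_congr rfl fun B _ => ?_
  have : (Pi.single B (v B) : ZVal N) = v B • Pi.single B 1 := by simp [← Pi.single_smul]
  rw [this, map_smul, smul_eq_mul, mul_comm]

theorem sharp_eq_mulVec (sig : Matrix (Fin N) (Fin N) ℝ) (e : ZVal N →L[ℝ] ℝ) :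
    sharp sig e = sig.mulVec (fun B => e (Pi.single B 1)) := rfl

theorem sympl_sharp (h : sig.transpose = -sig) (hu : IsUnit sig) (e : ZVal N →L[ℝ] ℝ)
    (v : ZVal N) : sympl sig (sharp sig e) v = -e v := by
  have hdet : IsUnit sig.det := (Matrix.isUnit_iff_isUnit_det sig).1 hu
  rw [sympl, sharp_eq_mulVec, sum_apply_single e v, ← Matrix.vecMul_transpose, h,
    ← Matrix.dotProduct_mulVec, Matrix.mulVec_mulVec, Matrix.neg_mul,
    Matrix.mul_nonsing_inv _ hdet, Matrix.neg_mulVec, Matrix.one_mulVec, dotProduct_neg]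

theorem apply_sharp_swap (h : sig.transpose = -sig) (e e' : ZVal N →L[ℝ] ℝ) :
    e (sharp sig e') = -e' (sharp sig e) := by
  rw [sum_apply_single e, sum_apply_single e', sharp_eq_mulVec, sharp_eq_mulVec,
    Matrix.dotProduct_mulVec, dotProduct_comm, ← Matrix.mulVec_transpose, h, Matrix.neg_mulVec,
    dotProduct_neg]

/-- The map `e_B ↦ σ^{AB} e_B` as a continuous linear map. -/
def sharpL (sig : Matrix (Fin N) (Fin N) ℝ) : (ZVal N →L[ℝ] ℝ) →L[ℝ] ZVal N :=
  ContinuousLinearMap.pi fun A => ∑ B, sig A B •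
    ContinuousLinearMap.apply ℝ ℝ (Pi.single B 1 : ZVal N)

theorem sharpL_apply (sig : Matrix (Fin N) (Fin N) ℝ) (e : ZVal N →L[ℝ] ℝ) :
    sharpL sig e = sharp sig e := by
  funext A
  simp [sharpL, sharp]

end Symplectic

/-! ### Histories, their jets in time, and the operators of the theory -/

section Histories

variable {n : ℕ} [NeZero n] {M : Type*} [TopologicalSpace M]
  [ChartedSpace (EuclideanHalfSpace n) M] [IsManifold (𝓡∂ n) ∞ M] {N m k : ℕ}

theorem SmoothFamily.fst {E V W : Type*} [NormedAddCommGroup E] [NormedSpace ℝ E]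
    [NormedAddCommGroup V] [NormedSpace ℝ V] [NormedAddCommGroup W] [NormedSpace ℝ W]
    {f : E → M → V × W} (hf : SmoothFamily n f) : SmoothFamily n (fun p x => (f p x).1) :=
  hf.post contDiff_fst

theorem SmoothFamily.snd {E V W : Type*} [NormedAddCommGroup E] [NormedSpace ℝ E]
    [NormedAddCommGroup V] [NormedSpace ℝ V] [NormedAddCommGroup W] [NormedSpace ℝ W]
    {f : E → M → V × W} (hf : SmoothFamily n f) : SmoothFamily n (fun p x => (f p x).2) :=
  hf.post contDiff_snd

theorem SmoothFamily.zDot {y : ℝ → M → ZLVal N m} (hy : SmoothFamily n y) :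
    SmoothFamily n (zDot y) :=
  hy.fst.deriv

theorem SmoothFamily.jetAt {y : ℝ → M → ZLVal N m} (hy : SmoothFamily n y) :
    SmoothFamily n (jetAt k y) :=
  hy.fst.prodMk (SmoothFamily.pi fun l : Fin (k + 1) => hy.snd.iteratedDeriv (l : ℕ))

/-- The variation `y + s e` of the history `y`, as a family with parameters `(s, t)`. -/
theorem SmoothFamily.variation {V : Type*} [NormedAddCommGroup V] [NormedSpace ℝ V]
    {y e : ℝ → M → V} (hy : SmoothFamily n y) (he : SmoothFamily n e) :
    SmoothFamily n (fun q : ℝ × ℝ => y q.2 + q.1 • e q.2) :=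
  (hy.comp_param contDiff_snd).add
    ((SmoothFamily.of_contDiff contDiff_fst).smul (he.comp_param contDiff_snd))

theorem SmoothFamily.add_smul {V : Type*} [NormedAddCommGroup V] [NormedSpace ℝ V]
    {y e : ℝ → M → V} (hy : SmoothFamily n y) (he : SmoothFamily n e) (s : ℝ) :
    SmoothFamily n (y + s • e) :=
  hy.add ((SmoothFamily.of_contDiff contDiff_const).smul he)

theorem zDot_add_smul {y e : ℝ → M → ZLVal N m} (hy : SmoothFamily n y) (he : SmoothFamily n e)
    (s t : ℝ) : zDot (y + s • e) t = zDot y t + s • zDot e t := by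
  funext x
  have h := (hy.fst.differentiableAt t x).hasDerivAt.add
    ((he.fst.differentiableAt t x).hasDerivAt.const_smul s)
  exact h.deriv

theorem jetAt_add_smul {y e : ℝ → M → ZLVal N m} (hy : SmoothFamily n y)
    (he : SmoothFamily n e) (s t : ℝ) :
    jetAt k (y + s • e) t = jetAt k y t + s • jetAt k e t := by
  funext x
  refine Prod.ext rfl (funext fun l => ?_)
  have h1 := ((hy.snd.at x).of_le (m := (l : ℕ)) (mod_cast le_top)).contDiffAt (x := t)
  have h2 := ((he.snd.at x).of_le (m := (l : ℕ)) (mod_cast le_top)).contDiffAt (x := t)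
  have h3 := iteratedDeriv_fun_add h1 (h2.const_smul s)
  have h4 := iteratedDeriv_fun_const_smul h2 s
  exact h3.trans (congrArg₂ (· + ·) rfl h4)

theorem SmoothFamily.zPart {E : Type*} [NormedAddCommGroup E] [NormedSpace ℝ E]
    {w : E → M → ZLVal N m} (hw : SmoothFamily n w) : SmoothFamily n (fun p => zPart (w p)) :=
  hw.fst

end Histories

namespace TheoryData

variable {n : ℕ} [NeZero n] {M : Type*} [TopologicalSpace M]
  [ChartedSpace (EuclideanHalfSpace n) M] [IsManifold (𝓡∂ n) ∞ M] [MeasurableSpace M]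
  {N m r k : ℕ} (T : TheoryData n M N m r)
  {E : Type*} [NormedAddCommGroup E] [NormedSpace ℝ E]

theorem smoothFamily_φ {z : E → M → ZVal N} (hz : SmoothFamily n z) :
    SmoothFamily n (fun p => T.φ (z p)) :=
  T.φ_local.smoothFamily hz (contDiff_const (c := (0 : ℝ)))

theorem smoothFamily_dh {z : E → M → ZVal N} (hz : SmoothFamily n z) :
    SmoothFamily n (fun p => T.dh (z p)) :=
  T.dh_spec.1.smoothFamily hz (contDiff_const (c := (0 : ℝ)))

theorem smoothFamily_dφz {w : E → M → ZLVal N m} (hw : SmoothFamily n w) :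
    SmoothFamily n (fun p => T.dφz (w p)) :=
  (T.dφ_spec.1.smoothFamily hw (contDiff_const (c := (0 : ℝ)))).post
    (contDiff_id.clm_comp contDiff_const)

theorem smoothFamily_dHz {w : E → M → ZLVal N m} (hw : SmoothFamily n w) :
    SmoothFamily n (fun p => T.dHz (w p)) :=
  (T.smoothFamily_dh hw.zPart).add (T.smoothFamily_dφz hw)

theorem _root_.ExtSym.SmoothFamily.sharp {f : E → M → ZVal N →L[ℝ] ℝ} (hf : SmoothFamily n f)
    (sig : Matrix (Fin N) (Fin N) ℝ) : SmoothFamily n (fun p x => sharp sig (f p x)) := by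
  simp_rw [← sharpL_apply]
  exact hf.post (sharpL sig).contDiff

theorem smoothFamily_flow {w : E → M → ZLVal N m} (hw : SmoothFamily n w) :
    SmoothFamily n (fun p => T.flow (w p)) :=
  (T.smoothFamily_dHz hw).sharp T.sig

theorem smoothFamily_genZ {dG : ℝ → (M → JVal N m k) → M → (JVal N m k →L[ℝ] ℝ)}
    (hdG : IsLocal n dG) {C : E → M → JVal N m k} (hC : SmoothFamily n C) {τ : E → ℝ}
    (hτ : ContDiff ℝ ∞ τ) : SmoothFamily n (fun p => T.genZ dG (τ p) (C p)) :=
  ((hdG.smoothFamily hC hτ).post (contDiff_id.clm_comp contDiff_const)).sharp T.sig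

theorem smoothFamily_transf {dG : ℝ → (M → JVal N m k) → M → (JVal N m k →L[ℝ] ℝ)}
    (hdG : IsLocal n dG) {Λ : ℝ → (M → JVal N m k) → M → Fin m → ℝ} (hΛ : IsLocal n Λ)
    {y : ℝ → M → ZLVal N m} (hy : SmoothFamily n y) :
    SmoothFamily n (T.transf dG Λ y) :=
  (T.smoothFamily_genZ hdG hy.jetAt contDiff_id).prodMk (hΛ.smoothFamily hy.jetAt contDiff_id)

theorem smoothFamily_hamiltonian_density {w : E → M → ZLVal N m} (hw : SmoothFamily n w) :
    SmoothFamily n (fun p x => T.h (zPart (w p)) x + ∑ a, (w p x).2 a * T.φ (zPart (w p)) x a) := by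
  refine (T.h_local.smoothFamily hw.zPart (contDiff_const (c := (0 : ℝ)))).add
    (SmoothFamily.sum fun a _ => SmoothFamily.mul ?_ ?_)
  · exact hw.snd.post (contDiff_apply ℝ ℝ a)
  · exact (T.smoothFamily_φ hw.zPart).post (contDiff_apply ℝ ℝ a)

variable [CompactSpace M] [BorelSpace M]

theorem contDiff_H {E : Type} [NormedAddCommGroup E] [NormedSpace ℝ E] [FiniteDimensional ℝ E]
    {w : E → M → ZLVal N m} (hw : SmoothFamily n w) : ContDiff ℝ ∞ (fun p => T.H (w p)) := by
  have := T.vol_smooth.isFiniteMeasure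
  have := T.bvol_smooth.isFiniteMeasure
  exact (T.smoothFamily_hamiltonian_density hw).contDiff_integral.add
    (T.b_local.smoothFamily hw (contDiff_const (c := (0 : ℝ)))).contDiff_integral

theorem _root_.ExtSym.LocalFunctional.contDiff_val {V : Type*} [NormedAddCommGroup V]
    [NormedSpace ℝ V] (G : LocalFunctional n M V) {E : Type} [NormedAddCommGroup E]
    [NormedSpace ℝ E] [FiniteDimensional ℝ E] {C : E → M → V} (hC : SmoothFamily n C) {τ : E → ℝ}
    (hτ : ContDiff ℝ ∞ τ) : ContDiff ℝ ∞ (fun p => G.val T.vol T.bvol (τ p) (C p)) := by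
  have := T.vol_smooth.isFiniteMeasure
  have := T.bvol_smooth.isFiniteMeasure
  exact (G.bulk_local.smoothFamily hC hτ).contDiff_integral.add
    (G.bdry_local.smoothFamily hC hτ).contDiff_integral

theorem deriv_H_add {f v w : M → ZLVal N m} (hf : SmoothField n f) (hv : SmoothField n v)
    (hw : SmoothField n w) :
    deriv (fun r : ℝ => T.H (f + r • (v + w))) 0 =
      deriv (fun r : ℝ => T.H (f + r • v)) 0 + deriv (fun r : ℝ => T.H (f + r • w)) 0 := by
  have h := ((T.contDiff_H (SmoothFamily.plane hf hv hw)).differentiable (by simp)) ((0, 0) : ℝ × ℝ)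
  simpa [add_assoc] using deriv_diagonal h

/-- For variations supported in the interior the variation of the total Hamiltonian is
`∫ (δH/δz^A δz^A + φ_a δλ^a)`. -/
theorem hasDerivAt_H_interior {f v : M → ZLVal N m} (hf : SmoothField n f)
    (hv : SmoothField n v) (hsupp : tsupport v ⊆ (𝓡∂ n).interior M) :
    HasDerivAt (fun s : ℝ => T.H (f + s • v))
      (∫ x, (T.dHz f x (v x).1 + ∑ a, T.φ (zPart f) x a * (v x).2 a) ∂T.vol) 0 := by
  have := T.vol_smooth.isFiniteMeasure
  have := T.bvol_smooth.isFiniteMeasure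
  have hv' : SmoothFamily n (fun _ : ℝ => v) := hv.family
  have hf' : SmoothFamily n (fun _ : ℝ => f) := hf.family
  have hline := SmoothFamily.line hf hv
  have supp_of : ∀ {W : Type} [NormedAddCommGroup W] (g : ZLVal N m → W), g 0 = 0 →
      tsupport (fun x => g (v x)) ⊆ (𝓡∂ n).interior M := fun g hg =>
    (closure_mono (Function.support_comp_subset hg v)).trans hsupp
  let vz : M → ZVal N := fun x => (v x).1
  have hvz : SmoothField n vz := (hv'.fst).field 0
  let vz' : M → ZLVal N m := fun x => ((v x).1, 0)
  have hvz' : SmoothField n vz' :=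
    (hv'.fst.prodMk (SmoothFamily.of_contDiff (contDiff_const (c := (0 : Fin m → ℝ))))).field 0
  let vl : M → ZLVal N m := fun x => (0, (v x).2)
  have hvl : SmoothField n vl :=
    ((SmoothFamily.of_contDiff (contDiff_const (c := (0 : ZVal N)))).prodMk hv'.snd).field 0
  have dphiapply : SmoothFamily n (fun _ : ℝ => T.dφ f) :=
    T.dφ_spec.1.smoothFamily hf' (contDiff_const (c := (0 : ℝ)))
  -- the derivative of `∫ h`
  have d1 := T.dh_spec.2 0 (zPart f) vz (hf'.zPart.field 0) hvz (supp_of (fun p => p.1) rfl)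
  -- the derivative of `∫ λ^a φ_a`, first along `v`, then along its `λ`-part
  have d2 := T.dφ_spec.2 0 f v hf hv hsupp
  have d3 := T.dφ_spec.2 0 f vl hf hvl (supp_of (fun p => ((0 : ZVal N), p.2)) rfl)
  have hφf : ∀ a, SmoothField n (fun x => T.φ (zPart f) x a) := fun a =>
    ((T.smoothFamily_φ hf'.zPart).post (contDiff_apply ℝ ℝ a)).field 0
  have hmul : ∀ {g : M → ZLVal N m}, SmoothField n g →
      SmoothField n (fun x => ∑ a, (g x).2 a * T.φ (zPart f) x a) := fun {g} hg =>
    (SmoothFamily.sum (E := ℝ) fun a _ => (hg.family.snd.post (contDiff_apply ℝ ℝ a)).mul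
      (hφf a).family).field 0
  have e3 : ∫ x, T.dφ f x (vl x) ∂T.vol = ∫ x, ∑ a, T.φ (zPart f) x a * (v x).2 a ∂T.vol := by
    refine d3.unique ?_
    have hz : ∀ s : ℝ, zPart (f + s • vl) = zPart f := by
      intro s; funext x; simp [zPart, vl]
    have he : (fun s : ℝ => ∫ x, ∑ a, ((f + s • vl) x).2 a * T.φ (zPart (f + s • vl)) x a ∂T.vol) =
        fun s : ℝ => (∫ x, ∑ a, (f x).2 a * T.φ (zPart f) x a ∂T.vol) +
          s * ∫ x, ∑ a, T.φ (zPart f) x a * (v x).2 a ∂T.vol := by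
      funext s
      rw [← integral_const_mul, ← integral_add (hmul hf).integrable
        (((hmul hv).integrable.congr (Filter.Eventually.of_forall fun x =>
          Finset.sum_congr rfl fun a _ => mul_comm _ _)).const_mul s)]
      refine integral_congr_ae (Filter.Eventually.of_forall fun x => ?_)
      simp only [hz, Finset.mul_sum, ← Finset.sum_add_distrib]
      refine Finset.sum_congr rfl fun a _ => ?_
      simp [vl]; ring
    rw [he]
    simpa using ((hasDerivAt_id (0 : ℝ)).mul_const
      (∫ x, ∑ a, T.φ (zPart f) x a * (v x).2 a ∂T.vol)).const_add
      (∫ x, ∑ a, (f x).2 a * T.φ (zPart f) x a ∂T.vol)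
  -- the boundary term does not feel the variation
  have d4 : HasDerivAt (fun s : ℝ => ∫ x, T.b (f + s • v) x ∂T.bvol) 0 0 := by
    have hb : (fun s : ℝ => ∫ x, T.b (f + s • v) x ∂T.bvol) =
        fun _ => ∫ x, T.b f x ∂T.bvol := by
      funext s
      refine integral_congr_ae ?_
      have h0 : ∀ᵐ x ∂T.bvol, x ∉ tsupport v := by
        rw [ae_iff]; simpa using T.bvol_smooth.measure_eq_zero hsupp
      filter_upwards [h0] with x hx
      refine T.b_local.congr_of_eventuallyEq 0 (hline.field s) hf ?_
      filter_upwards [notMem_tsupport_iff_eventuallyEq.1 hx] with x' hx'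
      simp [hx']
    rw [hb]
    exact hasDerivAt_const _ _
  have hfam := (T.smoothFamily_hamiltonian_density hline)
  have hsplit : (fun s : ℝ => T.H (f + s • v)) = fun s : ℝ =>
      ((∫ x, T.h (zPart f + s • vz) x ∂T.vol) +
        ∫ x, ∑ a, ((f + s • v) x).2 a * T.φ (zPart (f + s • v)) x a ∂T.vol) +
        ∫ x, T.b (f + s • v) x ∂T.bvol := by
    funext s
    rw [H, integral_add]
    · rfl
    · exact ((T.h_local.smoothFamily hline.zPart (contDiff_const (c := (0 : ℝ)))).integrable s)
    · exact (SmoothFamily.sum fun a _ => (hline.snd.post (contDiff_apply ℝ ℝ a)).mul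
        ((T.smoothFamily_φ hline.zPart).post (contDiff_apply ℝ ℝ a))).integrable s
  rw [hsplit]
  refine ((d1.add d2).add d4).congr_deriv (Eq.symm ?_)
  have i1 : Integrable (fun x => T.dφ f x (vz' x)) T.vol := (dphiapply.clm hvz'.family).integrable 0
  have i2 : Integrable (fun x => T.dφ f x (vl x)) T.vol := (dphiapply.clm hvl.family).integrable 0
  have i3 : Integrable (fun x => T.dh (zPart f) x (vz x)) T.vol :=
    ((T.smoothFamily_dh hf'.zPart).clm hvz.family).integrable 0
  have i4 : Integrable (fun x => ∑ a, T.φ (zPart f) x a * (v x).2 a) T.vol :=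
    (hmul hv).integrable.congr (Filter.Eventually.of_forall fun x =>
          Finset.sum_congr rfl fun a _ => mul_comm _ _)
  have e5 : ∀ x, T.dφ f x (v x) = T.dφ f x (vz' x) + T.dφ f x (vl x) := by
    intro x
    rw [← map_add]
    congr 1
    simp [vz', vl]
  have e6 : ∀ x, T.dHz f x (v x).1 = T.dh (zPart f) x (vz x) + T.dφ f x (vz' x) := by
    intro x
    simp [dHz, dφz, vz, vz']
  change _ = (∫ x, T.dh (zPart f) x (vz x) ∂T.vol) + (∫ x, T.dφ f x (v x) ∂T.vol) + 0
  simp_rw [e6, e5]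
  have i5 : Integrable (fun x => T.dh (zPart f) x (vz x) + T.dφ f x (vz' x)) T.vol := i3.add i1
  rw [integral_add i1 i2, e3, add_zero, integral_add i5 i4, integral_add i3 i1, add_assoc]

end TheoryData

/-! ### Conservation law of an external symmetry -/

section Calculus

theorem hasDerivAt_slice_left {K : ℝ × ℝ → ℝ} (hK : ContDiff ℝ ∞ K) (s t : ℝ) :
    HasDerivAt (fun s => K (s, t)) (fderiv ℝ K (s, t) (1, 0)) s :=
  ((hK.differentiable (by simp)) (s, t)).hasFDerivAt.comp_hasDerivAt s
    ((hasDerivAt_id s).prodMk (hasDerivAt_const s t))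

theorem continuous_deriv_slice_left {K : ℝ × ℝ → ℝ} (hK : ContDiff ℝ ∞ K) :
    Continuous (fun q : ℝ × ℝ => deriv (fun s => K (s, q.2)) q.1) := by
  have h : (fun q : ℝ × ℝ => deriv (fun s => K (s, q.2)) q.1) =
      fun q => fderiv ℝ K q (1, 0) :=
    funext fun q => (hasDerivAt_slice_left hK q.1 q.2).deriv
  rw [h]
  exact (hK.continuous_fderiv (by simp)).clm_apply continuous_const

theorem continuous_deriv_slice_left_at {K : ℝ × ℝ → ℝ} (hK : ContDiff ℝ ∞ K) (s₀ : ℝ) :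
    Continuous (fun t : ℝ => deriv (fun s => K (s, t)) s₀) :=
  (continuous_deriv_slice_left hK).comp (by fun_prop : Continuous fun t : ℝ => (s₀, t))

theorem hasDerivAt_intervalIntegral_left {K : ℝ × ℝ → ℝ} (hK : ContDiff ℝ ∞ K) (a b s₀ : ℝ) :
    HasDerivAt (fun s => ∫ t in a..b, K (s, t)) (∫ t in a..b, deriv (fun s => K (s, t)) s₀) s₀ := by
  have hc := continuous_deriv_slice_left hK
  obtain ⟨C, hC⟩ := ((isCompact_closedBall s₀ 1).prod
    (isCompact_uIcc (a := a) (b := b))).exists_bound_of_continuousOn hc.continuousOn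
  refine (intervalIntegral.hasDerivAt_integral_of_dominated_loc_of_deriv_le
    (F := fun s t => K (s, t)) (F' := fun s t => deriv (fun s => K (s, t)) s)
    (bound := fun _ => C) (Metric.closedBall_mem_nhds s₀ one_pos)
    (Filter.Eventually.of_forall fun s => ?_) ?_ ?_ ?_ intervalIntegrable_const ?_).2
  · exact (hK.continuous.comp (by fun_prop : Continuous fun t => (s, t))).aestronglyMeasurable
  · exact (hK.continuous.comp (by fun_prop : Continuous fun t => (s₀, t))).intervalIntegrable _ _
  · exact (hc.comp (by fun_prop : Continuous fun t => (s₀, t))).aestronglyMeasurable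
  · exact Filter.Eventually.of_forall fun t ht s hs => hC (s, t) ⟨hs, uIoc_subset_uIcc ht⟩
  · exact Filter.Eventually.of_forall fun t _ s _ =>
      (hasDerivAt_slice_left hK s t).differentiableAt.hasDerivAt

/-- Symmetry of mixed partial derivatives of a smooth function of two real variables. -/
theorem hasDerivAt_deriv_swap {K : ℝ × ℝ → ℝ} (hK : ContDiff ℝ ∞ K) (s t : ℝ) :
    HasDerivAt (fun s => deriv (fun t => K (s, t)) t)
      (deriv (fun t => deriv (fun s => K (s, t)) s) t) s := by
  have h := hasDerivAt_fderivWithin_slice (S := (univ : Set ℝ)) uniqueDiffOn_univ (by simp)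
    (g := K) (by simpa using hK.contDiffOn) s (mem_univ t)
  simpa only [fderivWithin_univ, fderiv_apply_one_eq_deriv, map_zero, add_zero] using
    h.clm_apply (hasDerivAt_const s (1 : ℝ))

/-- A primitive of a continuous function is differentiable. -/
theorem hasDerivAt_of_eq_integral {u f : ℝ → ℝ} (hf : Continuous f) {t₀ t₁ τ : ℝ}
    (hτ : τ ∈ Ioo t₀ t₁) (h : ∀ b ∈ Ioc t₀ t₁, u b = u t₀ + ∫ t in t₀..b, f t) :
    HasDerivAt u (f τ) τ := by
  have h1 := (intervalIntegral.integral_hasDerivAt_right (hf.intervalIntegrable t₀ τ)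
    (hf.stronglyMeasurableAtFilter volume _) hf.continuousAt).const_add (u t₀)
  refine h1.congr_of_eventuallyEq ?_
  filter_upwards [Ioo_mem_nhds hτ.1 hτ.2] with b hb
  exact h b ⟨hb.1, hb.2.le⟩

end Calculus

namespace TheoryData

variable {n : ℕ} [NeZero n] {M : Type*} [TopologicalSpace M]
  [ChartedSpace (EuclideanHalfSpace n) M] [IsManifold (𝓡∂ n) ∞ M] [MeasurableSpace M]
  {N m r k : ℕ} (T : TheoryData n M N m r)

theorem Admissible.mono {T : TheoryData n M N m r} {t₀ t₁ b : ℝ} {y : ℝ → M → ZLVal N m}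
    (h : T.Admissible t₀ t₁ y) (hb : b ≤ t₁) : T.Admissible t₀ b y :=
  ⟨h.smooth, fun t ht => h.constraints t ⟨ht.1, ht.2.trans hb⟩,
    fun t ht => h.motion t ⟨ht.1, ht.2.trans hb⟩⟩

/-- The integrand of the action, on the history `y + s w`, as a function of `(s, t)`. -/
def lagrangian (y w : ℝ → M → ZLVal N m) (q : ℝ × ℝ) : ℝ :=
  (∫ x, (1 / 2 : ℝ) * sympl T.sig ((y q.2 + q.1 • w q.2) x).1
    ((zDot y q.2 + q.1 • zDot w q.2) x) ∂T.vol) - T.H (y q.2 + q.1 • w q.2)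

variable [CompactSpace M] [BorelSpace M]

theorem smoothFamily_kinetic {y w : ℝ → M → ZLVal N m} (hy : SmoothFamily n y)
    (hw : SmoothFamily n w) :
    SmoothFamily n (fun (q : ℝ × ℝ) x => (1 / 2 : ℝ) *
      sympl T.sig ((y q.2 + q.1 • w q.2) x).1 ((zDot y q.2 + q.1 • zDot w q.2) x)) :=
  ((SmoothFamily.variation hy hw).fst.prodMk (SmoothFamily.variation hy.zDot hw.zDot)).post
    (contDiff_const.mul (contDiff_sympl T.sig))

theorem contDiff_lagrangian {y w : ℝ → M → ZLVal N m} (hy : SmoothFamily n y)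
    (hw : SmoothFamily n w) : ContDiff ℝ ∞ (T.lagrangian y w) := by
  have := T.vol_smooth.isFiniteMeasure
  exact (T.smoothFamily_kinetic hy hw).contDiff_integral.sub
    (T.contDiff_H (SmoothFamily.variation hy hw))

theorem action_add_smul {y w : ℝ → M → ZLVal N m} (hy : SmoothFamily n y)
    (hw : SmoothFamily n w) (t₀ t₁ s : ℝ) :
    T.action t₀ t₁ (y + s • w) = ∫ t in t₀..t₁, T.lagrangian y w (s, t) := by
  unfold action lagrangian
  simp only [zDot_add_smul hy hw]
  rfl

theorem deriv_lagrangian {y w : ℝ → M → ZLVal N m} (hy : SmoothFamily n y)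
    (hw : SmoothFamily n w) (t : ℝ) :
    deriv (fun s => T.lagrangian y w (s, t)) 0 =
      (∫ x, (1 / 2 : ℝ) * (sympl T.sig (w t x).1 (zDot y t x) +
        sympl T.sig (y t x).1 (zDot w t x)) ∂T.vol) - deriv (fun s : ℝ => T.H (y t + s • w t)) 0 := by
  have := T.vol_smooth.isFiniteMeasure
  have h1 : SmoothFamily n (fun (s : ℝ) x => (1 / 2 : ℝ) *
      sympl T.sig ((y t + s • w t) x).1 ((zDot y t + s • zDot w t) x)) :=
    (T.smoothFamily_kinetic hy hw).comp_param (g := fun s : ℝ => (s, t)) (by fun_prop)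
  have h2 : DifferentiableAt ℝ (fun s : ℝ => T.H (y t + s • w t)) 0 :=
    (T.contDiff_H (SmoothFamily.line (hy.field t) (hw.field t))).differentiable (by simp) 0
  have h3 := ((h1.hasDerivAt_integral (μ := T.vol) 0).sub h2.hasDerivAt).deriv
  refine h3.trans ?_
  congr 1
  refine integral_congr_ae (Filter.Eventually.of_forall fun x => ?_)
  have a1 : HasDerivAt (fun s : ℝ => ((y t + s • w t) x).1) (w t x).1 0 := by
    simpa using ((hasDerivAt_id (0 : ℝ)).smul_const (w t x).1).const_add (y t x).1
  have a2 : HasDerivAt (fun s : ℝ => (zDot y t + s • zDot w t) x) (zDot w t x) 0 := by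
    simpa using ((hasDerivAt_id (0 : ℝ)).smul_const (zDot w t x)).const_add (zDot y t x)
  have a3 := ((hasDerivAt_sympl T.sig a1 a2).const_mul (1 / 2 : ℝ)).deriv
  simpa using a3

/-- The conservation law. Along an admissible history the time derivative of the canonical
generator is `∫ (δG/δz^A dz^A/dt) + δ_G H + ∮ V`. -/
theorem hasDerivAt_generator {G U : LocalFunctional n M (JVal N m k)}
    {dG : ℝ → (M → JVal N m k) → M → (JVal N m k →L[ℝ] ℝ)} (hdG : IsLocal n dG)
    {Λ : ℝ → (M → JVal N m k) → M → Fin m → ℝ} (hΛ : IsLocal n Λ)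
    {k' : ℕ} {V : ℝ → (M → JVal N m k') → M → ℝ} (hV : IsLocal n V)
    (hact : ∀ t₀ t₁ : ℝ, t₀ < t₁ → ∀ y : ℝ → M → ZLVal N m, T.Admissible t₀ t₁ y →
      HasDerivAt (fun s : ℝ => T.action t₀ t₁ (y + s • T.transf dG Λ y))
        (U.val T.vol T.bvol t₁ (jetAt k y t₁) - U.val T.vol T.bvol t₀ (jetAt k y t₀)
          + ∫ t in t₀..t₁, ∫ x, V t (jetAt k' y t) x ∂T.bvol) 0)
    (hcan : ∀ (t : ℝ) (C : M → JVal N m k), SmoothField n C →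
      G.val T.vol T.bvol t C =
        (∫ x, (1 / 2 : ℝ) * ((C x).1 ⬝ᵥ (T.sig⁻¹).mulVec (T.genZ dG t C x)) ∂T.vol)
          - U.val T.vol T.bvol t C)
    {t₀ t₁ : ℝ} {y : ℝ → M → ZLVal N m} (hy : T.Admissible t₀ t₁ y) {τ : ℝ}
    (hτ : τ ∈ Ioo t₀ t₁) :
    HasDerivAt (fun t => G.val T.vol T.bvol t (jetAt k y t))
      ((∫ x, dG τ (jetAt k y τ) x (zDot y τ x, 0) ∂T.vol)
        + deriv (fun s : ℝ => T.H (y τ + s • T.transf dG Λ y τ)) 0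
        + ∫ x, V τ (jetAt k' y τ) x ∂T.bvol) τ := by
  have := T.vol_smooth.isFiniteMeasure
  have := T.bvol_smooth.isFiniteMeasure
  have hys : SmoothFamily n y := hy.smooth
  obtain ⟨w, hw⟩ : ∃ w, w = T.transf dG Λ y := ⟨_, rfl⟩
  have hws : SmoothFamily n w := by rw [hw]; exact T.smoothFamily_transf hdG hΛ hys
  have hwZ : ∀ t x, (w t x).1 = T.genZ dG t (jetAt k y t) x := fun t x => by rw [hw]; rfl
  rw [← hw]
  have hL : ContDiff ℝ ∞ (T.lagrangian y w) := T.contDiff_lagrangian hys hws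
  let ℓ : ℝ → ℝ := fun t => deriv (fun s => T.lagrangian y w (s, t)) 0
  have hℓ : Continuous ℓ := continuous_deriv_slice_left_at hL 0
  let v : ℝ → ℝ := fun t => ∫ x, V t (jetAt k' y t) x ∂T.bvol
  have hv : Continuous v :=
    ((hV.smoothFamily hys.jetAt contDiff_id).contDiff_integral (μ := T.bvol)).continuous
  let u : ℝ → ℝ := fun t => U.val T.vol T.bvol t (jetAt k y t)
  have hu : ∀ b ∈ Ioc t₀ t₁, u b = u t₀ + ∫ t in t₀..b, (ℓ t - v t) := by
    intro b hb
    -- an admissible history stays admissible on `[t₀, b]`, so the symmetry applies there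
    have h1 := hact t₀ b hb.1 y (hy.mono hb.2)
    simp_rw [← hw, T.action_add_smul hys hws] at h1
    have h3 := hasDerivAt_intervalIntegral_left hL t₀ b 0
    have h2 := h1.unique h3
    rw [intervalIntegral.integral_sub (hℓ.intervalIntegrable _ _) (hv.intervalIntegrable _ _)]
    change _ = u t₀ + ((∫ t in t₀..b, deriv (fun s => T.lagrangian y w (s, t)) 0) - _)
    rw [← h2]
    simp only [u, v]
    ring
  have hu' : HasDerivAt u (ℓ τ - v τ) τ :=
    hasDerivAt_of_eq_integral (hℓ.sub hv) hτ hu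
  have hZ : SmoothFamily n (fun t x => (w t x).1) := hws.fst
  have hzZ : SmoothFamily n (fun t x => (1 / 2 : ℝ) * sympl T.sig (y t x).1 (w t x).1) :=
    (hys.fst.prodMk hZ).post (contDiff_const.mul (contDiff_sympl T.sig))
  have hG : (fun t => G.val T.vol T.bvol t (jetAt k y t)) =
      fun t => (∫ x, (1 / 2 : ℝ) * sympl T.sig (y t x).1 (w t x).1 ∂T.vol) - u t :=
    funext fun t => by
      simp_rw [hwZ]
      exact hcan t (jetAt k y t) (hys.jetAt.field t)
  rw [hG]
  have hd := (hzZ.hasDerivAt_integral (μ := T.vol) τ).fun_sub hu'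
  refine hd.congr_deriv ?_
  have e1 : ∀ x, deriv (fun t => (1 / 2 : ℝ) * sympl T.sig (y t x).1 (w t x).1) τ =
      (1 / 2 : ℝ) * (sympl T.sig (zDot y τ x) (w τ x).1 + sympl T.sig (y τ x).1 (zDot w τ x)) := by
    intro x
    exact ((hasDerivAt_sympl T.sig (hys.fst.differentiableAt τ x).hasDerivAt
      (hZ.differentiableAt τ x).hasDerivAt).const_mul (1 / 2 : ℝ)).deriv
  have e2 : ℓ τ = _ := T.deriv_lagrangian hys hws τ
  have i1 : Integrable (fun x => (1 / 2 : ℝ) * (sympl T.sig (zDot y τ x) (w τ x).1 +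
      sympl T.sig (y τ x).1 (zDot w τ x))) T.vol := by
    have := (hzZ.deriv.integrable (μ := T.vol) τ)
    simpa only [e1] using this
  have i2 : Integrable (fun x => (1 / 2 : ℝ) * (sympl T.sig (w τ x).1 (zDot y τ x) +
        sympl T.sig (y τ x).1 (zDot w τ x))) T.vol :=
    (((hZ.prodMk hys.zDot).post (contDiff_sympl T.sig)).add
      ((hys.fst.prodMk hws.zDot).post (contDiff_sympl T.sig))).integrable τ |>.const_mul _
  simp_rw [e1]
  -- the terms with `dZ/dt` cancel; the others combine by antisymmetry of `σ`
  rw [e2, ← sub_add, ← sub_add, ← integral_sub i1 i2]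
  congr 2
  refine integral_congr_ae (Filter.Eventually.of_forall fun x => ?_)
  have e3 : sympl T.sig (w τ x).1 (zDot y τ x) = - dG τ (jetAt k y τ) x (zDot y τ x, 0) := by
    rw [hwZ]
    exact sympl_sharp T.sig_antisymm T.sig_isUnit _ _
  simp only
  rw [sympl_swap T.sig_antisymm T.sig_isUnit (zDot y τ x), e3]
  ring

end TheoryData

/-! ### Varying the conservation law in the interior -/

section Germs

variable {n : ℕ} [NeZero n] {M : Type*} [TopologicalSpace M]
  [ChartedSpace (EuclideanHalfSpace n) M] [IsManifold (𝓡∂ n) ∞ M] {N m k : ℕ}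

theorem FlatAt.congr {V : Type*} [NormedAddCommGroup V] [NormedSpace ℝ V] {f g : M → V} {x : M}
    (hf : FlatAt n f x) (h : f =ᶠ[nhds x] g) : FlatAt n g x := fun j => by
  rw [← chartDeriv_congr_of_eventuallyEq h x j (mem_extChartAt_source x)]
  exact hf j

theorem IsLocal.eq_of_eqOn {V W : Type*} [NormedAddCommGroup V] [NormedSpace ℝ V]
    [NormedAddCommGroup W] [NormedSpace ℝ W] {L : ℝ → (M → V) → M → W} (hL : IsLocal n L) (t : ℝ)
    {f g : M → V} (hf : SmoothField n f) (hg : SmoothField n g) {O : Set M} (hO : IsOpen O)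
    (h : EqOn f g O) {x : M} (hx : x ∈ O) : L t f x = L t g x :=
  hL.congr_of_eventuallyEq t hf hg (h.eventuallyEq_of_mem (hO.mem_nhds hx))

theorem zDot_eq_of_eq {y y' : ℝ → M → ZLVal N m} {x : M} (h : ∀ t, y t x = y' t x) (t : ℝ) :
    zDot y t x = zDot y' t x := by
  simp [zDot, h]

theorem jetAt_eq_of_eq {y y' : ℝ → M → ZLVal N m} {x : M} (h : ∀ t, y t x = y' t x) (t : ℝ) :
    jetAt k y t x = jetAt k y' t x := by
  simp [jetAt, h]

end Germs

namespace TheoryData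

variable {n : ℕ} [NeZero n] {M : Type*} [TopologicalSpace M]
  [ChartedSpace (EuclideanHalfSpace n) M] [IsManifold (𝓡∂ n) ∞ M] [MeasurableSpace M]
  {N m r k : ℕ} (T : TheoryData n M N m r)

theorem flow_eq_of_eqOn {w w' : M → ZLVal N m} (hw : SmoothField n w) (hw' : SmoothField n w')
    {O : Set M} (hO : IsOpen O) (h : EqOn w w' O) {x : M} (hx : x ∈ O) :
    T.flow w x = T.flow w' x := by
  have h1 : T.dh (zPart w) x = T.dh (zPart w') x :=
    T.dh_spec.1.eq_of_eqOn 0 (hw.family (E := ℝ).zPart.field 0) (hw'.family (E := ℝ).zPart.field 0)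
      hO (fun x hx => congrArg Prod.fst (h hx)) hx
  have h2 : T.dφ w x = T.dφ w' x := T.dφ_spec.1.eq_of_eqOn 0 hw hw' hO h hx
  simp only [flow, dHz, dφz, h1, h2]

theorem φ_eq_of_eqOn {w w' : M → ZLVal N m} (hw : SmoothField n w) (hw' : SmoothField n w')
    {O : Set M} (hO : IsOpen O) (h : EqOn w w' O) {x : M} (hx : x ∈ O) :
    T.φ (zPart w) x = T.φ (zPart w') x :=
  T.φ_local.eq_of_eqOn 0 (hw.family (E := ℝ).zPart.field 0) (hw'.family (E := ℝ).zPart.field 0)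
      hO (fun _ hx => congrArg Prod.fst (h hx)) hx

/-- The external boundary conditions only involve the fields near the boundary. -/
theorem Admissible.congr {T : TheoryData n M N m r} {t₀ t₁ : ℝ} {y y' : ℝ → M → ZLVal N m}
    (hy : T.Admissible t₀ t₁ y) (hy' : SmoothFamily n y') {K : Set M} (hK : IsClosed K)
    (hKi : K ⊆ (𝓡∂ n).interior M) (h : ∀ t, ∀ x ∉ K, y t x = y' t x) :
    T.Admissible t₀ t₁ y' := by
  have hb : ∀ x ∈ (𝓡∂ n).boundary M, x ∈ Kᶜ := fun x hx hxK =>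
    (ModelWithCorners.disjoint_interior_boundary (I := 𝓡∂ n) (M := M)).le_bot ⟨hKi hxK, hx⟩
  have hys : SmoothFamily n y := hy.smooth
  refine ⟨hy', fun t ht x hx => (hy.constraints t ht x hx).congr ?_,
    fun t ht x hx => (hy.motion t ht x hx).congr ?_⟩
  · filter_upwards [hK.isOpen_compl.mem_nhds (hb x hx)] with x' hx'
    exact T.φ_eq_of_eqOn (hys.field t) (hy'.field t) hK.isOpen_compl (h t) hx'
  · filter_upwards [hK.isOpen_compl.mem_nhds (hb x hx)] with x' hx'
    rw [zDot_eq_of_eq (fun t => h t x' hx'),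
      T.flow_eq_of_eqOn (hys.field t) (hy'.field t) hK.isOpen_compl (h t) hx']

variable [CompactSpace M] [BorelSpace M]

/-- The change of the conservation law under a variation `e` of the history that is supported in
the interior, does not move `z`, and vanishes at time `τ` (though its time derivatives there need
not vanish). -/
theorem deriv_pairing_eq {G U : LocalFunctional n M (JVal N m k)}
    {dG : ℝ → (M → JVal N m k) → M → (JVal N m k →L[ℝ] ℝ)}
    (hdG : IsFunctionalDerivative n T.vol (G.val T.vol T.bvol) dG)
    {Λ : ℝ → (M → JVal N m k) → M → Fin m → ℝ} (hΛ : IsLocal n Λ)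
    {k' : ℕ} {V : ℝ → (M → JVal N m k') → M → ℝ} (hV : IsLocal n V)
    (hact : ∀ t₀ t₁ : ℝ, t₀ < t₁ → ∀ y : ℝ → M → ZLVal N m, T.Admissible t₀ t₁ y →
      HasDerivAt (fun s : ℝ => T.action t₀ t₁ (y + s • T.transf dG Λ y))
        (U.val T.vol T.bvol t₁ (jetAt k y t₁) - U.val T.vol T.bvol t₀ (jetAt k y t₀)
          + ∫ t in t₀..t₁, ∫ x, V t (jetAt k' y t) x ∂T.bvol) 0)
    (hcan : ∀ (t : ℝ) (C : M → JVal N m k), SmoothField n C →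
      G.val T.vol T.bvol t C =
        (∫ x, (1 / 2 : ℝ) * ((C x).1 ⬝ᵥ (T.sig⁻¹).mulVec (T.genZ dG t C x)) ∂T.vol)
          - U.val T.vol T.bvol t C)
    {t₀ t₁ : ℝ} {y : ℝ → M → ZLVal N m} (hy : T.Admissible t₀ t₁ y) {τ : ℝ}
    (hτ : τ ∈ Ioo t₀ t₁) {e : ℝ → M → ZLVal N m} (he : SmoothFamily n e) {K : Set M}
    (hK : IsClosed K) (hKi : K ⊆ (𝓡∂ n).interior M) (heK : ∀ t, ∀ x ∉ K, e t x = 0)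
    (hez : ∀ t x, (e t x).1 = 0) (heτ : e τ = 0) :
    deriv (fun t => ∫ x, dG t (jetAt k y t) x (jetAt k e t x) ∂T.vol) τ =
      ∫ x, (dirDeriv dG τ (jetAt k y τ) (jetAt k e τ) x (zDot y τ x - T.flow (y τ) x, 0) +
        ∑ a, T.φ (zPart (y τ)) x a * dirDeriv Λ τ (jetAt k y τ) (jetAt k e τ) x a) ∂T.vol := by
  have := T.vol_smooth.isFiniteMeasure
  have := T.bvol_smooth.isFiniteMeasure
  have hys : SmoothFamily n y := hy.smooth
  have hKc := hK.isOpen_compl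
  have hyss : ∀ s : ℝ, SmoothFamily n (y + s • e) := fun s => hys.add_smul he s
  have hyseq : ∀ (s t : ℝ), ∀ x ∉ K, y t x = (y + s • e) t x := by
    intro s t x hx; simp [heK t x hx]
  have hadm : ∀ s : ℝ, T.Admissible t₀ t₁ (y + s • e) := fun s =>
    hy.congr (hyss s) hK hKi (hyseq s)
  have hysτ : ∀ s : ℝ, (y + s • e) τ = y τ := by
    intro s; simp [heτ]
  have hzdot : ∀ s : ℝ, zDot (y + s • e) τ = zDot y τ := by
    intro s; funext x; simp [zDot, hez]
  have hjet : ∀ s t : ℝ, jetAt k (y + s • e) t = jetAt k y t + s • jetAt k e t :=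
    fun s t => jetAt_add_smul hys he s t
  -- the part of the conservation law that changes with the variation
  let X : ℝ → M → ℝ := fun s x =>
    dG τ (jetAt k y τ + s • jetAt k e τ) x (zDot y τ x - T.flow (y τ) x, 0) +
      ∑ a, T.φ (zPart (y τ)) x a * Λ τ (jetAt k y τ + s • jetAt k e τ) x a
  have hline : SmoothFamily n (fun s : ℝ => jetAt k y τ + s • jetAt k e τ) :=
    SmoothFamily.line (hys.jetAt.field τ) (he.jetAt.field τ)
  have hdGl : SmoothFamily n (fun s : ℝ => dG τ (jetAt k y τ + s • jetAt k e τ)) :=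
    hdG.1.smoothFamily hline contDiff_const
  have hΛl : SmoothFamily n (fun s : ℝ => Λ τ (jetAt k y τ + s • jetAt k e τ)) :=
    hΛ.smoothFamily hline contDiff_const
  have hyτ : SmoothFamily n (fun _ : ℝ => y τ) := (hys.field τ).family
  have hżτ : SmoothFamily n (fun _ : ℝ => zDot y τ) := (hys.zDot.field τ).family
  have hzero : SmoothFamily n (fun (_ : ℝ) (_ : M) => (0 : Fin (k + 1) → Fin m → ℝ)) :=
    SmoothFamily.of_contDiff contDiff_const
  have hφτ : ∀ a, SmoothFamily n (fun (_ : ℝ) x => T.φ (zPart (y τ)) x a) := fun a =>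
    (T.smoothFamily_φ hyτ.zPart).post (contDiff_apply ℝ ℝ a)
  have hflow : SmoothFamily n (fun _ : ℝ => T.flow (y τ)) := T.smoothFamily_flow hyτ
  have hX : SmoothFamily n X :=
    (hdGl.clm ((hżτ.sub hflow).prodMk hzero)).add
      (SmoothFamily.sum fun a _ => (hφτ a).mul (hΛl.post (contDiff_apply ℝ ℝ a)))
  have hlaw := fun s : ℝ =>
    (T.hasDerivAt_generator hdG.1 hΛ hV hact hcan (hadm s) hτ).deriv
  have hVs : ∀ s : ℝ, ∫ x, V τ (jetAt k' (y + s • e) τ) x ∂T.bvol =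
      ∫ x, V τ (jetAt k' y τ) x ∂T.bvol := by
    intro s
    refine integral_congr_ae ?_
    have h0 : ∀ᵐ x ∂T.bvol, x ∉ K := by
      rw [ae_iff]; simpa using T.bvol_smooth.measure_eq_zero hKi
    filter_upwards [h0] with x hx
    exact hV.eq_of_eqOn τ ((hyss s).jetAt.field τ) (hys.jetAt.field τ) hKc
      (fun x' hx' => jetAt_eq_of_eq (fun t => (hyseq s t x' hx').symm) τ) hx
  obtain ⟨w, hw⟩ : ∃ w : ℝ → M → ZLVal N m, w = fun s => T.transf dG Λ (y + s • e) τ := ⟨_, rfl⟩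
  have hws : ∀ s, SmoothField n (w s) := fun s => by
    rw [hw]; exact (T.smoothFamily_transf hdG.1 hΛ (hyss s)).field τ
  have hw1 : ∀ (s : ℝ) x, (w s x).1 = sharp T.sig ((dG τ (jetAt k y τ + s • jetAt k e τ) x).comp
      (ContinuousLinearMap.inl ℝ (ZVal N) (Fin (k + 1) → Fin m → ℝ))) := by
    intro s x; rw [hw, ← hjet]; rfl
  have hw2 : ∀ (s : ℝ) x, (w s x).2 = Λ τ (jetAt k y τ + s • jetAt k e τ) x := by
    intro s x; rw [hw, ← hjet]; rfl
  have hwK : ∀ s, ∀ x ∉ K, w s x = w 0 x := by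
    intro s x hx
    have hon : EqOn (jetAt k y τ + s • jetAt k e τ) (jetAt k y τ + (0 : ℝ) • jetAt k e τ) Kᶜ := by
      intro x' hx'
      rw [← hjet, ← hjet]
      exact jetAt_eq_of_eq (fun t => ((hyseq s t x' hx').symm.trans (hyseq 0 t x' hx'))) τ
    refine Prod.ext ?_ ?_
    · rw [hw1, hw1, hdG.1.eq_of_eqOn τ (hline.field s) (hline.field 0) hKc hon hx]
    · rw [hw2, hw2, hΛ.eq_of_eqOn τ (hline.field s) (hline.field 0) hKc hon hx]
  -- `w s - w 0` is supported in the interior, where the variation of `H` is known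
  have hHs : ∀ s : ℝ, deriv (fun r : ℝ => T.H (y τ + r • w s)) 0 =
      deriv (fun r : ℝ => T.H (y τ + r • w 0)) 0 +
      ∫ x, (T.dHz (y τ) x ((w s - w 0) x).1 +
        ∑ a, T.φ (zPart (y τ)) x a * ((w s - w 0) x).2 a) ∂T.vol := by
    intro s
    have hd : SmoothField n (w s - w 0) :=
      ((hws s).family.sub (hws 0).family : SmoothFamily n
        (fun (_ : ℝ) x => w s x - w 0 x)).field 0
    have hsupp : tsupport (w s - w 0) ⊆ (𝓡∂ n).interior M := by
      refine (closure_minimal (fun x hx => ?_) hK).trans hKi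
      by_contra hxK
      exact hx (by simp [hwK s x hxK])
    rw [← (T.hasDerivAt_H_interior (hys.field τ) hd hsupp).deriv,
      ← T.deriv_H_add (hys.field τ) (hws 0) hd]
    simp
  have hlaw2 : ∀ s : ℝ,
      deriv (fun t => G.val T.vol T.bvol t (jetAt k y t + s • jetAt k e t)) τ =
      deriv (fun t => G.val T.vol T.bvol t (jetAt k y t + (0 : ℝ) • jetAt k e t)) τ -
        (∫ x, X 0 x ∂T.vol) + ∫ x, X s x ∂T.vol := by
    intro s
    have h1 := hlaw s
    have h0 := hlaw 0
    rw [hVs, hysτ, hzdot] at h1 h0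
    have hwr : ∀ s, T.transf dG Λ (y + s • e) τ = w s := fun s => by rw [hw]
    rw [hwr] at h1 h0
    rw [hHs] at h1
    simp_rw [hjet] at h1 h0
    rw [h1, h0]
    have hgi : ∀ s : ℝ, Integrable (fun x => dG τ (jetAt k y τ + s • jetAt k e τ) x
        (zDot y τ x, 0)) T.vol := fun s => (hdGl.clm (hżτ.prodMk hzero)).integrable s
    have hdiff : Integrable (fun x => T.dHz (y τ) x ((w s - w 0) x).1 +
        ∑ a, T.φ (zPart (y τ)) x a * ((w s - w 0) x).2 a) T.vol := by
      have hd : SmoothFamily n (fun (_ : ℝ) x => w s x - w 0 x) :=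
        (hws s).family.sub (hws 0).family
      exact (((T.smoothFamily_dHz hyτ).clm hd.fst).add
        (SmoothFamily.sum fun a _ => (hφτ a).mul (hd.snd.post (contDiff_apply ℝ ℝ a)))).integrable 0
    have key : ∫ x, X s x ∂T.vol - ∫ x, X 0 x ∂T.vol =
        (∫ x, dG τ (jetAt k y τ + s • jetAt k e τ) x (zDot y τ x, 0) ∂T.vol) -
        (∫ x, dG τ (jetAt k y τ + (0 : ℝ) • jetAt k e τ) x (zDot y τ x, 0) ∂T.vol) +
        ∫ x, (T.dHz (y τ) x ((w s - w 0) x).1 +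
          ∑ a, T.φ (zPart (y τ)) x a * ((w s - w 0) x).2 a) ∂T.vol := by
      rw [← integral_sub (hX.integrable s) (hX.integrable 0), ← integral_sub (hgi s) (hgi 0)]
      have h2 := integral_add ((hgi s).sub (hgi 0)) hdiff
      refine Eq.trans ?_ h2
      refine integral_congr_ae (Filter.Eventually.of_forall fun x => ?_)
      -- `δH/δz (σ g) = - g (σ δH/δz)`
      have hsw : ∀ s : ℝ, T.dHz (y τ) x (w s x).1 =
          - dG τ (jetAt k y τ + s • jetAt k e τ) x (T.flow (y τ) x, 0) := by
        intro s
        rw [hw1, apply_sharp_swap T.sig_antisymm]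
        rfl
      have hsub : ∀ s : ℝ, dG τ (jetAt k y τ + s • jetAt k e τ) x
          (zDot y τ x - T.flow (y τ) x, 0) =
          dG τ (jetAt k y τ + s • jetAt k e τ) x (zDot y τ x, 0) -
          dG τ (jetAt k y τ + s • jetAt k e τ) x (T.flow (y τ) x, 0) := by
        intro s
        rw [← map_sub]
        simp
      simp only [X, Pi.sub_apply, Prod.fst_sub, Prod.snd_sub, map_sub, hsw, hsub, hw2, mul_sub,
        Finset.sum_sub_distrib]
      ring
    linarith
  -- both sides of `hlaw2` are now differentiated in `s`, on the left after exchanging `d/ds`, `d/dt`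
  have hΓ : ContDiff ℝ ∞ (fun q : ℝ × ℝ =>
      G.val T.vol T.bvol q.2 (jetAt k y q.2 + q.1 • jetAt k e q.2)) :=
    LocalFunctional.contDiff_val T G (SmoothFamily.variation hys.jetAt he.jetAt) contDiff_snd
  have hswap := hasDerivAt_deriv_swap hΓ 0 τ
  have hpair : ∀ t, deriv (fun s : ℝ => G.val T.vol T.bvol t (jetAt k y t + s • jetAt k e t)) 0 =
      ∫ x, dG t (jetAt k y t) x (jetAt k e t x) ∂T.vol := by
    intro t
    refine (hdG.2 t _ _ (hys.jetAt.field t) (he.jetAt.field t) ?_).deriv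
    refine (closure_minimal (fun x hx => ?_) hK).trans hKi
    by_contra hxK
    refine hx ?_
    have h1 : jetAt k e t x = jetAt k (fun _ _ => (0 : ZLVal N m)) t x :=
      jetAt_eq_of_eq (fun t => heK t x hxK) t
    rw [h1]
    refine Prod.ext rfl (funext fun l => ?_)
    simp [jetAt]
  simp only [hpair] at hswap
  have hR := (hX.hasDerivAt_integral (μ := T.vol) 0).const_add
    (deriv (fun t => G.val T.vol T.bvol t (jetAt k y t + (0 : ℝ) • jetAt k e t)) τ -
        (∫ x, X 0 x ∂T.vol))
  rw [← funext hlaw2] at hR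
  rw [hswap.unique hR]
  refine integral_congr_ae (Filter.Eventually.of_forall fun x => ?_)
  have d1 := (hdG.1.hasDerivAt_line τ (hys.jetAt.field τ) (he.jetAt.field τ) x).clm_apply
    (hasDerivAt_const (0 : ℝ) (zDot y τ x - T.flow (y τ) x, (0 : Fin (k + 1) → Fin m → ℝ)))
  have d2 := hasDerivAt_pi.1 (hΛ.hasDerivAt_line τ (hys.jetAt.field τ) (he.jetAt.field τ) x)
  have d3 := d1.fun_add (HasDerivAt.fun_sum (u := Finset.univ) fun a _ =>
    (d2 a).const_mul (T.φ (zPart (y τ)) x a))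
  simpa using d3.deriv

end TheoryData

/-! ### Formal solutions of the equations of motion -/

section Taylor

/-- The Taylor monomial `(t - t₀)^l / l!`. -/
def taylorMonomial (l : ℕ) (t₀ t : ℝ) : ℝ := (t - t₀) ^ l / (l.factorial : ℝ)

theorem contDiff_taylorMonomial (l : ℕ) (t₀ : ℝ) : ContDiff ℝ ∞ (taylorMonomial l t₀) := by
  unfold taylorMonomial
  fun_prop

theorem deriv_taylorMonomial_succ (l : ℕ) (t₀ : ℝ) :
    deriv (taylorMonomial (l + 1) t₀) = taylorMonomial l t₀ := by
  funext t
  have h := (((hasDerivAt_id t).sub_const t₀).pow (l + 1)).div_const ((l + 1).factorial : ℝ)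
  refine h.deriv.trans ?_
  have : (l.factorial : ℝ) ≠ 0 := by positivity
  simp only [taylorMonomial, Nat.factorial_succ, Nat.cast_mul, Nat.cast_add, Nat.cast_one, id,
    Nat.add_sub_cancel, mul_one]
  field_simp

theorem iteratedDeriv_taylorMonomial (j l : ℕ) (t₀ : ℝ) :
    iteratedDeriv j (taylorMonomial l t₀) t₀ = if j = l then 1 else 0 := by
  induction j generalizing l with
  | zero => cases l <;> simp [taylorMonomial]
  | succ j ih =>
    rw [iteratedDeriv_succ']
    cases l with
    | zero =>
      have h : deriv (taylorMonomial 0 t₀) = fun _ => 0 := by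
        funext t; simp [show taylorMonomial 0 t₀ = fun _ => 1 by
          funext t; simp [taylorMonomial]]
      rw [h]
      simp
    | succ l => rw [deriv_taylorMonomial_succ, ih l]; simp

theorem vanishesTo_taylorMonomial (l : ℕ) (t₀ : ℝ) : VanishesTo l t₀ (taylorMonomial l t₀) :=
  fun i hi => by rw [iteratedDeriv_taylorMonomial, if_neg hi.ne]

theorem VanishesTo.smul_const {V : Type*} [NormedAddCommGroup V] [NormedSpace ℝ V] {p : ℕ}
    {t₀ : ℝ} {f : ℝ → ℝ} (hf : ContDiff ℝ ∞ f) (h : VanishesTo p t₀ f) (v : V) :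
    VanishesTo p t₀ (fun t => f t • v) := by
  simpa using h.clm (L := fun _ => ContinuousLinearMap.toSpanSingleton ℝ v) contDiff_const hf

theorem iteratedDeriv_smul_const {V : Type*} [NormedAddCommGroup V] [NormedSpace ℝ V] {f : ℝ → ℝ}
    (hf : ContDiff ℝ ∞ f) (v : V) (j : ℕ) :
    iteratedDeriv j (fun t => f t • v) = fun t => iteratedDeriv j f t • v := by
  induction j with
  | zero => simp
  | succ j ih =>
    rw [iteratedDeriv_succ, ih]
    funext t
    have h : DifferentiableAt ℝ (iteratedDeriv j f) t :=
      (hf.differentiable_iteratedDeriv j (mod_cast WithTop.coe_lt_top _)) t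
    rw [iteratedDeriv_succ]
    exact (h.hasDerivAt.smul_const v).deriv

end Taylor

namespace TheoryData

variable {n : ℕ} [NeZero n] {M : Type*} [TopologicalSpace M]
  [ChartedSpace (EuclideanHalfSpace n) M] [IsManifold (𝓡∂ n) ∞ M] [MeasurableSpace M]
  {N m r k : ℕ} (T : TheoryData n M N m r)

/-- Histories that agree to order `p` have Hamiltonian vector fields that agree to order `p`. -/
theorem vanishesTo_flow_sub {f g : ℝ → M → ZLVal N m} (hf : SmoothFamily n f)
    (hg : SmoothFamily n g) {p : ℕ} {t₀ : ℝ}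
    (h : ∀ x, VanishesTo p t₀ (fun t => f t x - g t x)) (x : M) :
    VanishesTo p t₀ (fun t => T.flow (f t) x - T.flow (g t) x) := by
  have hz : ∀ x, VanishesTo p t₀ (fun t => zPart (f t) x - zPart (g t) x) := fun x =>
    (h x).clm (L := fun _ => ContinuousLinearMap.fst ℝ (ZVal N) (Fin m → ℝ)) contDiff_const
      ((hf.at x).sub (hg.at x))
  have h1 := T.dh_spec.1.vanishesTo_sub hf.zPart hg.zPart hz x
  have h2 := T.dφ_spec.1.vanishesTo_sub hf hg h x
  have c1 : ContDiff ℝ ∞ (fun t => T.dh (zPart (f t)) x - T.dh (zPart (g t)) x) :=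
    ((T.smoothFamily_dh hf.zPart).at x).sub ((T.smoothFamily_dh hg.zPart).at x)
  have hφs : ∀ {f : ℝ → M → ZLVal N m}, SmoothFamily n f → SmoothFamily n (fun t => T.dφ (f t)) :=
    fun hf => T.dφ_spec.1.smoothFamily hf (contDiff_const (c := (0 : ℝ)))
  have c2 : ContDiff ℝ ∞ (fun t => T.dφ (f t) x - T.dφ (g t) x) :=
    ((hφs hf).at x).sub ((hφs hg).at x)
  -- restriction of a covector to the `z`-directions
  let ρ : (ZLVal N m →L[ℝ] ℝ) →L[ℝ] (ZVal N →L[ℝ] ℝ) :=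
    (ContinuousLinearMap.compL ℝ (ZVal N) (ZLVal N m) ℝ).flip
      (ContinuousLinearMap.inl ℝ (ZVal N) (Fin m → ℝ))
  have e : (fun t => T.flow (f t) x - T.flow (g t) x) = fun t =>
      sharpL T.sig (T.dh (zPart (f t)) x - T.dh (zPart (g t)) x) +
        ((sharpL T.sig).comp ρ) (T.dφ (f t) x - T.dφ (g t) x) := by
    funext t
    simp only [flow, ← sharpL_apply, dHz, dφz, map_add, map_sub, ContinuousLinearMap.comp_apply,
      ρ, ContinuousLinearMap.flip_apply, ContinuousLinearMap.compL_apply]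
    abel
  rw [e]
  exact (h1.clm (L := fun _ => sharpL T.sig) contDiff_const c1).add
    (contDiff_const.clm_apply c1) (contDiff_const.clm_apply c2)
    (h2.clm (L := fun _ => (sharpL T.sig).comp ρ) contDiff_const c2)

/-- The equations of motion can be solved to any finite order in time. -/
theorem exists_solution_to_order {lam : ℝ → M → Fin m → ℝ} (hlam : SmoothFamily n lam)
    {z₀ : M → ZVal N} (hz₀ : SmoothField n z₀) (t₀ : ℝ) (q : ℕ) :
    ∃ z : ℝ → M → ZVal N, SmoothFamily n z ∧ z t₀ = z₀ ∧ ∀ x, VanishesTo q t₀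
      (fun t => deriv (fun t => z t x) t - T.flow (fun x => (z t x, lam t x)) x) := by
  induction q with
  | zero => exact ⟨fun _ => z₀, hz₀.family, rfl, fun x => vanishesTo_zero_order _⟩
  | succ q ih =>
    obtain ⟨z, hz, hzt, hv⟩ := ih
    have hD : SmoothFamily n
        (fun t x => deriv (fun t => z t x) t - T.flow (fun x => (z t x, lam t x)) x) :=
      hz.deriv.sub (T.smoothFamily_flow (hz.prodMk hlam))
    -- the leading term of the equations of motion, to be removed by a correction of order `q + 1`
    let c : M → ZVal N := fun x => iteratedDeriv q
      (fun t => deriv (fun t => z t x) t - T.flow (fun x => (z t x, lam t x)) x) t₀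
    have hc : SmoothField n c := (hD.iteratedDeriv q).field t₀
    have hcorr : ∀ l, SmoothFamily n (fun t x => taylorMonomial l t₀ t • c x) := fun l =>
      (SmoothFamily.of_contDiff (contDiff_taylorMonomial l t₀)).smul hc.family
    have hz' : SmoothFamily n (fun t x => z t x - taylorMonomial (q + 1) t₀ t • c x) :=
      hz.sub (hcorr (q + 1))
    refine ⟨_, hz', ?_, fun x => ?_⟩
    · funext x
      simp [hzt, taylorMonomial]
    have hflow := T.vanishesTo_flow_sub (hz'.prodMk hlam) (hz.prodMk hlam) (p := q + 1)
      (t₀ := t₀) (fun x => by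
        have h := ((vanishesTo_taylorMonomial (q + 1) t₀).smul_const
          (contDiff_taylorMonomial _ _) ((-c x, 0) : ZLVal N m))
        convert h using 2 with t
        simp) x
    have hlead : VanishesTo (q + 1) t₀ (fun t => (deriv (fun t => z t x) t -
        T.flow (fun x => (z t x, lam t x)) x) - taylorMonomial q t₀ t • c x) := by
      intro i hi
      rw [iteratedDeriv_fun_sub ((hD.at x).of_le (mod_cast le_top)).contDiffAt
        (((hcorr q).at x).of_le (mod_cast le_top)).contDiffAt,
        iteratedDeriv_smul_const (contDiff_taylorMonomial q t₀)]
      simp only [iteratedDeriv_taylorMonomial]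
      rcases Nat.lt_succ_iff_lt_or_eq.1 hi with h | h
      · rw [hv x i h, if_neg h.ne]; simp
      · subst h; simp [c]
    have hfs : ContDiff ℝ ∞ (fun t =>
        T.flow (fun x => (z t x - taylorMonomial (q + 1) t₀ t • c x, lam t x)) x -
          T.flow (fun x => (z t x, lam t x)) x) :=
      ((T.smoothFamily_flow (hz'.prodMk hlam)).at x).sub
        ((T.smoothFamily_flow (hz.prodMk hlam)).at x)
    have h := hlead.add ((hD.sub (hcorr q)).at x) hfs.neg hflow.neg
    convert h using 2 with t
    have hd : deriv (fun t => z t x - taylorMonomial (q + 1) t₀ t • c x) t =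
        deriv (fun t => z t x) t - taylorMonomial q t₀ t • c x := by
      have h1 := ((contDiff_taylorMonomial (q + 1) t₀).differentiable (by simp) t).hasDerivAt
      rw [deriv_taylorMonomial_succ] at h1
      exact ((hz.differentiableAt t x).hasDerivAt.sub (h1.smul_const (c x))).deriv
    rw [hd]
    abel

/-- Local operators that are linear in their last argument vanish when that argument does. -/
theorem _root_.ExtSym.apply_zero_of_linear {V W W' : Type*} [NormedAddCommGroup V]
    [NormedSpace ℝ V] [NormedAddCommGroup W] [NormedSpace ℝ W] [NormedAddCommGroup W']
    [NormedSpace ℝ W'] {C : (M → V × W) → M → W'}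
    (hC : ∀ (w : M → V) (ψ ψ' : M → W) (c : ℝ), SmoothField n w →
      SmoothField n ψ → SmoothField n ψ' → ∀ x,
      C (fun x' => (w x', c • ψ x' + ψ' x')) x
        = c • C (fun x' => (w x', ψ x')) x + C (fun x' => (w x', ψ' x')) x)
    {w : M → V} (hw : SmoothField n w) (x : M) : C (fun x' => (w x', 0)) x = 0 := by
  have h0 : SmoothField n (fun _ : M => (0 : W)) := contMDiff_const
  simpa using hC w _ _ 1 hw h0 h0 x

theorem _root_.ExtSym.vanishesTo_of_linear {V W W' : Type*} [NormedAddCommGroup V]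
    [NormedSpace ℝ V] [NormedAddCommGroup W] [NormedSpace ℝ W] [NormedAddCommGroup W']
    [NormedSpace ℝ W'] {C : (M → V × W) → M → W'} (hCl : IsLocal n (fun _ : ℝ => C))
    (hC : ∀ (w : M → V) (ψ ψ' : M → W) (c : ℝ), SmoothField n w →
      SmoothField n ψ → SmoothField n ψ' → ∀ x,
      C (fun x' => (w x', c • ψ x' + ψ' x')) x
        = c • C (fun x' => (w x', ψ x')) x + C (fun x' => (w x', ψ' x')) x)
    {w : ℝ → M → V} (hw : SmoothFamily n w) {ψ : ℝ → M → W} (hψ : SmoothFamily n ψ) {p : ℕ}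
    {t₀ : ℝ} (h : ∀ x, VanishesTo p t₀ (fun t => ψ t x)) (x : M) :
    VanishesTo p t₀ (fun t => C (fun x' => (w t x', ψ t x')) x) := by
  have h0 : SmoothFamily n (fun (_ : ℝ) (_ : M) => (0 : W)) :=
    SmoothFamily.of_contDiff contDiff_const
  have h1 := hCl.vanishesTo_sub (p := p) (t := t₀) (hw.prodMk hψ) (hw.prodMk h0) (fun x => by
    have := (h x).clm (L := fun _ => ContinuousLinearMap.inr ℝ V W) contDiff_const (hψ.at x)
    convert this using 2 with t
    simp) x
  simpa [apply_zero_of_linear hC (hw.field _)] using h1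

/-- First class constraints propagate: a history that starts on the constraint surface and
satisfies the equations of motion to order `p` satisfies the constraints to order `p`. -/
theorem vanishesTo_constraints (hφ : T.ConstraintsFirstClass) (hh : T.HamiltonianFirstClass)
    {z : ℝ → M → ZVal N} (hz : SmoothFamily n z) {lam : ℝ → M → Fin m → ℝ}
    (hlam : SmoothFamily n lam) {t₀ : ℝ} {p : ℕ} (h0 : ∀ x, T.φ (z t₀) x = 0)
    (hv : ∀ x, VanishesTo p t₀
      (fun t => deriv (fun t => z t x) t - T.flow (fun x => (z t x, lam t x)) x)) (x : M) :
    VanishesTo p t₀ (fun t => T.φ (z t) x) := by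
  obtain ⟨C, hCl, hC, hCφ⟩ := hφ
  obtain ⟨D, hDl, hD, hDφ⟩ := hh
  have hw : SmoothFamily n (fun t x => (z t x, lam t x)) := hz.prodMk hlam
  have hφs := T.smoothFamily_φ hz
  let v : ℝ → M → ZVal N := fun t x =>
    deriv (fun t => z t x) t - T.flow (fun x => (z t x, lam t x)) x
  have hvs : SmoothFamily n v := hz.deriv.sub (T.smoothFamily_flow hw)
  have hd1 : SmoothFamily n (fun t x => sharp T.sig (T.dφz (fun x => (z t x, lam t x)) x)) :=
    (T.smoothFamily_dφz hw).sharp T.sig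
  have hd2 : SmoothFamily n (fun t x => sharp T.sig (T.dh (z t) x)) :=
    (T.smoothFamily_dh hz).sharp T.sig
  -- `dz/dt` is the sum of the fields generated by the constraints and by `h`, and of `v`; along the
  -- first two `φ` changes by a combination of the constraints
  have hφder : ∀ t x, deriv (fun t => T.φ (z t) x) t =
      C (fun x' => ((z t x', lam t x'), T.φ (z t) x')) x +
        D (fun x' => (z t x', T.φ (z t) x')) x +
        dirDeriv (fun _ => T.φ) t (z t) (v t) x := by
    intro t x
    have h1 := (T.φ_local.hasDerivAt_curve t hz t x).deriv
    have hsplit : (fun x => deriv (fun t => z t x) t) =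
        ((fun x => sharp T.sig (T.dφz (fun x => (z t x, lam t x)) x)) +
          (fun x => sharp T.sig (T.dh (z t) x))) + v t := by
      funext x
      have hf : T.flow (fun x => (z t x, lam t x)) x = sharp T.sig (T.dh (z t) x) +
          sharp T.sig (T.dφz (fun x => (z t x, lam t x)) x) := by
        rw [flow, dHz, ← sharpL_apply, map_add, sharpL_apply, sharpL_apply]
        rfl
      simp only [v, Pi.add_apply, hf]
      abel
    have hd12 : SmoothField n ((fun x => sharp T.sig (T.dφz (fun x => (z t x, lam t x)) x)) +
        (fun x => sharp T.sig (T.dh (z t) x))) := (hd1.add hd2).field t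
    rw [h1, hsplit, T.φ_local.dirDeriv_add t (hz.field t) hd12 (hvs.field t),
      T.φ_local.dirDeriv_add t (hz.field t) (hd1.field t) (hd2.field t)]
    congr 2
    · exact (hCφ _ (hw.field t) x).deriv
    · exact (hDφ _ (hz.field t) x).deriv
  -- if the constraints vanish to order `q`, so do their time derivatives
  have key : ∀ q ≤ p, ∀ x, VanishesTo q t₀ (fun t => T.φ (z t) x) := by
    intro q
    induction q with
    | zero => exact fun _ x => vanishesTo_zero_order _
    | succ q ih =>
      intro hq x
      have hq' : q ≤ p := (Nat.le_succ q).trans hq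
      rw [vanishesTo_succ]
      refine ⟨h0 x, ?_⟩
      rw [funext fun t => hφder t x]
      have s1 : ContDiff ℝ ∞ (fun t => C (fun x' => ((z t x', lam t x'), T.φ (z t) x')) x) :=
        (hCl.smoothFamily (hw.prodMk hφs) (contDiff_const (c := (0 : ℝ)))).at x
      have s2 : ContDiff ℝ ∞ (fun t => D (fun x' => (z t x', T.φ (z t) x')) x) :=
        (hDl.smoothFamily (hz.prodMk hφs) (contDiff_const (c := (0 : ℝ)))).at x
      have s3 : ContDiff ℝ ∞ (fun t => dirDeriv (fun _ => T.φ) t (z t) (v t) x) := by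
        have h := (hφs.at x)
        have h' : ContDiff ℝ ∞ (deriv (fun t => T.φ (z t) x)) := (contDiff_infty_iff_deriv.1 h).2
        rw [funext fun t => hφder t x] at h'
        have := h'.sub (s1.add s2)
        simpa using this
      refine (VanishesTo.add s1 s2 ?_ ?_).add (s1.add s2) s3 ?_
      · exact vanishesTo_of_linear hCl hC hw hφs (ih hq') x
      · exact vanishesTo_of_linear hDl hD hz hφs (ih hq') x
      · exact T.φ_local.vanishesTo_dirDeriv hz hvs (fun x => (hv x).mono hq') x
  exact key p le_rfl x

/-- Through every configuration on the constraint surface passes a history that satisfies the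
constraints and the equations of motion to any prescribed finite order in time. -/
theorem exists_history_to_order (hT : T.IsGaugeFieldTheory) {C : M → JVal N m k}
    (hC : SmoothField n C) (hφ : ∀ x, T.φ (fun x' => (C x').1) x = 0) (t₀ : ℝ) (p : ℕ) :
    ∃ y : ℝ → M → ZLVal N m, SmoothFamily n y ∧ jetAt k y t₀ = C ∧
      (∀ x, VanishesTo p t₀ (fun t => zDot y t x - T.flow (y t) x)) ∧
      ∀ x, VanishesTo p t₀ (fun t => T.φ (zPart (y t)) x) := by
  have hCf : SmoothFamily n (fun _ : ℝ => C) := hC.family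
  -- the Taylor polynomial in time with the prescribed derivatives
  let lam : ℝ → M → Fin m → ℝ := fun t x =>
    ∑ l : Fin (k + 1), taylorMonomial (l : ℕ) t₀ t • (C x).2 l
  have hCl : ∀ l, SmoothFamily n (fun (_ : ℝ) x => (C x).2 l) := fun l =>
    hCf.snd.post (contDiff_apply ℝ (Fin m → ℝ) l)
  have hlam : SmoothFamily n lam := SmoothFamily.sum fun l _ =>
    (SmoothFamily.of_contDiff (contDiff_taylorMonomial _ t₀)).smul (hCl l)
  obtain ⟨z, hz, hzt, hv⟩ := T.exists_solution_to_order hlam (hCf.fst.field 0) t₀ p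
  refine ⟨fun t x => (z t x, lam t x), hz.prodMk hlam, ?_, hv, ?_⟩
  · funext x
    refine Prod.ext (congrFun hzt x) (funext fun l => ?_)
    change iteratedDeriv (l : ℕ) (fun t => ∑ i : Fin (k + 1), taylorMonomial (i : ℕ) t₀ t •
      (C x).2 i) t₀ = (C x).2 l
    have hcd : ∀ i ∈ (Finset.univ : Finset (Fin (k + 1))), ContDiffAt ℝ (l : ℕ)
        (fun t => taylorMonomial (i : ℕ) t₀ t • (C x).2 i) t₀ := fun i _ =>
      (((contDiff_taylorMonomial (i : ℕ) t₀).smul contDiff_const).of_le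
        (mod_cast le_top)).contDiffAt
    rw [iteratedDeriv_fun_sum hcd]
    simp_rw [iteratedDeriv_smul_const (contDiff_taylorMonomial _ t₀),
      iteratedDeriv_taylorMonomial]
    simp [Fin.val_inj]
  · exact T.vanishesTo_constraints hT.constraints_firstClass hT.hamiltonian_firstClass hz hlam
      (fun x => by rw [hzt]; exact hφ x) hv

end TheoryData

/-! ### Recursion for the derivatives along the multipliers -/

section Recursion

theorem VanishesTo.congr {W : Type*} [NormedAddCommGroup W] [NormedSpace ℝ W] {p : ℕ} {t : ℝ}
    {f g : ℝ → W} (h : VanishesTo p t f) (hfg : g =ᶠ[nhds t] f) : VanishesTo p t g :=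
  fun i hi => (hfg.iteratedDeriv_eq i).trans (h i hi)

theorem vanishesTo_zero {W : Type*} [NormedAddCommGroup W] [NormedSpace ℝ W] (p : ℕ) (t : ℝ) :
    VanishesTo p t (fun _ => (0 : W)) :=
  fun i _ => by simp

/-- If `a_l + a_{l+1}' = R_l` near `t` for `l ≤ k`, with `a_{k+1} = 0` and with sources `R_l` that
vanish to order `k + 1` at `t`, then all `a_l` vanish at `t`: one derivative is lost in each of
the steps from `k + 1` down to `l`. -/
theorem eq_zero_of_recursion {k : ℕ} {t : ℝ} {a R : ℕ → ℝ → ℝ} (ha : ∀ l, ContDiff ℝ ∞ (a l))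
    (hR : ∀ l, ContDiff ℝ ∞ (R l)) (hRv : ∀ l ≤ k, VanishesTo (k + 1) t (R l))
    (hrec : ∀ l ≤ k, ∀ᶠ s in nhds t, a l s + deriv (a (l + 1)) s = R l s)
    (htop : a (k + 1) = 0) {l : ℕ} (hl : l ≤ k) : a l t = 0 := by
  have key : ∀ i j, i + j = k + 1 → VanishesTo (j + 1) t (a j) := by
    intro i
    induction i with
    | zero =>
      intro j hj
      rw [show j = k + 1 by omega, htop]
      exact vanishesTo_zero _ t
    | succ i ih =>
      intro j hj
      have h1 := (vanishesTo_succ.1 (ih (j + 1) (by omega))).2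
      have hd : ContDiff ℝ ∞ (deriv (a (j + 1))) := (contDiff_infty_iff_deriv.1 (ha _)).2
      refine (((hRv j (by omega)).mono (by omega)).add (hR j) hd.neg h1.neg).congr ?_
      filter_upwards [hrec j (by omega)] with s hs
      linarith
  have := key (k + 1 - l) l (by omega) 0 (Nat.succ_pos l)
  simpa using this

end Recursion

section Modes

variable {n : ℕ} [NeZero n] {M : Type*} [TopologicalSpace M]
  [ChartedSpace (EuclideanHalfSpace n) M] {N m : ℕ}

/-- The variation `η` of the `l`-th time derivative of the multiplier `λ^a`, all other arguments
`z, λ, …` being fixed. It is zero if `l > k`. -/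
def multiplierMode (N k l : ℕ) (a : Fin m) (η : M → ℝ) : M → JVal N m k :=
  fun x => η x • ((0 : ZVal N), fun j : Fin (k + 1) => if (j : ℕ) = l then Pi.single a 1 else 0)

theorem smoothField_multiplierMode {η : M → ℝ} (hη : SmoothField n η) (k l : ℕ) (a : Fin m) :
    SmoothField n (multiplierMode N k l a η) :=
  (((hη.family (E := ℝ)).smul (SmoothFamily.of_contDiff contDiff_const)).field 0)

theorem multiplierMode_eq_zero {η : M → ℝ} {x : M} (h : η x = 0) (k l : ℕ) (a : Fin m) :
    multiplierMode N k l a η x = 0 := by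
  simp [multiplierMode, h]

theorem multiplierMode_of_lt {k l : ℕ} (hl : k < l) (a : Fin m) (η : M → ℝ) :
    multiplierMode N k l a η = 0 := by
  funext x
  refine Prod.ext (by simp [multiplierMode]) (funext fun j => ?_)
  have : (j : ℕ) ≠ l := by omega
  simp [multiplierMode, this]

theorem multiplierMode_apply {k : ℕ} (l : Fin (k + 1)) (a : Fin m) (η : M → ℝ) (x : M) :
    multiplierMode N k l a η x = η x • ((0 : ZVal N), Pi.single l (Pi.single a 1)) := by
  refine congrArg (η x • ·) (Prod.ext rfl (funext fun j => ?_))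
  by_cases h : j = l
  · subst h; simp
  · have : (j : ℕ) ≠ l := fun h' => h (Fin.ext h')
    simp [h, this]

/-- The jet of a variation of `λ^a` that is a function of time times a function of space. -/
theorem jetAt_multiplier {θ : ℝ → ℝ} (hθ : ContDiff ℝ ∞ θ) (k : ℕ) (a : Fin m) (η : M → ℝ)
    (t : ℝ) (x : M) :
    jetAt k (fun t x => ((0 : ZVal N), θ t • η x • (Pi.single a 1 : Fin m → ℝ))) t x =
      ∑ j : Fin (k + 1), iteratedDeriv (j : ℕ) θ t • multiplierMode N k j a η x := by
  refine Prod.ext (by simp [jetAt, multiplierMode, Prod.fst_sum]) (funext fun j => ?_)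
  change iteratedDeriv (j : ℕ) (fun t => θ t • η x • (Pi.single a 1 : Fin m → ℝ)) t = _
  rw [iteratedDeriv_smul_const hθ, Prod.snd_sum, Finset.sum_apply,
    Finset.sum_eq_single j (fun i _ hi => ?_) (by simp)]
  · simp [multiplierMode]
  · have : (j : ℕ) ≠ i := fun h => hi (Fin.ext h.symm)
    simp [multiplierMode, this]

end Modes

section LocalDerivatives

variable {n : ℕ} [NeZero n] {M : Type*} [TopologicalSpace M]
  [ChartedSpace (EuclideanHalfSpace n) M] [IsManifold (𝓡∂ n) ∞ M]
  {V : Type*} [NormedAddCommGroup V] [NormedSpace ℝ V]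
  {W : Type*} [NormedAddCommGroup W] [NormedSpace ℝ W]

theorem IsLocal.smoothFamily_dirDeriv {L : ℝ → (M → V) → M → W} (hL : IsLocal n L)
    {f v : ℝ → M → V} (hf : SmoothFamily n f) (hv : SmoothFamily n v) :
    SmoothFamily n (fun t => dirDeriv L t (f t) (v t)) := by
  have h : SmoothFamily n (fun q : ℝ × ℝ => L q.1 (f q.1 + q.2 • v q.1)) :=
    hL.smoothFamily ((hf.comp_param contDiff_fst).add
      ((SmoothFamily.of_contDiff contDiff_snd).smul (hv.comp_param contDiff_fst))) contDiff_fst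
  exact h.deriv_right.comp_param (g := fun t : ℝ => (t, (0 : ℝ)))
    (contDiff_id.prodMk contDiff_const)

theorem IsLocal.dirDeriv_eq_zero {L : ℝ → (M → V) → M → W} (hL : IsLocal n L) (t : ℝ)
    {f v : M → V} (hf : SmoothField n f) (hv : SmoothField n v) {K : Set M} (hK : IsClosed K)
    (hvK : ∀ x ∉ K, v x = 0) {x : M} (hx : x ∉ K) : dirDeriv L t f v x = 0 := by
  have h : ∀ r : ℝ, L t (f + r • v) x = L t f x := fun r =>
    hL.eq_of_eqOn t ((SmoothFamily.line hf hv).field r) hf hK.isOpen_compl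
      (fun x' hx' => by simp [hvK x' hx']) hx
  simp [dirDeriv, h]

/-- The interior of a manifold with boundary is dense. -/
theorem dense_interior : Dense ((𝓡∂ n).interior M) := by
  intro x
  have h1 := extChartAt_target_subset_closure_interior (I := 𝓡∂ n) (x := x)
    (mem_extChartAt_target x)
  rw [mem_closure_iff_nhdsWithin_neBot] at h1
  rw [mem_closure_iff_frequently]
  have h2 : Filter.Tendsto (extChartAt (𝓡∂ n) x).symm
      (nhdsWithin (extChartAt (𝓡∂ n) x x) (interior (extChartAt (𝓡∂ n) x).target)) (nhds x) := by
    have := (continuousAt_extChartAt_symm (I := 𝓡∂ n) x).tendsto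
    rw [extChartAt_to_inv] at this
    exact this.mono_left nhdsWithin_le_nhds
  refine h2.frequently (Filter.Eventually.frequently ?_)
  filter_upwards [self_mem_nhdsWithin] with u hu
  have hut := interior_subset hu
  have hsrc := (extChartAt (𝓡∂ n) x).map_target hut
  rw [extChartAt_source] at hsrc
  refine ((𝓡∂ n).isInteriorPoint_iff_of_mem_atlas (n := ∞) (by simp)
    (chart_mem_atlas (EuclideanHalfSpace n) x) hsrc).2 ?_
  change extChartAt (𝓡∂ n) x ((extChartAt (𝓡∂ n) x).symm u) ∈
    interior (extChartAt (𝓡∂ n) x).target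
  rwa [(extChartAt (𝓡∂ n) x).right_inv hut]

end LocalDerivatives

namespace TheoryData

variable {n : ℕ} [NeZero n] {M : Type*} [TopologicalSpace M]
  [ChartedSpace (EuclideanHalfSpace n) M] [IsManifold (𝓡∂ n) ∞ M] [MeasurableSpace M]
  {N m r k : ℕ} (T : TheoryData n M N m r)

/-- The source of the recursion: it is built from the equations of motion and the constraints,
evaluated on the history `y`, and from the change of the transformation along `v`. -/
def recursionSource (dG : ℝ → (M → JVal N m k) → M → (JVal N m k →L[ℝ] ℝ))
    (Λ : ℝ → (M → JVal N m k) → M → Fin m → ℝ) (y : ℝ → M → ZLVal N m) (v : M → JVal N m k)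
    (t : ℝ) (x : M) : ℝ :=
  dirDeriv dG t (jetAt k y t) v x (zDot y t x - T.flow (y t) x, 0) +
    ∑ a, T.φ (zPart (y t)) x a * dirDeriv Λ t (jetAt k y t) v x a

variable {T} {dG : ℝ → (M → JVal N m k) → M → (JVal N m k →L[ℝ] ℝ)}
  {Λ : ℝ → (M → JVal N m k) → M → Fin m → ℝ}

theorem smoothFamily_recursionSource (hdG : IsLocal n dG) (hΛ : IsLocal n Λ)
    {y : ℝ → M → ZLVal N m} (hy : SmoothFamily n y) {v : M → JVal N m k} (hv : SmoothField n v) :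
    SmoothFamily n (T.recursionSource dG Λ y v) :=
  ((hdG.smoothFamily_dirDeriv hy.jetAt hv.family).clm
    ((hy.zDot.sub (T.smoothFamily_flow hy)).prodMk (SmoothFamily.of_contDiff contDiff_const))).add
    (SmoothFamily.sum fun a _ => ((T.smoothFamily_φ hy.zPart).post (contDiff_apply ℝ ℝ a)).mul
      ((hΛ.smoothFamily_dirDeriv hy.jetAt hv.family).post (contDiff_apply ℝ ℝ a)))

/-- The source vanishes to the order to which the equations of motion and the constraints hold on
the support of the variation. -/
theorem vanishesTo_recursionSource (hdG : IsLocal n dG) (hΛ : IsLocal n Λ)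
    {y : ℝ → M → ZLVal N m} (hy : SmoothFamily n y) {v : M → JVal N m k} (hv : SmoothField n v)
    {K : Set M} (hK : IsClosed K) (hvK : ∀ x ∉ K, v x = 0) {p : ℕ} {t₀ : ℝ}
    (hmot : ∀ x ∈ K, VanishesTo p t₀ (fun t => zDot y t x - T.flow (y t) x))
    (hcon : ∀ x ∈ K, VanishesTo p t₀ (fun t => T.φ (zPart (y t)) x)) (x : M) :
    VanishesTo p t₀ (fun t => T.recursionSource dG Λ y v t x) := by
  have s1 := (hdG.smoothFamily_dirDeriv hy.jetAt hv.family).at x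
  have s2 := (hΛ.smoothFamily_dirDeriv hy.jetAt hv.family).at x
  have s3 := (hy.zDot.sub (T.smoothFamily_flow hy)).at x
  have s4 := (T.smoothFamily_φ hy.zPart).at x
  by_cases hx : x ∈ K
  · have e : (fun t => T.recursionSource dG Λ y v t x) = fun t =>
        ((dirDeriv dG t (jetAt k y t) v x).comp
          (ContinuousLinearMap.inl ℝ (ZVal N) (Fin (k + 1) → Fin m → ℝ)))
            (zDot y t x - T.flow (y t) x) +
        (∑ a, dirDeriv Λ t (jetAt k y t) v x a • ContinuousLinearMap.proj (R := ℝ)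
          (φ := fun _ : Fin m => ℝ) a) (T.φ (zPart (y t)) x) := by
      funext t
      simp [recursionSource, mul_comm]
    have c1 : ContDiff ℝ ∞ (fun t => (dirDeriv dG t (jetAt k y t) v x).comp
          (ContinuousLinearMap.inl ℝ (ZVal N) (Fin (k + 1) → Fin m → ℝ))) :=
      s1.clm_comp contDiff_const
    have c2 : ContDiff ℝ ∞ (fun t => ∑ a, dirDeriv Λ t (jetAt k y t) v x a •
        ContinuousLinearMap.proj (R := ℝ) (φ := fun _ : Fin m => ℝ) a) :=
      ContDiff.sum fun a _ => ((contDiff_apply ℝ ℝ a).comp s2).smul contDiff_const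
    rw [e]
    exact ((hmot x hx).clm c1 s3).add (c1.clm_apply s3) (c2.clm_apply s4) ((hcon x hx).clm c2 s4)
  · have e : (fun t => T.recursionSource dG Λ y v t x) = fun _ => 0 := by
      funext t
      simp [recursionSource, hdG.dirDeriv_eq_zero t (hy.jetAt.field t) hv hK hvK hx,
        hΛ.dirDeriv_eq_zero t (hy.jetAt.field t) hv hK hvK hx]
    rw [e]
    exact vanishesTo_zero p t₀

variable [CompactSpace M] [BorelSpace M]

/-- The recursion between the derivatives of `G` along successive time derivatives of `λ^a`. It
follows from the variation `(t - τ)^(l+1) / (l+1)! · η` of `λ^a`. -/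
theorem multiplier_recursion {G U : LocalFunctional n M (JVal N m k)}
    (hdG : IsFunctionalDerivative n T.vol (G.val T.vol T.bvol) dG)
    (hΛ : IsLocal n Λ)
    {k' : ℕ} {V : ℝ → (M → JVal N m k') → M → ℝ} (hV : IsLocal n V)
    (hact : ∀ t₀ t₁ : ℝ, t₀ < t₁ → ∀ y : ℝ → M → ZLVal N m, T.Admissible t₀ t₁ y →
      HasDerivAt (fun s : ℝ => T.action t₀ t₁ (y + s • T.transf dG Λ y))
        (U.val T.vol T.bvol t₁ (jetAt k y t₁) - U.val T.vol T.bvol t₀ (jetAt k y t₀)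
          + ∫ t in t₀..t₁, ∫ x, V t (jetAt k' y t) x ∂T.bvol) 0)
    (hcan : ∀ (t : ℝ) (C : M → JVal N m k), SmoothField n C →
      G.val T.vol T.bvol t C =
        (∫ x, (1 / 2 : ℝ) * ((C x).1 ⬝ᵥ (T.sig⁻¹).mulVec (T.genZ dG t C x)) ∂T.vol)
          - U.val T.vol T.bvol t C)
    {t₀ t₁ : ℝ} {y : ℝ → M → ZLVal N m} (hy : T.Admissible t₀ t₁ y) {τ : ℝ}
    (hτ : τ ∈ Ioo t₀ t₁) {η : M → ℝ} (hη : SmoothField n η)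
    (hηi : tsupport η ⊆ (𝓡∂ n).interior M) (a : Fin m) {l : ℕ} (hl : l ≤ k) :
    (∫ x, dG τ (jetAt k y τ) x (multiplierMode N k l a η x) ∂T.vol) +
      deriv (fun t => ∫ x, dG t (jetAt k y t) x (multiplierMode N k (l + 1) a η x) ∂T.vol) τ =
    ∫ x, T.recursionSource dG Λ y (multiplierMode N k (l + 1) a η) τ x ∂T.vol := by
  have := T.vol_smooth.isFiniteMeasure
  have hys : SmoothFamily n y := hy.smooth
  have hθ := contDiff_taylorMonomial (l + 1) τ
  let e : ℝ → M → ZLVal N m := fun t x =>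
    (0, taylorMonomial (l + 1) τ t • η x • (Pi.single a 1 : Fin m → ℝ))
  have he : SmoothFamily n e := (SmoothFamily.of_contDiff contDiff_const).prodMk
    ((SmoothFamily.of_contDiff hθ).smul
      (hη.family.smul (SmoothFamily.of_contDiff contDiff_const)))
  have hη0 : ∀ x ∉ tsupport η, η x = 0 := fun x hx => image_eq_zero_of_notMem_tsupport hx
  have hpair := T.deriv_pairing_eq hdG hΛ hV hact hcan hy hτ he (isClosed_tsupport η) hηi
    (fun t x hx => by simp [e, hη0 x hx]) (fun _ _ => rfl)
    (by funext x; simp [e, taylorMonomial])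
  have hje : ∀ t x, jetAt k e t x = ∑ j : Fin (k + 1),
      iteratedDeriv (j : ℕ) (taylorMonomial (l + 1) τ) t • multiplierMode N k j a η x :=
    fun t x => jetAt_multiplier hθ k a η t x
  have hjτ : jetAt k e τ = multiplierMode N k (l + 1) a η := by
    funext x
    rw [hje]
    simp only [iteratedDeriv_taylorMonomial]
    rcases Nat.lt_or_ge l k with h | h
    · rw [Finset.sum_eq_single (⟨l + 1, by omega⟩ : Fin (k + 1)) (fun i _ hi => ?_) (by simp)]
      · simp
      · have : (i : ℕ) ≠ l + 1 := fun h' => hi (Fin.ext h')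
        simp [this]
    · rw [multiplierMode_of_lt (by omega : k < l + 1)]
      refine Finset.sum_eq_zero fun i _ => ?_
      have : (i : ℕ) ≠ l + 1 := by omega
      simp [this]
  let A : ℕ → ℝ → ℝ := fun j t => ∫ x, dG t (jetAt k y t) x (multiplierMode N k j a η x) ∂T.vol
  have hfam : ∀ j : ℕ, SmoothFamily n
      (fun t x => dG t (jetAt k y t) x (multiplierMode N k j a η x)) := fun j =>
    (hdG.1.smoothFamily hys.jetAt contDiff_id).clm (smoothField_multiplierMode hη k j a).family
  have hA : ∀ j, ContDiff ℝ ∞ (A j) := fun j => (hfam j).contDiff_integral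
  -- at `t = τ` only the derivative of order `l + 1` of the monomial is nonzero
  have hsum : (fun t => ∫ x, dG t (jetAt k y t) x (jetAt k e t x) ∂T.vol) = fun t =>
      ∑ j : Fin (k + 1), iteratedDeriv (j : ℕ) (taylorMonomial (l + 1) τ) t * A j t := by
    funext t
    simp only [hje, map_sum, map_smul, smul_eq_mul]
    refine (integral_finsetSum (μ := T.vol) Finset.univ (f := fun (j : Fin (k + 1)) x =>
      iteratedDeriv (j : ℕ) (taylorMonomial (l + 1) τ) t *
        dG t (jetAt k y t) x (multiplierMode N k j a η x))
      fun j _ => ((hfam j).integrable t).const_mul _).trans ?_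
    simp only [integral_const_mul, A]
  have hder : HasDerivAt (fun t =>
      ∑ j : Fin (k + 1), iteratedDeriv (j : ℕ) (taylorMonomial (l + 1) τ) t * A j t)
      (∑ j : Fin (k + 1), (iteratedDeriv ((j : ℕ) + 1) (taylorMonomial (l + 1) τ) τ * A j τ +
        iteratedDeriv (j : ℕ) (taylorMonomial (l + 1) τ) τ * deriv (A j) τ)) τ := by
    refine HasDerivAt.fun_sum fun j _ => ?_
    have h1 : HasDerivAt (iteratedDeriv (j : ℕ) (taylorMonomial (l + 1) τ))
        (iteratedDeriv ((j : ℕ) + 1) (taylorMonomial (l + 1) τ) τ) τ := by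
      rw [iteratedDeriv_succ]
      exact ((hθ.differentiable_iteratedDeriv (j : ℕ) (by exact_mod_cast ENat.natCast_lt_top _)) τ
        ).hasDerivAt
    exact h1.mul (((hA j).differentiable (by simp)) τ).hasDerivAt
  rw [hsum, hder.deriv, hjτ] at hpair
  refine Eq.trans ?_ hpair
  simp only [iteratedDeriv_taylorMonomial, Nat.add_right_cancel_iff, Finset.sum_add_distrib]
  congr 1
  · rw [Finset.sum_eq_single (⟨l, by omega⟩ : Fin (k + 1)) (fun i _ hi => ?_) (by simp)]
    · simp [A]
    · have : (i : ℕ) ≠ l := fun h' => hi (Fin.ext h')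
      simp [this]
  · change deriv (A (l + 1)) τ = _
    rcases Nat.lt_or_ge l k with h | h
    · rw [Finset.sum_eq_single (⟨l + 1, by omega⟩ : Fin (k + 1)) (fun i _ hi => ?_) (by simp)]
      · simp
      · have : (i : ℕ) ≠ l + 1 := fun h' => hi (Fin.ext h')
        simp [this]
    · have h0 : A (l + 1) = fun _ => 0 := by
        funext t
        simp [A, multiplierMode_of_lt (by omega : k < l + 1)]
      rw [h0, deriv_const]
      refine (Finset.sum_eq_zero fun i _ => ?_).symm
      have : (i : ℕ) ≠ l + 1 := by omega
      simp [this]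

end TheoryData

/-! ### Vanishing of the derivatives along the multipliers -/

namespace TheoryData

variable {n : ℕ} [NeZero n] {M : Type*} [TopologicalSpace M] [T2Space M] [CompactSpace M]
  [ChartedSpace (EuclideanHalfSpace n) M] [IsManifold (𝓡∂ n) ∞ M] [MeasurableSpace M]
  [BorelSpace M] {N m r k : ℕ} {T : TheoryData n M N m r}
  {dG : ℝ → (M → JVal N m k) → M → (JVal N m k →L[ℝ] ℝ)}
  {Λ : ℝ → (M → JVal N m k) → M → Fin m → ℝ}

/-- Near an interior point, any history can be deformed, without losing admissibility, into one
that satisfies the constraints and the equations of motion there to finite order in time and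
passes through a given configuration on the constraint surface. -/
theorem exists_admissible_to_order (hT : T.IsGaugeFieldTheory) {t₀ t₁ : ℝ}
    {y₀ : ℝ → M → ZLVal N m} (hy₀ : T.Admissible t₀ t₁ y₀) {C : M → JVal N m k}
    (hC : SmoothField n C) (hφ : ∀ x, T.φ (fun x' => (C x').1) x = 0) (τ : ℝ) (p : ℕ) {x : M}
    (hx : x ∈ (𝓡∂ n).interior M) :
    ∃ (y : ℝ → M → ZLVal N m) (O : Set M), T.Admissible t₀ t₁ y ∧ IsOpen O ∧ x ∈ O ∧
      O ⊆ (𝓡∂ n).interior M ∧ EqOn (jetAt k y τ) C O ∧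
      (∀ x ∈ O, VanishesTo p τ (fun t => zDot y t x - T.flow (y t) x)) ∧
      ∀ x ∈ O, VanishesTo p τ (fun t => T.φ (zPart (y t)) x) := by
  obtain ⟨y', hy', hyC, hmot, hcon⟩ := T.exists_history_to_order hT hC hφ τ p
  have hint : IsOpen ((𝓡∂ n).interior M) := (𝓡∂ n).isOpen_interior (n := ∞) (by simp)
  obtain ⟨κ, hκ, hκi, hκ1, -⟩ := exists_smooth_cutoff (n := n) (hint.mem_nhds hx)
  obtain ⟨O, hO1, hO, hxO⟩ := mem_nhds_iff.1 (Filter.inter_mem hκ1 (hint.mem_nhds hx))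
  have hy₀s : SmoothFamily n y₀ := hy₀.smooth
  let y : ℝ → M → ZLVal N m := fun t x => y₀ t x + κ x • (y' t x - y₀ t x)
  have hy : SmoothFamily n y := hy₀s.add (hκ.family.smul (hy'.sub hy₀s))
  have hyO : ∀ t, EqOn (y t) (y' t) O := by
    intro t x hx
    have h1 : κ x = 1 := (hO1 hx).1
    simp [y, h1]
  refine ⟨y, O, hy₀.congr hy (isClosed_tsupport κ) hκi fun t x hx => ?_, hO, hxO,
    fun x hx => (hO1 hx).2, fun x hx => ?_, fun x hx => ?_, fun x hx => ?_⟩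
  · simp [y, image_eq_zero_of_notMem_tsupport hx]
  · rw [← hyC]
    exact jetAt_eq_of_eq (fun t => hyO t hx) τ
  · have e : (fun t => zDot y t x - T.flow (y t) x) = fun t => zDot y' t x - T.flow (y' t) x := by
      funext t
      rw [zDot_eq_of_eq (fun t => hyO t hx),
        T.flow_eq_of_eqOn (hy.field t) (hy'.field t) hO (hyO t) hx]
    rw [e]
    exact hmot x
  · have e : (fun t => T.φ (zPart (y t)) x) = fun t => T.φ (zPart (y' t)) x := by
      funext t
      rw [T.φ_eq_of_eqOn (hy.field t) (hy'.field t) hO (hyO t) hx]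
    rw [e]
    exact hcon x

/-- The conclusion at interior points and interior times: by locality `C` may be replaced by the
jet of the history of `exists_admissible_to_order`, on which the recursion forces the integrals
against all `η` supported near `x` to vanish. -/
theorem apply_single_eq_zero_of_interior {G U : LocalFunctional n M (JVal N m k)}
    (hT : T.IsGaugeFieldTheory)
    (hdG : IsFunctionalDerivative n T.vol (G.val T.vol T.bvol) dG) (hΛ : IsLocal n Λ)
    {k' : ℕ} {V : ℝ → (M → JVal N m k') → M → ℝ} (hV : IsLocal n V)
    (hact : ∀ t₀ t₁ : ℝ, t₀ < t₁ → ∀ y : ℝ → M → ZLVal N m, T.Admissible t₀ t₁ y →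
      HasDerivAt (fun s : ℝ => T.action t₀ t₁ (y + s • T.transf dG Λ y))
        (U.val T.vol T.bvol t₁ (jetAt k y t₁) - U.val T.vol T.bvol t₀ (jetAt k y t₀)
          + ∫ t in t₀..t₁, ∫ x, V t (jetAt k' y t) x ∂T.bvol) 0)
    (hcan : ∀ (t : ℝ) (C : M → JVal N m k), SmoothField n C →
      G.val T.vol T.bvol t C =
        (∫ x, (1 / 2 : ℝ) * ((C x).1 ⬝ᵥ (T.sig⁻¹).mulVec (T.genZ dG t C x)) ∂T.vol)
          - U.val T.vol T.bvol t C)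
    {t₀ t₁ : ℝ} {y₀ : ℝ → M → ZLVal N m} (hy₀ : T.Admissible t₀ t₁ y₀) {τ : ℝ}
    (hτ : τ ∈ Ioo t₀ t₁) {C : M → JVal N m k} (hC : SmoothField n C)
    (hφ : ∀ x, T.φ (fun x' => (C x').1) x = 0) (l : Fin (k + 1)) (a : Fin m) {x : M}
    (hx : x ∈ (𝓡∂ n).interior M) :
    dG τ C x (0, Pi.single l (Pi.single a 1)) = 0 := by
  have := T.vol_smooth.isFiniteMeasure
  obtain ⟨y, O, hy, hO, hxO, hOi, hyC, hmot, hcon⟩ :=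
    exists_admissible_to_order hT hy₀ hC hφ τ (k + 1) hx
  have hys : SmoothFamily n y := hy.smooth
  have hg : Continuous fun x =>
      dG τ (jetAt k y τ) x (0, Pi.single l (Pi.single a 1)) :=
    ContMDiff.continuous ((((hdG.1.smoothFamily hys.jetAt contDiff_id).clm
      (SmoothFamily.of_contDiff contDiff_const)).field τ))
  rw [← hdG.1.eq_of_eqOn τ (hys.jetAt.field τ) hC hO hyC hxO]
  refine eq_zero_of_forall_integral_mul_eq_zero T.vol_smooth hg hx (hO.mem_nhds hxO)
    fun η hη hηO => ?_
  have hη0 : ∀ x ∉ tsupport η, η x = 0 := fun x hx => image_eq_zero_of_notMem_tsupport hx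
  have hmode := fun j : ℕ => smoothField_multiplierMode (N := N) hη k j a
  have hsrc := fun j : ℕ => smoothFamily_recursionSource (T := T) hdG.1 hΛ hys (hmode j)
  have hfam : ∀ j : ℕ, SmoothFamily n
      (fun t x => dG t (jetAt k y t) x (multiplierMode N k j a η x)) := fun j =>
    (hdG.1.smoothFamily hys.jetAt contDiff_id).clm (hmode j).family
  have h := eq_zero_of_recursion (k := k) (t := τ)
    (a := fun j t => ∫ x, dG t (jetAt k y t) x (multiplierMode N k j a η x) ∂T.vol)
    (R := fun j t => ∫ x, T.recursionSource dG Λ y (multiplierMode N k (j + 1) a η) t x ∂T.vol)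
    (fun j => (hfam j).contDiff_integral) (fun j => (hsrc (j + 1)).contDiff_integral)
    (fun j _ => (hsrc (j + 1)).vanishesTo_integral fun x =>
      vanishesTo_recursionSource hdG.1 hΛ hys (hmode _) (isClosed_tsupport η)
        (fun x hx => multiplierMode_eq_zero (hη0 x hx) k _ a)
        (fun x hx => hmot x (hηO hx)) (fun x hx => hcon x (hηO hx)) x)
    (fun j hj => by
      filter_upwards [Ioo_mem_nhds hτ.1 hτ.2] with s hs
      exact multiplier_recursion hdG hΛ hV hact hcan hy hs hη (hηO.trans hOi) a hj)
    (by funext t; simp [multiplierMode_of_lt (Nat.lt_succ_self k)])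
    (Nat.lt_succ_iff.1 l.2)
  simpa only [multiplierMode_apply, map_smul, smul_eq_mul, mul_comm] using h

end TheoryData

end ExtSym

end

theorem mainTheorem7 {n : ℕ} [NeZero n] {M : Type*} [TopologicalSpace M] [T2Space M]
    [CompactSpace M] [ChartedSpace (EuclideanHalfSpace n) M] [IsManifold (𝓡∂ n) ∞ M]
    [MeasurableSpace M] [BorelSpace M] {N m r k : ℕ}
    (T : ExtSym.TheoryData n M N m r) (hT : T.IsGaugeFieldTheory)
    (G : ExtSym.LocalFunctional n M (ExtSym.JVal N m k))
    (dG : ℝ → (M → ExtSym.JVal N m k) → M → (ExtSym.JVal N m k →L[ℝ] ℝ))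
    (hdG : ExtSym.IsFunctionalDerivative n T.vol (G.val T.vol T.bvol) dG)
    (Λ : ℝ → (M → ExtSym.JVal N m k) → M → Fin m → ℝ) (hΛ : ExtSym.IsLocal n Λ)
    (hG : T.IsCouple G dG Λ) (hsym : T.IsExternalSymmetry G dG Λ) :
    ∀ (l : Fin (k + 1)) (a : Fin m),
      T.WeaklyZero (fun t C x => dG t C x (0, Pi.single l (Pi.single a 1))) := by
  intro l a t ht C hC hφ x
  obtain ⟨t₀, t₁, h01, ht, y₀, hy₀⟩ := ht
  obtain ⟨U, k', V, hV, -, hact, hcan⟩ := hsym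
  have hfam : ExtSym.SmoothFamily n
      (fun t x => dG t C x (0, Pi.single l (Pi.single a 1))) :=
    (hdG.1.smoothFamily hC.family contDiff_id).clm
      (ExtSym.SmoothFamily.of_contDiff contDiff_const)
  -- interior points and interior times are dense
  have hcl : IsClosed {q : ℝ × M | dG q.1 C q.2 (0, Pi.single l (Pi.single a 1)) = 0} :=
    isClosed_eq hfam.continuous continuous_const
  have hsub : Set.Ioo t₀ t₁ ×ˢ (𝓡∂ n).interior M ⊆
      {q : ℝ × M | dG q.1 C q.2 (0, Pi.single l (Pi.single a 1)) = 0} := fun q hq =>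
    ExtSym.TheoryData.apply_single_eq_zero_of_interior hT hdG hΛ hV hact hcan hy₀ hq.1 hC hφ l a
      hq.2
  refine closure_minimal hsub hcl (a := (t, x)) ?_
  rw [closure_prod_eq, closure_Ioo h01.ne]
  exact ⟨ht, ExtSym.dense_interior x⟩
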